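/- **Setting.** Let $0<\gamma<\pi/2$, $\eta=i\gamma$, $q=e^{\eta}$, $q^x:=e^{\eta x}$ for $x\in\mathbb C$, let $N=2M$ with $M\ge 1$, let $\beta,\kappa,\alpha\in\mathbb C$ with $1+q^{2\kappa}\neq 0$, and put $\operatorname{cth}=\cosh/\sinh$, $$a(\lambda)=\Bigl(\tfrac{\sinh(\lambda+\beta/N)}{\sinh(\lambda+\beta/N-\eta)}\Bigr)^{N/2},\qquad d(\lambda)=\Bigl(\tfrac{\sinh(\lambda-\beta/N)}{\sinh(\lambda-\beta/N+\eta)}\Bigr)^{N/2}.$$ For each of the two twists $k=\kappa$ and $k=\kappa+\alpha$ let $Q(\lambda|k)=\prod_{j=1}^{N/2}\sinh(\lambda-\lambda_j(k))$ and $\Lambda(\lambda|k)$ be a solution of Baxter's equation $$\Lambda(\lambda|k)Q(\lambda|k)=q^{k}a(\lambda)Q(\lambda-\eta|k)+q^{-k}d(\lambda)Q(\lambda+\eta|k),$$ with $\Lambda(\cdot|k)$ holomorphic away from the poles of $a$ and $d$ (for instance the dominant eigenvalue of the quantum transfer matrix of the six-vertex model with its $Q$-function). Let $C$ be the positively oriented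 boundary of the rectangle $|\operatorname{Re}\lambda|\le R$, $|\operatorname{Im}\lambda|\le h$, where $R>0$ and $0<h<\gamma/2$. Assume that $\beta/N$ and all Bethe roots $\lambda_j(\kappa)$, $\lambda_j(\kappa+\alpha)$ lie inside $C$ and that $\Lambda(\cdot|\kappa)$ and $\Lambda(\cdot|\kappa+\alpha)$ have no zeros on or inside $C$. Put $$\mathfrak a(\lambda|\kappa)=\frac{q^{-2\kappa}d(\lambda)Q(\lambda+\eta|\kappa)}{a(\lambda)Q(\lambda-\eta|\kappa)},\quad \rho(\lambda)=\frac{\Lambda(\lambda|\kappa+\alpha)}{\Lambda(\lambda|\kappa)},\quad dm(\lambda)=\frac{d\lambda}{2\pi i\,\rho(\lambda)(1+\mathfrak a(\lambda|\kappa))},$$ $$K_\alpha(\lambda)=q^{-\alpha}\operatorname{cth}(\lambda-\eta)-q^{\alpha}\operatorname{cth}(\lambda+\eta).$$ For $\nu$ inside $C$, let $G(\cdot,\nu)$ be the solution, assumed to be unique among continuous functions on $C$, of $$G(\lambda,\nu)=q^{-\alpha}\operatorname{cth}(\lambda-\nu-\eta)-\rho(\nu)\operatorname{cth}(\lambda-\nu)+\int_C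 dm(\mu)\,K_\alpha(\lambda-\mu)G(\mu,\nu),$$ and for $\nu_1,\nu_2$ inside $C$ let $$\Psi(\nu_1,\nu_2)=\int_C dm(\mu)\,G(\mu,\nu_2)\bigl(q^{\alpha}\operatorname{cth}(\mu-\nu_1-\eta)-\rho(\nu_1)\operatorname{cth}(\mu-\nu_1)\bigr).$$ Let $D=\{z:|\operatorname{Im}z|<\gamma/2\}\cup\{z:\operatorname{Re}z>R\}$. Both functions are continued meromorphically to arguments in $D$: first in the first argument, for each fixed second argument inside $C$, and then in the second argument, for each fixed first argument in $D$ (for $\Psi$: each $\nu_1\in D$ that is not a zero of $\Lambda(\cdot|\kappa)$). Removable singularities are removed, and the value $0$ is assigned at poles. **Lemma (asymptotic behaviour of $G$ and $\Psi$).** The following limits hold, as the real part of the indicated argument tends to $+\infty$ and uniformly in its imaginary part. 1. $\displaystyle\lim_{\operatorname{Re}\lambda\to\infty}G(\lambda,\nu)=0$ for every $\nu\in D$ with $\Lambda(\nu|\kappa)\ne0$, and $\displaystyle\lim_{\operatorname{Re}\nu\to\infty}G(\lambda,\nu)=0$ for every $\lambda\in D$. 2. $\displaystyle\lim_{\operatorname{Re}\nu_1\to\infty}\Psi(\nu_1,\nu_2)=-\frac{q^{-\alpha}-\rho(\nu_2)}{1+q^{2\kappa}}$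 for every $\nu_2\in D$ with $\Lambda(\nu_2|\kappa)\neq0$, and $\displaystyle\lim_{\operatorname{Re}\nu_2\to\infty}\Psi(\nu_1,\nu_2)=-\frac{q^{\alpha}-\rho(\nu_1)}{1+q^{-2\kappa}}$ for every $\nu_1\in D$ with $\Lambda(\nu_1|\kappa)\neq0$. -/

import Mathlib

open Filter Topology

namespace SixVertex

/-- The hyperbolic cotangent `cth z = cosh z / sinh z`. -/
noncomputable def cth (z : ℂ) : ℂ := Complex.cosh z / Complex.sinh z

/-- The data of the problem.  The anisotropy is `η = iγ`, the deformation parameter is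
`q = exp η`, the (even) Trotter number is `N = 2 M`, `κ` is the twist, `α` the disorder
parameter; `R` and `h` are half the width and half the height of the rectangular contour `C`.
`Λ₀`, `roots₀` are the transfer matrix eigenvalue and the Bethe roots for the twist `κ`, and
`Λ₁`, `roots₁` are those for the twist `κ + α`.  No property is imposed here. -/
structure Data where
  γ : ℝ
  β : ℂ
  M : ℕ
  κ : ℂ
  α : ℂ
  R : ℝ
  h : ℝ
  Λ₀ : ℂ → ℂ
  roots₀ : Fin M → ℂ
  Λ₁ : ℂ → ℂ
  roots₁ : Fin M → ℂ

namespace Data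

variable (S : Data)

/-- `η = iγ`. -/
noncomputable def η : ℂ := Complex.I * (S.γ : ℂ)

/-- The power `q ^ x = exp (η x)`. -/
noncomputable def qpow (x : ℂ) : ℂ := Complex.exp (S.η * x)

/-- The shift `β / N`, where `N = 2 M`. -/
noncomputable def shift : ℂ := S.β / (2 * (S.M : ℂ))

/-- The pseudo vacuum eigenvalue `a(z)`. -/
noncomputable def vacA (z : ℂ) : ℂ :=
  (Complex.sinh (z + S.shift) / Complex.sinh (z + S.shift - S.η)) ^ S.M

/-- The pseudo vacuum eigenvalue `d(z)`. -/
noncomputable def vacD (z : ℂ) : ℂ :=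
  (Complex.sinh (z - S.shift) / Complex.sinh (z - S.shift + S.η)) ^ S.M

/-- The function `Q(z) = ∏ⱼ sinh (z - λⱼ)` with zeros `λⱼ`, `j = 1, …, N / 2`. -/
noncomputable def qFun (roots : Fin S.M → ℂ) (z : ℂ) : ℂ :=
  ∏ j, Complex.sinh (z - roots j)

/-- `Λ` and the `Q`-function with the given roots solve Baxter's `t`-`Q`-equation with twist `k`,
`Λ(z) Q(z) = q ^ k a(z) Q(z - η) + q ^ (-k) d(z) Q(z + η)`,
where `Λ` is holomorphic away from the poles of `a` and `d`.  (Equivalently: `Λ` is the quotient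
of the right-hand side by `Q`, and the roots solve the Bethe ansatz equations.) -/
def IsBaxterPair (k : ℂ) (Λ : ℂ → ℂ) (roots : Fin S.M → ℂ) : Prop :=
  ∀ z : ℂ, Complex.sinh (z + S.shift - S.η) ≠ 0 → Complex.sinh (z - S.shift + S.η) ≠ 0 →
    AnalyticAt ℂ Λ z ∧
    Λ z * S.qFun roots z =
      S.qpow k * S.vacA z * S.qFun roots (z - S.η) +
        S.qpow (-k) * S.vacD z * S.qFun roots (z + S.η)

/-- The auxiliary function `𝔞(z | κ)`. -/
noncomputable def aux (z : ℂ) : ℂ :=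
  S.qpow (-2 * S.κ) * S.vacD z * S.qFun S.roots₀ (z + S.η) /
    (S.vacA z * S.qFun S.roots₀ (z - S.η))

/-- The ratio of eigenvalues `ρ(z) = Λ(z | κ + α) / Λ(z | κ)`. -/
noncomputable def rho (z : ℂ) : ℂ := S.Λ₁ z / S.Λ₀ z

/-- The deformed kernel `K_α`. -/
noncomputable def kernel (z : ℂ) : ℂ :=
  S.qpow (-S.α) * cth (z - S.η) - S.qpow S.α * cth (z + S.η)

/-- The open region inside the contour `C`. -/
def inside : Set ℂ := {z | |z.re| < S.R ∧ |z.im| < S.h}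

/-- The contour together with its inside. -/
def closedInside : Set ℂ := {z | |z.re| ≤ S.R ∧ |z.im| ≤ S.h}

/-- The contour `C` as a set: the boundary of the rectangle. -/
def contour : Set ℂ := S.closedInside \ S.inside

/-- The integral `∫_C f(z) dz` along the positively oriented boundary of the rectangle. -/
noncomputable def contourIntegral (f : ℂ → ℂ) : ℂ :=
  (∫ x in (-S.R)..S.R, f ((x : ℂ) - (S.h : ℂ) * Complex.I)) +
    Complex.I * (∫ y in (-S.h)..S.h, f ((S.R : ℂ) + (y : ℂ) * Complex.I)) -
    (∫ x in (-S.R)..S.R, f ((x : ℂ) + (S.h : ℂ) * Complex.I)) -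
    Complex.I * (∫ y in (-S.h)..S.h, f (-(S.R : ℂ) + (y : ℂ) * Complex.I))

/-- The integral `∫_C dm(z) f(z)` for the `measure`
`dm(z) = dz / (2 π i ρ(z) (1 + 𝔞(z | κ)))`. -/
noncomputable def integralDm (f : ℂ → ℂ) : ℂ :=
  S.contourIntegral fun z =>
    f z / (2 * (Real.pi : ℂ) * Complex.I * S.rho z * (1 + S.aux z))

/-- `g`, as a function on the contour, is continuous and solves the linear integral equation
that defines `G(·, ν)` for `ν` inside `C`. -/
def SolvesG (ν : ℂ) (g : ℂ → ℂ) : Prop :=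
  ContinuousOn g S.contour ∧
  ∀ l ∈ S.contour,
    g l = S.qpow (-S.α) * cth (l - ν - S.η) - S.rho ν * cth (l - ν) +
      S.integralDm fun μ => S.kernel (l - μ) * g μ

/-- `g` is *the* solution of the integral equation: it is a solution, and it is the only one
on the contour. -/
def IsTheSolutionG (ν : ℂ) (g : ℂ → ℂ) : Prop :=
  S.SolvesG ν g ∧ ∀ g' : ℂ → ℂ, S.SolvesG ν g' → Set.EqOn g' g S.contour

/-- The domain into which the spectral parameters are continued: the strip `|Im z| < γ / 2`
around the contour, joined with the half-plane `Re z > R` to the right of the contour. -/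
def domain : Set ℂ := {z | |z.im| < S.γ / 2 ∨ S.R < z.re}

/-- `G` is the function `G(λ, ν)`.  For `ν` inside `C` the function `G(·, ν)` is the solution of
the integral equation on the contour, continued meromorphically in `λ`; then, for every `λ`, the
function `G(λ, ·)` is continued meromorphically in `ν` from the inside of `C`.
(`MeromorphicNFOn` is meromorphy together with the removal of removable singularities and the
convention that the value at a pole is `0`, so that continuations are unique.) -/
structure IsG (G : ℂ → ℂ → ℂ) : Prop where
  solution : ∀ ν ∈ S.inside, S.IsTheSolutionG ν fun l => G l ν
  continuation_left : ∀ ν ∈ S.inside, MeromorphicNFOn (fun l => G l ν) S.domain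
  continuation_right : ∀ l ∈ S.domain, MeromorphicNFOn (fun ν => G l ν) S.domain

/-- `Ψ` is the function `Ψ(ν₁, ν₂)` belonging to `G`: it is given by the contour integral for
`ν₁` and `ν₂` inside `C`, and it is continued meromorphically first in `ν₁` and then, for every
`ν₁` that is not a zero of `Λ(· | κ)` (a pole of `ρ`), in `ν₂`. -/
structure IsPsi (G Ψ : ℂ → ℂ → ℂ) : Prop where
  formula : ∀ ν₁ ∈ S.inside, ∀ ν₂ ∈ S.inside,
    Ψ ν₁ ν₂ = S.integralDm fun μ =>
      G μ ν₂ * (S.qpow S.α * cth (μ - ν₁ - S.η) - S.rho ν₁ * cth (μ - ν₁))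
  continuation_left : ∀ ν₂ ∈ S.inside, MeromorphicNFOn (fun ν₁ => Ψ ν₁ ν₂) S.domain
  continuation_right : ∀ ν₁ ∈ S.domain, S.Λ₀ ν₁ ≠ 0 →
    MeromorphicNFOn (fun ν₂ => Ψ ν₁ ν₂) S.domain

end Data

end SixVertex

/-! The mechanism is duality. Write φ for the quotient of the Q-functions for κ + α and κ (`qRatio`)
and τ = 1/(1 + 𝔞) (`tau`). By Baxter's equation for κ, the density of dm has inside C no
singularities except at the Bethe roots for κ (`integralDm_eq`), so C may be shrunk to any rectangle
around these roots. The Fredholm alternative turns the assumed uniqueness into a continuous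
resolvent T of the transposed equation u(m) = s(m) + ∫ dm(μ) K_α(μ - m) u(μ). If g solves the
original equation with inhomogeneity f, then ∫ dm s g = ∫ dm (T s) f (`exists_box_resolvent`). Hence
G and Ψ are, up to explicit terms, integrals of T s against the inhomogeneity of the equation for G.
The source s depends on the first argument only, and the second argument enters only through `cth`
and ρ.

Limits in the first argument. The source tends uniformly to a multiple of the constant q^(-α) - q^α,
and for this source the transposed equation is solved explicitly. The two Baxter equations combine
to τ(z) (q^(-α) φ(z+η) - q^α φ(z-η)) = q^(-α) φ(z+η) - ρ(z) φ(z) (`tau_mul_dualSol`). After division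
by ρ the first term on the right is holomorphic inside C, while the second is πi-periodic with
limits at ±∞. Integrals against `cth` thus follow from Cauchy's formula and from closing the contour
over one period strip. They show that `dualSol` divided by `qMean` is the solution and that its
integral against the inhomogeneity is ρ(ν) - q^(-α) (`constSource`). That `qMean` does not vanish is
again a consequence of uniqueness.

Limits in the second argument. No explicit solution is needed here. Moving ν out of the contour
produces a residue term with the factor τ(ν) (`continuation`). As ν → ∞, T s survives only through
its total mass ∫ dm T s, whose coefficient is ρ(∞) - q^(-α) + (q^(-α) - q^α) τ(∞) = 0
(`tendsto_of_resolvent`). What remains is explicit.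

All limits are along `comap re atTop`, which expresses uniformity in the imaginary part. -/

namespace SixVertex

open MeasureTheory

/-! ### Fredholm theory for integral operators with continuous kernel -/

section IntegralOperator

variable {Y : Type*} [TopologicalSpace Y] [CompactSpace Y] [MeasurableSpace Y]
  (μ : Measure Y) [IsFiniteMeasure μ]

theorem norm_integral_mul_le (f g : C(Y, ℂ)) :
    ‖∫ y, f y * g y ∂μ‖ ≤ μ.real Set.univ * ‖f‖ * ‖g‖ := by
  have := norm_integral_le_of_norm_le_const (μ := μ) (f := fun y => f y * g y) (C := ‖f‖ * ‖g‖)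
    (Eventually.of_forall fun y => by
      rw [norm_mul]
      exact mul_le_mul (f.norm_coe_le_norm y) (g.norm_coe_le_norm y) (norm_nonneg _) (norm_nonneg _))
  linarith

variable [BorelSpace Y]

theorem integrable_of_continuous {f : Y → ℂ} (hf : Continuous f) : Integrable f μ :=
  hf.integrable_of_hasCompactSupport (HasCompactSupport.of_compactSpace f)

/-- Integration against a continuous function, as a functional. -/
noncomputable def pairing (f : C(Y, ℂ)) : C(Y, ℂ) →L[ℂ] ℂ :=
  LinearMap.mkContinuous
    { toFun := fun g => ∫ y, f y * g y ∂μ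
      map_add' := fun g₁ g₂ => by
        simp only [ContinuousMap.add_apply, mul_add]
        exact integral_add (integrable_of_continuous μ (by fun_prop))
          (integrable_of_continuous μ (by fun_prop))
      map_smul' := fun c g => by
        simp only [ContinuousMap.smul_apply, smul_eq_mul, RingHom.id_apply, mul_left_comm _ c]
        exact integral_const_mul _ _ }
    (μ.real Set.univ * ‖f‖) fun g => norm_integral_mul_le μ f g

@[simp]
theorem pairing_apply (f g : C(Y, ℂ)) : pairing μ f g = ∫ y, f y * g y ∂μ := rfl

/-- The modulus of continuity comes from the kernel alone, through the continuous map y ↦ k(y, ·)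
into C(Y), and is uniform over bounded sets of g. This yields continuity of the image functions and
equicontinuity for Arzelà–Ascoli. -/
theorem norm_integral_kernel_sub_le (k : C(Y × Y, ℂ)) (g : C(Y, ℂ)) (y z : Y) :
    ‖(∫ x, k (y, x) * g x ∂μ) - ∫ x, k (z, x) * g x ∂μ‖ ≤
      μ.real Set.univ * ‖k.curry y - k.curry z‖ * ‖g‖ := by
  have h := norm_integral_mul_le μ (k.curry y - k.curry z) g
  simp only [ContinuousMap.sub_apply, ContinuousMap.curry_apply, sub_mul] at h
  rwa [integral_sub (integrable_of_continuous μ (by fun_prop))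
    (integrable_of_continuous μ (by fun_prop))] at h

/-- The integral operator with a continuous kernel. -/
noncomputable def intOp (k : C(Y × Y, ℂ)) : C(Y, ℂ) →L[ℂ] C(Y, ℂ) :=
  LinearMap.mkContinuous
    { toFun := fun g => ⟨fun y => ∫ x, k (y, x) * g x ∂μ, by
        refine continuous_iff_continuousAt.2 fun z => tendsto_iff_norm_sub_tendsto_zero.2 ?_
        refine squeeze_zero (fun _ => norm_nonneg _)
          (fun y => norm_integral_kernel_sub_le μ k g y z) ?_
        have h : Continuous fun y => μ.real Set.univ * ‖k.curry y - k.curry z‖ * ‖g‖ := by fun_prop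
        simpa using h.tendsto z⟩
      map_add' := fun g₁ g₂ => by
        ext y
        exact map_add (pairing μ (k.curry y)) g₁ g₂
      map_smul' := fun c g => by
        ext y
        exact map_smul (pairing μ (k.curry y)) c g }
    (μ.real Set.univ * ‖k‖) fun g => by
      refine (ContinuousMap.norm_le _ (by positivity)).2 fun y => ?_
      refine (norm_integral_mul_le μ (k.curry y) g).trans ?_
      gcongr
      exact (ContinuousMap.norm_le _ (norm_nonneg _)).2 fun x => k.norm_coe_le_norm (y, x)

/-- Arzelà–Ascoli: the image of the unit ball is bounded by the operator norm and equicontinuous by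
`norm_integral_kernel_sub_le`. -/
theorem isCompactOperator_intOp (k : C(Y × Y, ℂ)) : IsCompactOperator (intOp μ k) := by
  have hlin := isCompactOperator_iff_isCompact_closure_image_closedBall
    (𝕜₁ := ℂ) (intOp μ k).toLinearMap (r := 1) one_pos
  refine hlin.2 ?_
  set A := (intOp μ k) '' Metric.closedBall 0 1 with hA
  change IsCompact (closure A)
  let E := ContinuousMap.isometryEquivBoundedOfCompact Y ℂ
  -- Arzelà–Ascoli is applied among bounded continuous functions, so the closure is transported
  -- along the isometry with C(Y).
  have hE : closure A = E.symm '' closure (E '' A) := by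
    have h := E.symm.toHomeomorph.image_closure (E '' A)
    refine Eq.trans ?_ h.symm
    change closure A = closure (E.symm '' (E '' A))
    rw [← Set.image_comp]
    simp
  rw [hE]
  refine IsCompact.image ?_ E.symm.continuous
  refine BoundedContinuousFunction.arzela_ascoli (Metric.closedBall 0 (‖intOp μ k‖))
    (isCompact_closedBall _ _) _ ?_ ?_
  · rintro _ x ⟨_, ⟨g, hg, rfl⟩, rfl⟩
    rw [mem_closedBall_zero_iff] at hg ⊢
    refine ((intOp μ k g).norm_coe_le_norm x).trans (((intOp μ k).le_opNorm g).trans ?_)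
    exact mul_le_of_le_one_right (norm_nonneg _) hg
  · intro z
    rw [Metric.equicontinuousAt_iff_right]
    intro ε hε
    have h : Continuous fun y => μ.real Set.univ * ‖k.curry y - k.curry z‖ := by fun_prop
    have h' := (h.tendsto z)
    simp only [sub_self, norm_zero, mul_zero] at h'
    filter_upwards [h'.eventually (gt_mem_nhds hε)] with y hy
    rintro ⟨_, ⟨_, ⟨g, hg, rfl⟩, rfl⟩⟩
    rw [mem_closedBall_zero_iff] at hg
    rw [dist_comm, dist_eq_norm]
    refine lt_of_le_of_lt ((norm_integral_kernel_sub_le μ k g y z).trans ?_) hy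
    exact mul_le_of_le_one_right (by positivity) hg

/-- **Fredholm alternative** for integral equations of the second kind. -/
theorem exists_resolvent_intOp (k : C(Y × Y, ℂ))
    (hk : ∀ g : C(Y, ℂ), g = intOp μ k g → g = 0) :
    ∃ T : C(Y, ℂ) →L[ℂ] C(Y, ℂ), ∀ s u, u = s + intOp μ k u ↔ u = T s := by
  have hev : ¬ Module.End.HasEigenvalue (intOp μ k : Module.End ℂ C(Y, ℂ)) 1 := by
    intro h
    obtain ⟨g, hg⟩ := h.exists_hasEigenvector
    refine hg.2 (hk g ?_)
    have := hg.apply_eq_smul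
    simpa using this.symm
  -- A nonzero point of the spectrum of a compact operator is an eigenvalue, and the value 1 has
  -- just been excluded.
  have hu : IsUnit (intOp μ k - 1) := by
    have := (isCompactOperator_intOp μ k).hasEigenvalue_or_mem_resolventSet (μ := 1) one_ne_zero
    have h2 := this.resolve_left hev
    rw [spectrum.mem_resolventSet_iff, map_one] at h2
    simpa using h2.neg
  obtain ⟨U, hU⟩ := hu
  refine ⟨-(↑U⁻¹ : C(Y, ℂ) →L[ℂ] C(Y, ℂ)), fun s u => ?_⟩
  have h1 : ∀ x, (↑U⁻¹ : C(Y, ℂ) →L[ℂ] C(Y, ℂ)) (intOp μ k x - x) = x := fun x => by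
    have := DFunLike.congr_fun (U.inv_mul) x
    rw [hU] at this
    simpa using this
  have h2 : ∀ x, intOp μ k ((↑U⁻¹ : C(Y, ℂ) →L[ℂ] C(Y, ℂ)) x) -
      (↑U⁻¹ : C(Y, ℂ) →L[ℂ] C(Y, ℂ)) x = x := fun x => by
    have := DFunLike.congr_fun (U.mul_inv) x
    rw [hU] at this
    simpa using this
  constructor
  · intro h
    have hs : intOp μ k u - u = -s := by
      nth_rewrite 2 [h]
      abel
    have := h1 u
    rw [hs, map_neg] at this
    rw [← this]
    rfl
  · intro h
    have := h2 (-s)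
    rw [map_neg] at this
    have hu' : u = -((↑U⁻¹ : C(Y, ℂ) →L[ℂ] C(Y, ℂ)) s) := h
    rw [← hu'] at this
    rw [show s = -(intOp μ k u - u) by rw [this, neg_neg]]
    abel

variable (v : C(Y, ℂ)) (κ : C(Y × Y, ℂ))

/-- The kernel `κ (y, x) v x`. -/
noncomputable def weightKernel : C(Y × Y, ℂ) := κ * v.comp ⟨Prod.snd, continuous_snd⟩

/-- The kernel `κ (x, y) v x`, transposed to `weightKernel` for the weight `v`. -/
noncomputable def weightKernelT : C(Y × Y, ℂ) :=
  weightKernel v (κ.comp ⟨Prod.swap, continuous_swap⟩)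

theorem intOp_weightKernel_apply (g : C(Y, ℂ)) (y : Y) :
    intOp μ (weightKernel v κ) g y = ∫ x, κ (y, x) * v x * g x ∂μ := rfl

theorem intOp_weightKernelT_apply (g : C(Y, ℂ)) (y : Y) :
    intOp μ (weightKernelT v κ) g y = ∫ x, κ (x, y) * v x * g x ∂μ := rfl

/-- Fubini: with respect to the bilinear form ∫ v u g, the operators with the kernels κ(y, x) v(x)
and κ(x, y) v(x) are adjoint to each other. -/
theorem integral_intOp_swap (u g : C(Y, ℂ)) :
    ∫ y, v y * u y * intOp μ (weightKernel v κ) g y ∂μ =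
      ∫ y, v y * intOp μ (weightKernelT v κ) u y * g y ∂μ := by
  simp only [intOp_weightKernel_apply, intOp_weightKernelT_apply, ← integral_const_mul,
    ← integral_mul_const]
  rw [integral_integral_swap_of_hasCompactSupport (by fun_prop)
    (HasCompactSupport.of_compactSpace _)]
  refine integral_congr_ae (Eventually.of_forall fun x => ?_)
  refine integral_congr_ae (Eventually.of_forall fun y => ?_)
  dsimp only
  ring

/-- Pairing the solution of an integral equation with the solution of the transposed one. -/
theorem integral_dual {s u f g : C(Y, ℂ)} (hu : u = s + intOp μ (weightKernelT v κ) u)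
    (hg : g = f + intOp μ (weightKernel v κ) g) :
    ∫ y, v y * u y * f y ∂μ = ∫ y, v y * s y * g y ∂μ := by
  have hf : ∀ y, f y = g y - intOp μ (weightKernel v κ) g y := fun y => by
    have := DFunLike.congr_fun hg y
    rw [ContinuousMap.add_apply] at this
    rw [eq_sub_iff_add_eq, ← this]
  have hs : ∀ y, s y = u y - intOp μ (weightKernelT v κ) u y := fun y => by
    have := DFunLike.congr_fun hu y
    rw [ContinuousMap.add_apply] at this
    rw [eq_sub_iff_add_eq, ← this]
  simp only [hf, hs, mul_sub, sub_mul]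
  rw [integral_sub (integrable_of_continuous μ (by fun_prop))
    (integrable_of_continuous μ (by fun_prop)), integral_sub (integrable_of_continuous μ
    (by fun_prop)) (integrable_of_continuous μ (by fun_prop)), integral_intOp_swap]

/-- If an integral equation has at most one solution, then the transposed equation is uniquely
solvable, and its solution depends continuously on the source. -/
theorem exists_resolvent_transpose
    (h : ∀ g : C(Y, ℂ), g = intOp μ (weightKernel v κ) g → g = 0) :
    ∃ T : C(Y, ℂ) →L[ℂ] C(Y, ℂ), ∀ s u, u = s + intOp μ (weightKernelT v κ) u ↔ u = T s := by
  obtain ⟨T, hT⟩ := exists_resolvent_intOp μ _ h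
  refine exists_resolvent_intOp μ _ fun u hu => ?_
  ext y
  rw [hu, intOp_weightKernelT_apply]
  -- The test source is the column κ(·, y): pairing it with a homogeneous transposed solution u
  -- returns u(y), while duality with s = 0 makes the pairing vanish.
  let f : C(Y, ℂ) := κ.comp ⟨fun x => (x, y), by fun_prop⟩
  have := integral_dual μ v κ (s := 0) (u := u) (f := f) (g := T f) (by rwa [zero_add])
    ((hT f (T f)).2 rfl)
  simp only [ContinuousMap.zero_apply, mul_zero, zero_mul, integral_zero] at this
  rw [ContinuousMap.zero_apply, ← this]
  refine integral_congr_ae (Eventually.of_forall fun x => ?_)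
  change κ (x, y) * v x * u x = v x * u x * κ (x, y)
  ring

end IntegralOperator

end SixVertex

namespace SixVertex

open MeasureTheory Complex

/-! ### Cauchy's theorem on rectangles -/

section BoxIntegral

/-- The integral along the positively oriented boundary of the rectangle `[a, b] × [c, d]`. -/
noncomputable def boxIntegral (a b c d : ℝ) (f : ℂ → ℂ) : ℂ :=
  (∫ x in a..b, f ((x : ℂ) + (c : ℂ) * I)) - (∫ x in a..b, f ((x : ℂ) + (d : ℂ) * I)) +
    I * (∫ y in c..d, f ((b : ℂ) + (y : ℂ) * I)) - I * (∫ y in c..d, f ((a : ℂ) + (y : ℂ) * I))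

theorem boxIntegral_eq_zero {a b c d : ℝ} {f : ℂ → ℂ} (hab : a ≤ b) (hcd : c ≤ d)
    (hf : ∀ z : ℂ, a ≤ z.re → z.re ≤ b → c ≤ z.im → z.im ≤ d → DifferentiableAt ℂ f z) :
    boxIntegral a b c d f = 0 := by
  have h := Complex.integral_boundary_rect_eq_zero_of_differentiableOn f (a + c * I) (b + d * I)
    (fun z hz => by
      simp [Complex.mem_reProdIm, Set.uIcc_of_le hab, Set.uIcc_of_le hcd] at hz
      exact (hf z hz.1.1 hz.1.2 hz.2.1 hz.2.2).differentiableWithinAt)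
  simpa [boxIntegral] using h

/-- The closed rectangle with half width `r` and half height `k`. -/
def closedBox (r k : ℝ) : Set ℂ := {z | |z.re| ≤ r ∧ |z.im| ≤ k}

/-- The open rectangle with half width `r` and half height `k`. -/
def openBox (r k : ℝ) : Set ℂ := {z | |z.re| < r ∧ |z.im| < k}

theorem openBox_subset_closedBox (r k : ℝ) : openBox r k ⊆ closedBox r k :=
  fun _ hz => ⟨hz.1.le, hz.2.le⟩

theorem closedBox_subset_openBox {r k R h : ℝ} (hr : r < R) (hk : k < h) :
    closedBox r k ⊆ openBox R h :=
  fun _ hz => ⟨hz.1.trans_lt hr, hz.2.trans_lt hk⟩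

theorem isOpen_openBox (r k : ℝ) : IsOpen (openBox r k) :=
  (isOpen_lt (f := fun z : ℂ => |z.re|) (by fun_prop) continuous_const).inter
    (isOpen_lt (f := fun z : ℂ => |z.im|) (by fun_prop) continuous_const)

theorem isClosed_closedBox (r k : ℝ) : IsClosed (closedBox r k) :=
  (isClosed_le (f := fun z : ℂ => |z.re|) (by fun_prop) continuous_const).inter
    (isClosed_le (f := fun z : ℂ => |z.im|) (by fun_prop) continuous_const)

/-- The integral over the boundary of a centred rectangle. -/
noncomputable def rectIntegral (r k : ℝ) (f : ℂ → ℂ) : ℂ := boxIntegral (-r) r (-k) k f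

theorem rectIntegral_eq_zero {r k : ℝ} {f : ℂ → ℂ} (hr : 0 ≤ r) (hk : 0 ≤ k)
    (hf : ∀ z ∈ closedBox r k, DifferentiableAt ℂ f z) : rectIntegral r k f = 0 :=
  boxIntegral_eq_zero (by linarith) (by linarith) fun z h1 h2 h3 h4 =>
    hf z ⟨abs_le.2 ⟨h1, h2⟩, abs_le.2 ⟨h3, h4⟩⟩

theorem integral_split_three {f : ℝ → ℂ} {a b : ℝ} (hb : 0 ≤ b) (hba : b ≤ a)
    (hf : ∀ x, |x| ≤ a → ContinuousAt f x) :
    ∫ x in -a..a, f x = (∫ x in -a..-b, f x) + (∫ x in -b..b, f x) + ∫ x in b..a, f x := by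
  have hi : ∀ u v : ℝ, |u| ≤ a → |v| ≤ a → IntervalIntegrable f volume u v := fun u v hu hv => by
    refine ContinuousOn.intervalIntegrable fun x hx => (hf x ?_).continuousWithinAt
    rw [abs_le] at hu hv ⊢
    rcases Set.mem_uIcc.1 hx with h | h <;> constructor <;> linarith
  have ha : |a| ≤ a := by rw [abs_of_nonneg (by linarith)]
  have ha' : |-a| ≤ a := by rwa [abs_neg]
  have hb1 : |b| ≤ a := by rwa [abs_of_nonneg hb]
  have hb2 : |-b| ≤ a := by rwa [abs_neg]
  rw [intervalIntegral.integral_add_adjacent_intervals (hi _ _ ha' hb2) (hi _ _ hb2 hb1),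
    intervalIntegral.integral_add_adjacent_intervals (hi _ _ ha' hb1) (hi _ _ hb1 ha)]

/-- **Cauchy's theorem** for a rectangular annulus. -/
theorem rectIntegral_eq_of_annulus {R h r k : ℝ} {f : ℂ → ℂ} (hr : 0 ≤ r) (hk : 0 ≤ k)
    (hrR : r ≤ R) (hkh : k ≤ h)
    (hf : ∀ z ∈ closedBox R h \ openBox r k, DifferentiableAt ℂ f z) :
    rectIntegral R h f = rectIntegral r k f := by
  have hout : ∀ z : ℂ, |z.re| ≤ R → |z.im| ≤ h → (r ≤ |z.re| ∨ k ≤ |z.im|) →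
      DifferentiableAt ℂ f z := fun z h1 h2 h3 => by
    refine hf z ⟨⟨h1, h2⟩, fun h4 => ?_⟩
    rcases h3 with h3 | h3
    · exact absurd h4.1 (not_lt.2 h3)
    · exact absurd h4.2 (not_lt.2 h3)
  have hhor : ∀ y : ℝ, |y| ≤ h → k ≤ |y| → ∀ x : ℝ, |x| ≤ R →
      ContinuousAt (fun x : ℝ => f ((x : ℂ) + (y : ℂ) * I)) x := fun y hy hy' x hx => by
    have := (hout ((x : ℂ) + (y : ℂ) * I) (by simpa using hx) (by simpa using hy)
      (Or.inr (by simpa using hy'))).continuousAt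
    exact ContinuousAt.comp (f := fun x : ℝ => (x : ℂ) + (y : ℂ) * I) this (by fun_prop)
  have hver : ∀ x : ℝ, |x| ≤ R → r ≤ |x| → ∀ y : ℝ, |y| ≤ h →
      ContinuousAt (fun y : ℝ => f ((x : ℂ) + (y : ℂ) * I)) y := fun x hx hx' y hy => by
    have := (hout ((x : ℂ) + (y : ℂ) * I) (by simpa using hx) (by simpa using hy)
      (Or.inl (by simpa using hx'))).continuousAt
    exact ContinuousAt.comp (f := fun y : ℝ => (x : ℂ) + (y : ℂ) * I) this (by fun_prop)
  have habs : ∀ x : ℝ, 0 ≤ x → |x| = x ∧ |-x| = x := fun x hx =>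
    ⟨abs_of_nonneg hx, by rw [abs_neg, abs_of_nonneg hx]⟩
  have hR := habs R (by linarith)
  have hh := habs h (by linarith)
  have hr' := habs r hr
  have hk' := habs k hk
  have e1 := integral_split_three hr hrR (hhor h hh.1.le (by rw [hh.1]; exact hkh))
  have e2 := integral_split_three hr hrR (hhor (-h) hh.2.le (by rw [hh.2]; exact hkh))
  have e3 := integral_split_three hk hkh (hver r (by rw [hr'.1]; exact hrR) hr'.1.ge)
  have e4 := integral_split_three hk hkh (hver (-r) (by rw [hr'.2]; exact hrR) hr'.2.ge)
  -- The annulus is cut into a left and a right rectangle of full height and two rectangles above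
  -- and below the hole. The pieces of the outer sides are regrouped by e1, …, e4.
  have z1 : boxIntegral (-R) (-r) (-h) h f = 0 :=
    boxIntegral_eq_zero (by linarith) (by linarith) fun z h1 h2 h3 h4 =>
      hout z (abs_le.2 ⟨h1, by linarith⟩) (abs_le.2 ⟨h3, h4⟩)
        (Or.inl (le_abs.2 (Or.inr (by linarith))))
  have z2 : boxIntegral r R (-h) h f = 0 :=
    boxIntegral_eq_zero (by linarith) (by linarith) fun z h1 h2 h3 h4 =>
      hout z (abs_le.2 ⟨by linarith, h2⟩) (abs_le.2 ⟨h3, h4⟩) (Or.inl (le_abs.2 (Or.inl h1)))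
  have z3 : boxIntegral (-r) r (-h) (-k) f = 0 :=
    boxIntegral_eq_zero (by linarith) (by linarith) fun z h1 h2 h3 h4 =>
      hout z (abs_le.2 ⟨by linarith, by linarith⟩) (abs_le.2 ⟨h3, by linarith⟩)
        (Or.inr (le_abs.2 (Or.inr (by linarith))))
  have z4 : boxIntegral (-r) r k h f = 0 :=
    boxIntegral_eq_zero (by linarith) (by linarith) fun z h1 h2 h3 h4 =>
      hout z (abs_le.2 ⟨by linarith, by linarith⟩) (abs_le.2 ⟨by linarith, h4⟩)
        (Or.inr (le_abs.2 (Or.inl h3)))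
  unfold boxIntegral at z1 z2 z3 z4
  unfold rectIntegral boxIntegral
  linear_combination e2 - e1 + I * e3 - I * e4 + z1 + z2 + z3 + z4

end BoxIntegral

/-! ### The boundary of a rectangle as a compact measure space -/

section Parametrization

/-- The parameter space of the boundary of a rectangle: four sides. -/
abbrev Sides := Fin 4 × unitInterval

/-- The length measure on the parameter space. -/
noncomputable def sidesMeasure : Measure Sides :=
  (Measure.count : Measure (Fin 4)).prod (volume : Measure unitInterval)

instance : IsFiniteMeasure sidesMeasure := by
  unfold sidesMeasure
  infer_instance

/-- The starting points of the sides. -/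
noncomputable def corner (r k : ℝ) : Fin 4 → ℂ :=
  ![-r + (-k : ℝ) * I, r + (-k : ℝ) * I, r + k * I, -r + k * I]

/-- The sides as vectors. -/
noncomputable def sideVec (r k : ℝ) : Fin 4 → ℂ :=
  ![2 * r, 2 * k * I, -(2 * r), -(2 * k * I)]

/-- The parametrization of the boundary of a rectangle. -/
noncomputable def bdry (r k : ℝ) (y : Sides) : ℂ := corner r k y.1 + (y.2 : ℝ) * sideVec r k y.1

theorem continuous_bdry (r k : ℝ) : Continuous (bdry r k) := by
  have h1 : Continuous (corner r k) := continuous_of_discreteTopology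
  have h2 : Continuous (sideVec r k) := continuous_of_discreteTopology
  unfold bdry
  fun_prop

theorem continuous_sideVec (r k : ℝ) : Continuous fun y : Sides => sideVec r k y.1 := by
  have h2 : Continuous (sideVec r k) := continuous_of_discreteTopology
  fun_prop

theorem bdry_mem {r k : ℝ} (hr : 0 ≤ r) (hk : 0 ≤ k) (y : Sides) :
    bdry r k y ∈ closedBox r k \ openBox r k := by
  obtain ⟨i, t, ht0, ht1⟩ := y
  have h1 : 0 ≤ t * r := mul_nonneg ht0 hr
  have h2 : t * r ≤ r := mul_le_of_le_one_left hr ht1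
  have h3 : 0 ≤ t * k := mul_nonneg ht0 hk
  have h4 : t * k ≤ k := mul_le_of_le_one_left hk ht1
  fin_cases i <;>
  · simp [bdry, corner, sideVec, closedBox, openBox, abs_of_nonneg hr, abs_of_nonneg hk]
    try rw [abs_le]
    constructor <;> linarith

theorem integral_sides {f : Sides → ℂ} (hf : Continuous f) :
    ∫ y, f y ∂sidesMeasure = ∑ i, ∫ t in (0 : ℝ)..1, f (i, Set.projIcc 0 1 zero_le_one t) := by
  unfold sidesMeasure
  rw [integral_prod]
  · rw [integral_count]
    refine Finset.sum_congr rfl fun i _ => ?_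
    rw [intervalIntegral.integral_of_le zero_le_one, ← integral_Icc_eq_integral_Ioc,
      ← integral_subtype measurableSet_Icc]
    refine integral_congr_ae (Eventually.of_forall fun t => ?_)
    simp
  · exact integrable_of_continuous _ hf

/-- Affine substitution on each side; the complex factor `sideVec` carries direction and length. In
this form the Fredholm theory applies to contour integrals. A continuous function on `Sides` need
not agree at the corners, but a solution of an integral equation does, since its equation expresses
it through `bdry`. -/
theorem rectIntegral_eq_integral {r k : ℝ} {f : ℂ → ℂ}
    (hf : Continuous fun y => f (bdry r k y)) :
    rectIntegral r k f = ∫ y, f (bdry r k y) * sideVec r k y.1 ∂sidesMeasure := by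
  have hsub : ∀ (F : ℝ → ℂ) (c d : ℝ), (c : ℂ) * (∫ t in (0 : ℝ)..1, F (d + c * t)) =
      ∫ x in d..d + c, F x := fun F c d => by
    have := intervalIntegral.smul_integral_comp_add_mul (a := 0) (b := 1) F c d
    rw [mul_zero, add_zero, mul_one] at this
    rw [← this, Complex.real_smul]
  have hcomp : ∀ i, (∫ t in (0 : ℝ)..1,
      f (bdry r k (i, Set.projIcc 0 1 zero_le_one t)) * sideVec r k i) =
      (∫ t in (0 : ℝ)..1, f (corner r k i + t * sideVec r k i)) * sideVec r k i := fun i => by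
    rw [← intervalIntegral.integral_mul_const]
    refine intervalIntegral.integral_congr fun t ht => ?_
    rw [Set.uIcc_of_le zero_le_one] at ht
    simp [bdry, Set.projIcc_of_mem zero_le_one ht]
  rw [integral_sides (f := fun y => f (bdry r k y) * sideVec r k y.1)
    (hf.mul (continuous_sideVec r k))]
  simp only [hcomp, Fin.sum_univ_four]
  have h1 := hsub (fun x => f ((x : ℂ) + (-k : ℝ) * I)) (2 * r) (-r)
  have h2 := hsub (fun y => f ((r : ℂ) + (y : ℂ) * I)) (2 * k) (-k)
  have h3 := hsub (fun x => f ((x : ℂ) + k * I)) (-(2 * r)) r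
  have h4 := hsub (fun y => f (((-r : ℝ) : ℂ) + (y : ℂ) * I)) (-(2 * k)) k
  rw [show -r + 2 * r = r by ring] at h1
  rw [show -k + 2 * k = k by ring] at h2
  rw [show r + -(2 * r) = -r by ring] at h3
  have t3 := intervalIntegral.integral_symm (μ := volume) (f := fun x : ℝ => f (x + k * I)) (-r) r
  rw [show k + -(2 * k) = -k by ring] at h4
  have t4 := intervalIntegral.integral_symm (μ := volume)
    (f := fun y : ℝ => f (((-r : ℝ) : ℂ) + y * I)) (-k) k
  have g1 : ∀ t : ℝ, corner r k 0 + t * sideVec r k 0 =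
      ((-r + 2 * r * t : ℝ) : ℂ) + (-k : ℝ) * I := fun t => by
    simp [corner, sideVec]; ring
  have g2 : ∀ t : ℝ, corner r k 1 + t * sideVec r k 1 =
      (r : ℂ) + ((-k + 2 * k * t : ℝ) : ℂ) * I := fun t => by
    simp [corner, sideVec]; ring
  have g3 : ∀ t : ℝ, corner r k 2 + t * sideVec r k 2 =
      ((r + -(2 * r) * t : ℝ) : ℂ) + k * I := fun t => by
    simp [corner, sideVec]; ring
  have g4 : ∀ t : ℝ, corner r k 3 + t * sideVec r k 3 =
      ((-r : ℝ) : ℂ) + ((k + -(2 * k) * t : ℝ) : ℂ) * I := fun t => by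
    simp [corner, sideVec]; ring
  have s1 : sideVec r k 0 = ((2 * r : ℝ) : ℂ) := by simp [sideVec]
  have s2 : sideVec r k 1 = ((2 * k : ℝ) : ℂ) * I := by simp [sideVec]
  have s3 : sideVec r k 2 = ((-(2 * r) : ℝ) : ℂ) := by simp [sideVec]
  have s4 : sideVec r k 3 = ((-(2 * k) : ℝ) : ℂ) * I := by simp [sideVec]
  simp only [g1, g2, g3, g4]
  rw [s1, s2, s3, s4]
  unfold rectIntegral boxIntegral
  linear_combination -h1 - I * h2 - h3 - I * h4 - t3 - I * t4

/-- The boundary of a centred rectangle. -/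
def frame (r k : ℝ) : Set ℂ := closedBox r k \ openBox r k

theorem continuous_comp_bdry {r k : ℝ} (hr : 0 ≤ r) (hk : 0 ≤ k) {f : ℂ → ℂ}
    (hf : ContinuousOn f (frame r k)) : Continuous fun y => f (bdry r k y) :=
  hf.comp_continuous (continuous_bdry r k) (bdry_mem hr hk)

theorem rectIntegral_congr {r k : ℝ} (hr : 0 ≤ r) (hk : 0 ≤ k) {f g : ℂ → ℂ}
    (h : Set.EqOn f g (frame r k)) : rectIntegral r k f = rectIntegral r k g := by
  have hx : ∀ x ∈ Set.uIcc (-r) r, |x| ≤ r := fun x hx => by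
    rw [Set.uIcc_of_le (by linarith)] at hx
    exact abs_le.2 hx
  have hy : ∀ x ∈ Set.uIcc (-k) k, |x| ≤ k := fun x hx => by
    rw [Set.uIcc_of_le (by linarith)] at hx
    exact abs_le.2 hx
  unfold rectIntegral boxIntegral
  congr 1
  · congr 1
    · congr 1 <;> refine intervalIntegral.integral_congr fun x hx' => h ?_
      · exact ⟨⟨by simpa using hx x hx', by simp [abs_of_nonneg hk]⟩,
          fun h' => by simpa [abs_of_nonneg hk] using h'.2⟩
      · exact ⟨⟨by simpa using hx x hx', by simp [abs_of_nonneg hk]⟩,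
          fun h' => by simpa [abs_of_nonneg hk] using h'.2⟩
    · congr 1
      refine intervalIntegral.integral_congr fun x hx' => h ?_
      exact ⟨⟨by simp [abs_of_nonneg hr], by simpa using hy x hx'⟩,
          fun h' => by simpa [abs_of_nonneg hr] using h'.1⟩
  · congr 1
    refine intervalIntegral.integral_congr fun x hx' => h ?_
    exact ⟨⟨by simp [abs_of_nonneg hr], by simpa using hy x hx'⟩,
          fun h' => by simpa [abs_of_nonneg hr] using h'.1⟩

theorem rectIntegral_add {r k : ℝ} (hr : 0 ≤ r) (hk : 0 ≤ k) {f g : ℂ → ℂ}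
    (hf : ContinuousOn f (frame r k)) (hg : ContinuousOn g (frame r k)) :
    rectIntegral r k (fun z => f z + g z) = rectIntegral r k f + rectIntegral r k g := by
  have hf' := continuous_comp_bdry hr hk hf
  have hg' := continuous_comp_bdry hr hk hg
  have hs := continuous_sideVec r k
  rw [rectIntegral_eq_integral hf', rectIntegral_eq_integral hg',
    rectIntegral_eq_integral (hf'.add hg'),
    ← integral_add (integrable_of_continuous _ (f := fun y => f (bdry r k y) * sideVec r k y.1)
      (hf'.mul hs)) (integrable_of_continuous _ (f := fun y => g (bdry r k y) * sideVec r k y.1)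
      (hg'.mul hs))]
  simp only [add_mul]

theorem rectIntegral_const_mul (r k : ℝ) (c : ℂ) (f : ℂ → ℂ) :
    rectIntegral r k (fun z => c * f z) = c * rectIntegral r k f := by
  simp only [rectIntegral, boxIntegral, intervalIntegral.integral_const_mul]
  ring

end Parametrization

end SixVertex

namespace SixVertex

open MeasureTheory Complex

/-! ### The hyperbolic cotangent: poles, period and limits -/

section Cth

theorem sinh_eq_zero_iff {z : ℂ} : sinh z = 0 ↔ ∃ n : ℤ, z = n * (Real.pi * I) := by
  have h : sinh z = 0 ↔ sin (z * I) = 0 := by rw [sin_mul_I]; simp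
  rw [h, sin_eq_zero_iff]
  constructor
  · rintro ⟨n, hn⟩
    refine ⟨-n, ?_⟩
    have : z = -(z * I * I) := by rw [mul_assoc, I_mul_I]; ring
    rw [this, hn]
    push_cast
    ring
  · rintro ⟨n, rfl⟩
    refine ⟨-n, ?_⟩
    have : (n : ℂ) * (Real.pi * I) * I = n * Real.pi * (I * I) := by ring
    rw [this, I_mul_I]
    push_cast
    ring

theorem sinh_ne_zero_of_re {z : ℂ} (h : z.re ≠ 0) : sinh z ≠ 0 := by
  intro h0
  obtain ⟨n, rfl⟩ := sinh_eq_zero_iff.1 h0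
  exact h (by simp)

theorem sinh_ne_zero_of_im {z : ℂ} (h : |z.im| < Real.pi) (hz : z ≠ 0) : sinh z ≠ 0 := by
  intro h0
  obtain ⟨n, rfl⟩ := sinh_eq_zero_iff.1 h0
  have h1 : |(n : ℝ)| * Real.pi < 1 * Real.pi := by
    simpa [abs_mul, abs_of_pos Real.pi_pos] using h
  have h2 : |(n : ℝ)| < 1 := lt_of_mul_lt_mul_right h1 Real.pi_pos.le
  have h3 : n = 0 := by
    have : |n| < 1 := by exact_mod_cast h2
    exact Int.abs_lt_one_iff.1 this
  exact hz (by simp [h3])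

theorem cth_neg (z : ℂ) : cth (-z) = -cth z := by
  simp [cth, div_neg]

theorem sinh_add_pi (z : ℂ) : sinh (z + Real.pi * I) = -sinh z := by
  rw [sinh_add]
  simp [sinh_mul_I, cosh_mul_I]

theorem cosh_add_pi (z : ℂ) : cosh (z + Real.pi * I) = -cosh z := by
  rw [cosh_add]
  simp [sinh_mul_I, cosh_mul_I]

theorem cth_add_pi (z : ℂ) : cth (z + Real.pi * I) = cth z := by
  rw [cth, cth, sinh_add_pi, cosh_add_pi, neg_div_neg_eq]

theorem analyticAt_cth {z : ℂ} (h : sinh z ≠ 0) : AnalyticAt ℂ cth z := by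
  unfold cth
  exact (show AnalyticAt ℂ cosh z by fun_prop).div (by fun_prop) h

theorem analyticAt_cth_sub {x z : ℂ} (h : sinh (z - x) ≠ 0) :
    AnalyticAt ℂ (fun z => cth (z - x)) z :=
  (analyticAt_cth h).fun_comp (f := fun z => z - x) (by fun_prop)

theorem analyticAt_sub_cth {x z : ℂ} (h : sinh (x - z) ≠ 0) :
    AnalyticAt ℂ (fun z => cth (x - z)) z :=
  (analyticAt_cth h).fun_comp (f := fun z => x - z) (by fun_prop)

theorem measurable_cth : Measurable cth := by
  unfold cth
  exact (continuous_cosh.measurable).div continuous_sinh.measurable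

theorem meromorphicAt_cth_sub (x z : ℂ) : MeromorphicAt (fun z => cth (z - x)) z := by
  unfold cth
  exact ((show AnalyticAt ℂ cosh _ by fun_prop).fun_comp (analyticAt_id.sub analyticAt_const)).meromorphicAt.div
    ((show AnalyticAt ℂ sinh _ by fun_prop).fun_comp (analyticAt_id.sub analyticAt_const)).meromorphicAt

theorem meromorphicAt_sub_cth (x z : ℂ) : MeromorphicAt (fun z => cth (x - z)) z := by
  unfold cth
  exact ((show AnalyticAt ℂ cosh _ by fun_prop).fun_comp (analyticAt_const.sub analyticAt_id)).meromorphicAt.div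
    ((show AnalyticAt ℂ sinh _ by fun_prop).fun_comp (analyticAt_const.sub analyticAt_id)).meromorphicAt

theorem tendsto_exp_neg_two_mul :
    Tendsto (fun z : ℂ => exp (-2 * z)) (comap re atTop) (𝓝 0) := by
  rw [tendsto_zero_iff_norm_tendsto_zero]
  have h : (fun z : ℂ => ‖exp (-2 * z)‖) = (fun x : ℝ => Real.exp (-(2 * x))) ∘ re := by
    ext z
    simp [norm_exp]
  rw [h]
  refine Tendsto.comp ?_ tendsto_comap
  exact Real.tendsto_exp_neg_atTop_nhds_zero.comp (tendsto_id.const_mul_atTop two_pos)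

/-- Only exp (-2 z) enters, and its modulus depends on Re z alone; so the limits of `cth` are
uniform in the imaginary part. -/
theorem cth_eq_exp (z : ℂ) : cth z = (1 + exp (-2 * z)) / (1 - exp (-2 * z)) := by
  have h : exp (-2 * z) = exp (-z) * exp (-z) := by rw [← exp_add]; ring_nf
  have h1 : exp z * exp (-z) = 1 := by rw [← exp_add]; simp
  have hne := exp_ne_zero z
  have e1 : 1 + exp (-2 * z) = exp (-z) * (2 * cosh z) := by
    rw [two_cosh, h]; linear_combination -h1
  have e2 : 1 - exp (-2 * z) = exp (-z) * (2 * sinh z) := by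
    rw [two_sinh, h]; linear_combination -h1
  rw [e1, e2, mul_div_mul_left _ _ (exp_ne_zero _), mul_div_mul_left _ _ two_ne_zero, cth]

theorem tendsto_cth_atTop : Tendsto cth (comap re atTop) (𝓝 1) := by
  have h : cth = fun z => (1 + exp (-2 * z)) / (1 - exp (-2 * z)) := funext cth_eq_exp
  rw [h]
  have : Tendsto (fun z => (1 + exp (-2 * z)) / (1 - exp (-2 * z))) (comap re atTop)
      (𝓝 ((1 + 0) / (1 - 0))) :=
    (tendsto_exp_neg_two_mul.const_add 1).div (tendsto_exp_neg_two_mul.const_sub 1) (by simp)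
  simpa using this

theorem tendsto_neg_comap_re : Tendsto (fun z : ℂ => -z) (comap re atBot) (comap re atTop) := by
  rw [tendsto_comap_iff]
  have : re ∘ (fun z : ℂ => -z) = Neg.neg ∘ re := by ext; simp
  rw [this]
  exact tendsto_neg_atBot_atTop.comp tendsto_comap

theorem tendsto_cth_atBot : Tendsto cth (comap re atBot) (𝓝 (-1)) := by
  have h := (tendsto_cth_atTop.comp tendsto_neg_comap_re).neg
  refine h.congr fun z => ?_
  simp [cth_neg]

/-- Bounded shifts do not change the limit of the real part. -/
theorem tendsto_sub_bounded {Y : Type*} {b : Y → ℂ} {B : ℝ} (hb : ∀ y, ‖b y‖ ≤ B) :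
    Tendsto (fun q : ℂ × Y => q.1 - b q.2) (comap re atTop ×ˢ ⊤) (comap re atTop) := by
  rw [tendsto_comap_iff]
  have h1 : Tendsto (fun q : ℂ × Y => q.1.re - B) (comap re atTop ×ˢ ⊤) atTop := by
    have h : Tendsto (fun q : ℂ × Y => q.1.re) (comap re atTop ×ˢ ⊤) atTop :=
      tendsto_comap.comp tendsto_fst
    simpa [sub_eq_add_neg] using tendsto_atTop_add_const_right _ (-B) h
  refine tendsto_atTop_mono (fun q => ?_) h1
  have := (abs_le.1 ((abs_re_le_norm (b q.2)).trans (hb q.2))).2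
  simp only [Function.comp, sub_re]
  linarith

theorem tendsto_sub_const (x : ℂ) : Tendsto (fun z : ℂ => z - x) (comap re atTop) (comap re atTop) := by
  rw [tendsto_comap_iff]
  have h1 : Tendsto (fun q : ℂ => q.re + -x.re) (comap re atTop) atTop :=
    tendsto_atTop_add_const_right _ _ tendsto_comap
  refine h1.congr fun z => ?_
  simp [sub_eq_add_neg]

theorem tendsto_sub_const_atBot (x : ℂ) :
    Tendsto (fun z : ℂ => z - x) (comap re atBot) (comap re atBot) := by
  rw [tendsto_comap_iff]
  have h1 : Tendsto (fun q : ℂ => q.re + -x.re) (comap re atBot) atBot :=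
    tendsto_atBot_add_const_right _ _ tendsto_comap
  refine h1.congr fun z => ?_
  simp [sub_eq_add_neg]

theorem tendsto_cth_sub (x : ℂ) : Tendsto (fun z => cth (z - x)) (comap re atTop) (𝓝 1) :=
  tendsto_cth_atTop.comp (tendsto_sub_const x)

theorem tendsto_cth_sub_atBot (x : ℂ) : Tendsto (fun z => cth (z - x)) (comap re atBot) (𝓝 (-1)) :=
  tendsto_cth_atBot.comp (tendsto_sub_const_atBot x)

theorem tendsto_sub_cth (x : ℂ) : Tendsto (fun z => cth (x - z)) (comap re atTop) (𝓝 (-1)) := by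
  refine (tendsto_cth_sub x).neg.congr fun z => ?_
  rw [← cth_neg, neg_sub]

/-- Uniformity over bounded shifts makes the kernels converge in the norm of C(Sides) when the
spectral parameter goes to infinity, so that a continuous resolvent can be applied to the limit. -/
theorem tendstoUniformly_cth {Y : Type*} {b : Y → ℂ} {B : ℝ} (hb : ∀ y, ‖b y‖ ≤ B) :
    TendstoUniformly (fun (z : ℂ) y => cth (z - b y)) (fun _ => 1) (comap re atTop) := by
  rw [Metric.tendstoUniformly_iff]
  intro ε hε
  have h := (tendsto_cth_atTop.comp (tendsto_sub_bounded hb)).eventually (Metric.ball_mem_nhds 1 hε)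
  rw [← Filter.principal_univ, Filter.eventually_prod_principal_iff] at h
  filter_upwards [h] with z hz y
  rw [dist_comm]
  exact hz y (Set.mem_univ y)

end Cth

end SixVertex

namespace SixVertex

open MeasureTheory Complex

/-! ### Integrals of a density against the kernel `cth` -/

section Transform

variable {Y : Type*} [TopologicalSpace Y] [CompactSpace Y]

/-- By the tube lemma the poles stay away from a whole ball around z₀, uniformly over the compact Y.
The quantity bounded is the derivative of `cth`, as needed for differentiation under the integral.
-/
theorem exists_bound_cthTransform {p : Y → ℂ} (hp : Continuous p) {z₀ : ℂ}
    (h : ∀ y, sinh (z₀ - p y) ≠ 0) :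
    ∃ ε > 0, ∃ B, ∀ z ∈ Metric.closedBall z₀ ε, ∀ y, sinh (z - p y) ≠ 0 ∧
      ‖-1 / sinh (z - p y) ^ 2‖ ≤ B := by
  have hopen : IsOpen {q : ℂ × Y | sinh (q.1 - p q.2) ≠ 0} :=
    isOpen_ne_fun (by fun_prop) continuous_const
  obtain ⟨u, v, hu, -, hzu, hv, huv⟩ := generalized_tube_lemma (isCompact_singleton (x := z₀))
    (isCompact_univ (X := Y)) hopen (by
      rintro ⟨z, y⟩ ⟨hz, -⟩
      rw [Set.mem_singleton_iff] at hz
      subst hz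
      exact h y)
  obtain ⟨ε, hε, hεu⟩ := Metric.nhds_basis_closedBall.mem_iff.1 (hu.mem_nhds (hzu rfl))
  have hne : ∀ z ∈ Metric.closedBall z₀ ε, ∀ y, sinh (z - p y) ≠ 0 := fun z hz y =>
    huv (Set.mk_mem_prod (hεu hz) (hv (Set.mem_univ y)))
  have hc : ContinuousOn (fun q : ℂ × Y => -1 / sinh (q.1 - p q.2) ^ 2)
      (Metric.closedBall z₀ ε ×ˢ Set.univ) := by
    refine ContinuousOn.div (by fun_prop) (by fun_prop) ?_
    rintro ⟨z, y⟩ ⟨hz, -⟩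
    exact pow_ne_zero 2 (hne z hz y)
  obtain ⟨B, hB⟩ := ((isCompact_closedBall z₀ ε).prod
    (isCompact_univ (X := Y))).exists_bound_of_continuousOn hc
  exact ⟨ε, hε, B, fun z hz y => ⟨hne z hz y, hB (z, y) ⟨hz, Set.mem_univ y⟩⟩⟩

variable [MeasurableSpace Y] [BorelSpace Y] (μ : Measure Y) [IsFiniteMeasure μ]

/-- The transform of a density with the kernel `cth`. -/
noncomputable def cthTransform (p : Y → ℂ) (g : Y → ℂ) (z : ℂ) : ℂ :=
  ∫ y, g y * cth (z - p y) ∂μ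

theorem hasDerivAt_cth {z : ℂ} (h : sinh z ≠ 0) : HasDerivAt cth (-1 / sinh z ^ 2) z := by
  have := (hasDerivAt_cosh z).div (hasDerivAt_sinh z) h
  refine this.congr_deriv ?_
  congr 1
  linear_combination -(cosh_sq_sub_sinh_sq z)

theorem differentiableAt_cthTransform {p : Y → ℂ} (hp : Continuous p) {g : Y → ℂ}
    (hg : Continuous g) {z₀ : ℂ} (h : ∀ y, sinh (z₀ - p y) ≠ 0) :
    DifferentiableAt ℂ (cthTransform μ p g) z₀ := by
  obtain ⟨ε, hε, B, hB⟩ := exists_bound_cthTransform hp h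
  have hm : ∀ z, AEStronglyMeasurable (fun y => g y * cth (z - p y)) μ := fun z =>
    (hg.measurable.mul (measurable_cth.comp (hp.measurable.const_sub z))).aestronglyMeasurable
  have hz₀ : z₀ ∈ Metric.closedBall z₀ ε := Metric.mem_closedBall_self hε.le
  have hc : Continuous fun y => g y * cth (z₀ - p y) := by
    refine hg.mul (continuous_iff_continuousAt.2 fun y => ?_)
    exact ContinuousAt.comp (f := fun y => z₀ - p y) (analyticAt_cth (h y)).continuousAt
      (by fun_prop)
  refine (hasDerivAt_integral_of_dominated_loc_of_deriv_le (bound := fun y => ‖g y‖ * B)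
    (F := fun z y => g y * cth (z - p y)) (F' := fun z y => g y * (-1 / sinh (z - p y) ^ 2))
    (s := Metric.closedBall z₀ ε)
    (Metric.closedBall_mem_nhds z₀ hε) (Eventually.of_forall hm)
    (integrable_of_continuous μ hc) ?_ ?_ ?_ ?_).2.differentiableAt
  · refine Measurable.aestronglyMeasurable ?_
    exact hg.measurable.mul (measurable_const.div
      (((continuous_sinh.measurable).comp (hp.measurable.const_sub z₀)).pow_const 2))
  · refine Eventually.of_forall fun y z hz => ?_
    rw [norm_mul]
    exact mul_le_mul_of_nonneg_left (hB z hz y).2 (norm_nonneg _)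
  · exact (((integrable_of_continuous μ hg).norm).mul_const B)
  · refine Eventually.of_forall fun y z hz => ?_
    have h1 := hasDerivAt_cth (hB z hz y).1
    exact (h1.comp_sub_const z (p y)).const_mul (g y)

theorem analyticAt_cthTransform {p : Y → ℂ} (hp : Continuous p) {g : Y → ℂ}
    (hg : Continuous g) {z₀ : ℂ} (h : ∀ y, sinh (z₀ - p y) ≠ 0) :
    AnalyticAt ℂ (cthTransform μ p g) z₀ := by
  rw [analyticAt_iff_eventually_differentiableAt]
  obtain ⟨ε, hε, B, hB⟩ := exists_bound_cthTransform hp h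
  filter_upwards [Metric.closedBall_mem_nhds z₀ hε] with z hz
  exact differentiableAt_cthTransform μ hp hg fun y => (hB z hz y).1

/-- Dominated convergence: far to the right `cth` is within 1 of its limit 1, so the density times 2
dominates, and the limit is the total mass. -/
theorem tendsto_cthTransform {p : Y → ℂ} (hp : Continuous p) {g : Y → ℂ}
    (hg : Continuous g) :
    Tendsto (cthTransform μ p g) (comap re atTop) (𝓝 (∫ y, g y ∂μ)) := by
  obtain ⟨B, hB⟩ := isCompact_univ.exists_bound_of_continuousOn (hp.continuousOn (s := Set.univ))
  have hu := Metric.tendstoUniformly_iff.1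
    (tendstoUniformly_cth (b := p) (B := B) fun y => hB y (Set.mem_univ y)) 1 one_pos
  refine tendsto_integral_filter_of_dominated_convergence (fun y => ‖g y‖ * 2) ?_ ?_ ?_ ?_
  · exact Eventually.of_forall fun z =>
      (hg.measurable.mul (measurable_cth.comp (hp.measurable.const_sub z))).aestronglyMeasurable
  · filter_upwards [hu] with z hz
    refine Eventually.of_forall fun y => ?_
    rw [norm_mul]
    refine mul_le_mul_of_nonneg_left ?_ (norm_nonneg _)
    have h1 := hz y
    rw [dist_eq_norm] at h1
    have h2 := norm_sub_norm_le (cth (z - p y)) 1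
    rw [norm_sub_rev] at h2
    rw [norm_one] at h2
    linarith
  · exact (integrable_of_continuous μ hg).norm.mul_const 2
  · refine Eventually.of_forall fun y => ?_
    simpa using (tendsto_cth_sub (p y)).const_mul (g y)

end Transform

/-! ### Residue calculus with `cth` on a period strip -/

section Residue

/-- The quotient `(f z - f x) cth (z - x)`, continued to the zeros of `sinh (z - x)`. -/
noncomputable def cthQuotient (f : ℂ → ℂ) (x z : ℂ) : ℂ :=
  open Classical in if sinh (z - x) = 0 then deriv f z else (f z - f x) * cth (z - x)

/-- The zero of f - f(x) cancels the simple pole of `cth`. The condition `hx` is also required at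
the translates of x by multiples of πi, where it will follow from periodicity of f. -/
theorem differentiableAt_cthQuotient {f : ℂ → ℂ} {x z₀ : ℂ} (hf : AnalyticAt ℂ f z₀)
    (hx : sinh (z₀ - x) = 0 → f z₀ = f x) : DifferentiableAt ℂ (cthQuotient f x) z₀ := by
  have hloc : ∀ z, sinh (z - x) ≠ 0 → AnalyticAt ℂ f z → DifferentiableAt ℂ (cthQuotient f x) z := by
    intro z hz hfz
    have he : ∀ᶠ w in 𝓝 z, sinh (w - x) ≠ 0 :=
      ContinuousAt.eventually_ne (g := fun w => sinh (w - x)) (by fun_prop) hz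
    have : cthQuotient f x =ᶠ[𝓝 z] fun w => (f w - f x) * cth (w - x) := by
      filter_upwards [he] with w hw
      simp [cthQuotient, hw]
    rw [this.differentiableAt_iff]
    exact ((hfz.sub analyticAt_const).mul (analyticAt_cth_sub hz)).differentiableAt
  by_cases h0 : sinh (z₀ - x) = 0
  swap
  · exact hloc z₀ h0 hf
  have hd : HasDerivAt (fun z => sinh (z - x)) (cosh (z₀ - x)) z₀ :=
    (hasDerivAt_sinh (z₀ - x)).comp_sub_const z₀ x
  have hcosh : cosh (z₀ - x) ≠ 0 := by
    intro hc
    have := cosh_sq_sub_sinh_sq (z₀ - x)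
    rw [hc, h0] at this
    simp at this
  have hne : ∀ᶠ z in 𝓝[≠] z₀, sinh (z - x) ≠ 0 := hd.eventually_ne hcosh
  refine (Complex.analyticAt_of_differentiable_on_punctured_nhds_of_continuousAt ?_ ?_).differentiableAt
  · filter_upwards [hne, nhdsWithin_le_nhds hf.eventually_analyticAt] with z hz hfz
    exact hloc z hz hfz
  · rw [continuousAt_iff_punctured_nhds]
    have hval : cthQuotient f x z₀ = deriv f z₀ := by simp [cthQuotient, h0]
    rw [hval]
    have h1 := hasDerivAt_iff_tendsto_slope.1 hf.differentiableAt.hasDerivAt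
    have h2 := (hasDerivAt_iff_tendsto_slope.1 hd).inv₀ hcosh
    have h3 : Tendsto (fun z => cosh (z - x)) (𝓝[≠] z₀) (𝓝 (cosh (z₀ - x))) :=
      ((show Continuous fun z => cosh (z - x) by fun_prop).tendsto z₀).mono_left nhdsWithin_le_nhds
    -- The quotient is the difference quotient of f divided by that of sinh, times cosh; the two
    -- factors cosh (z₀ - x) cancel in the limit.
    have h4 := (h1.mul h2).mul h3
    rw [mul_assoc, inv_mul_cancel₀ hcosh, mul_one] at h4
    refine h4.congr' ?_
    filter_upwards [hne, self_mem_nhdsWithin] with z hz hzz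
    have hzz' : z - z₀ ≠ 0 := sub_ne_zero.2 hzz
    simp only [cthQuotient, if_neg hz, slope_def_field, h0, sub_zero, cth, hx h0]
    field_simp

/-- Enlarge the rectangle to |Re z| ≤ L, |Im z| ≤ π/2. The horizontal sides cancel by periodicity,
and the vertical ones, of length π, tend to πA and πB as L → ∞. Nothing is assumed about F inside
the original rectangle. -/
theorem rectIntegral_periodic {r k : ℝ} {F : ℂ → ℂ} {A B : ℂ} (hr : 0 ≤ r) (hk : 0 ≤ k)
    (hk' : k ≤ Real.pi / 2) (hper : ∀ z, F (z + Real.pi * I) = F z)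
    (hF : ∀ z : ℂ, |z.im| ≤ Real.pi / 2 → z ∉ openBox r k → DifferentiableAt ℂ F z)
    (hA : Tendsto F (comap re atTop) (𝓝 A)) (hB : Tendsto F (comap re atBot) (𝓝 B)) :
    rectIntegral r k F = Real.pi * I * (A - B) := by
  have hpi := Real.pi_pos
  have hside : ∀ (s : ℝ → ℝ) (C : ℂ), (∀ L, |s L| = |L|) →
      Tendsto (fun z : ℝ × ℝ => F ((s z.1 : ℂ) + z.2 * I)) (atTop ×ˢ ⊤) (𝓝 C) →
      Tendsto (fun L : ℝ => ∫ y in (-(Real.pi / 2))..(Real.pi / 2), F ((s L : ℂ) + y * I)) atTop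
        (𝓝 (Real.pi * C)) := by
    intro s C hs hC
    have h1 : Tendsto (fun L : ℝ => ∫ y in (-(Real.pi / 2))..(Real.pi / 2), F ((s L : ℂ) + y * I))
        atTop (𝓝 (∫ _ in (-(Real.pi / 2))..(Real.pi / 2), C)) := by
      refine intervalIntegral.tendsto_integral_filter_of_dominated_convergence
        (fun _ => ‖C‖ + 1) ?_ ?_ (by simp) ?_
      · filter_upwards [eventually_ge_atTop r] with L hL
        refine ContinuousOn.aestronglyMeasurable ?_ measurableSet_uIoc
        intro y hy
        rw [Set.uIoc_of_le (by linarith)] at hy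
        refine ContinuousAt.continuousWithinAt ?_
        refine ContinuousAt.comp (f := fun y : ℝ => (s L : ℂ) + y * I)
          (hF _ ?_ ?_).continuousAt (by fun_prop)
        · simpa using abs_le.2 ⟨hy.1.le, hy.2⟩
        · intro h
          have := h.1
          simp only [add_re, ofReal_re, mul_re, I_re, mul_zero, ofReal_im, I_im, sub_zero,
            add_zero, zero_mul, hs] at this
          exact absurd (hL.trans (le_abs_self L)) (not_le.2 this)
      · have h2 := hC.norm.eventually (gt_mem_nhds (lt_add_one ‖C‖))
        rw [← Filter.principal_univ, Filter.eventually_prod_principal_iff] at h2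
        filter_upwards [h2] with L hL
        exact Eventually.of_forall fun y _ => (hL y (Set.mem_univ y)).le
      · refine Eventually.of_forall fun y _ => ?_
        exact hC.comp (tendsto_id.prodMk tendsto_top)
    have h2 : (∫ _ in (-(Real.pi / 2))..(Real.pi / 2), C) = Real.pi * C := by
      rw [intervalIntegral.integral_const, Complex.real_smul]
      congr 1
      push_cast
      ring
    rwa [h2] at h1
  have hright := hside id A (fun _ => rfl) (hA.comp (by
    rw [tendsto_comap_iff]
    have : re ∘ (fun z : ℝ × ℝ => ((id z.1 : ℝ) : ℂ) + z.2 * I) = Prod.fst := by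
      ext; simp
    rw [this]
    exact tendsto_fst))
  have hleft := hside Neg.neg B abs_neg (hB.comp (by
    rw [tendsto_comap_iff]
    have : re ∘ (fun z : ℝ × ℝ => ((-z.1 : ℝ) : ℂ) + z.2 * I) = Neg.neg ∘ Prod.fst := by
      ext; simp
    rw [this]
    exact tendsto_neg_atTop_atBot.comp tendsto_fst))
  have hlim := (hright.const_mul I).sub (hleft.const_mul I)
  have hconst : ∀ᶠ L : ℝ in atTop,
      I * (∫ y in (-(Real.pi / 2))..(Real.pi / 2), F (((id L : ℝ) : ℂ) + y * I)) -
      I * (∫ y in (-(Real.pi / 2))..(Real.pi / 2), F (((-L : ℝ) : ℂ) + y * I)) =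
      rectIntegral r k F := by
    filter_upwards [eventually_ge_atTop r] with L hL
    rw [← rectIntegral_eq_of_annulus (R := L) (h := Real.pi / 2) hr hk hL hk'
      fun z hz => hF z hz.1.2 hz.2]
    unfold rectIntegral boxIntegral
    have hh : ∀ x : ℝ, F ((x : ℂ) + ((Real.pi / 2 : ℝ) : ℂ) * I) =
        F ((x : ℂ) + ((-(Real.pi / 2) : ℝ) : ℂ) * I) := fun x => by
      rw [← hper ((x : ℂ) + ((-(Real.pi / 2) : ℝ) : ℂ) * I)]
      congr 1
      push_cast
      ring
    simp only [hh, sub_self, zero_add, id]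
  have huniq := tendsto_nhds_unique (hlim.congr' hconst) tendsto_const_nhds
  rw [← huniq]
  ring

theorem sinh_sub_ne_zero_of_strip {r k : ℝ} {x z : ℂ} (hk : k < Real.pi / 2)
    (hx : x ∈ openBox r k) (hz : |z.im| ≤ Real.pi / 2) (hzx : z ∉ openBox r k) :
    sinh (z - x) ≠ 0 := by
  refine sinh_ne_zero_of_im ?_ (sub_ne_zero.2 fun h => hzx (h ▸ hx))
  rw [sub_im]
  have := hx.2
  exact (abs_sub _ _).trans_lt (by linarith)

/-- With x inside, f · `cth` is regular in the rest of the period strip, and since `cth` tends to ±1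
its limits are A and -B. The function f may have arbitrary singularities inside the rectangle;
`qRatio` has its poles there. -/
theorem rectIntegral_mul_cth_of_mem {r k : ℝ} {f : ℂ → ℂ} {A B x : ℂ} (hr : 0 ≤ r) (hk : 0 ≤ k)
    (hk' : k < Real.pi / 2) (hper : ∀ z, f (z + Real.pi * I) = f z)
    (hf : ∀ z : ℂ, |z.im| ≤ Real.pi / 2 → z ∉ openBox r k → DifferentiableAt ℂ f z)
    (hA : Tendsto f (comap re atTop) (𝓝 A)) (hB : Tendsto f (comap re atBot) (𝓝 B))
    (hx : x ∈ openBox r k) :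
    rectIntegral r k (fun z => f z * cth (z - x)) = Real.pi * I * (A + B) := by
  rw [rectIntegral_periodic (A := A * 1) (B := B * (-1)) hr hk hk'.le]
  · ring
  · intro z
    rw [hper, add_sub_right_comm, cth_add_pi]
  · intro z hz hzx
    exact (hf z hz hzx).mul
      (analyticAt_cth_sub (sinh_sub_ne_zero_of_strip hk' hx hz hzx)).differentiableAt
  · exact hA.mul (tendsto_cth_sub x)
  · exact hB.mul (tendsto_cth_sub_atBot x)

theorem rectIntegral_cth_of_mem {r k : ℝ} {x : ℂ} (hr : 0 ≤ r) (hk : 0 ≤ k)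
    (hk' : k < Real.pi / 2) (hx : x ∈ openBox r k) :
    rectIntegral r k (fun z => cth (z - x)) = 2 * Real.pi * I := by
  have := rectIntegral_mul_cth_of_mem (f := fun _ => 1) (A := 1) (B := 1) hr hk hk' (fun _ => rfl)
    (fun z _ _ => differentiableAt_const 1) tendsto_const_nhds tendsto_const_nhds hx
  simp only [one_mul] at this
  rw [this]
  ring

theorem rectIntegral_cth_of_notMem {r k : ℝ} {x : ℂ} (hr : 0 ≤ r) (hk : 0 ≤ k)
    (hx : ∀ z ∈ closedBox r k, sinh (z - x) ≠ 0) :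
    rectIntegral r k (fun z => cth (z - x)) = 0 :=
  rectIntegral_eq_zero hr hk fun z hz => (analyticAt_cth_sub (hx z hz)).differentiableAt

/-- On a rectangle whose boundary contains no pole, the integral over `f z cth (z - x)` is obtained
from the regularized quotient and the integral of `cth`. -/
theorem rectIntegral_mul_cth_eq {r k : ℝ} {f : ℂ → ℂ} {x : ℂ} (hr : 0 ≤ r) (hk : 0 ≤ k)
    (hf : ∀ z ∈ frame r k, AnalyticAt ℂ f z) (hx : ∀ z ∈ frame r k, sinh (z - x) ≠ 0) :
    rectIntegral r k (fun z => f z * cth (z - x)) =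
      rectIntegral r k (cthQuotient f x) + f x * rectIntegral r k (fun z => cth (z - x)) := by
  rw [← rectIntegral_const_mul, ← rectIntegral_add hr hk]
  · refine rectIntegral_congr hr hk fun z hz => ?_
    simp only [cthQuotient, if_neg (hx z hz)]
    ring
  · intro z hz
    exact (differentiableAt_cthQuotient (hf z hz) fun h =>
      absurd h (hx z hz)).continuousAt.continuousWithinAt
  · intro z hz
    exact (analyticAt_const.mul (analyticAt_cth_sub (hx z hz))).continuousAt.continuousWithinAt

/-- **Cauchy's integral formula** with the kernel `cth`. -/
theorem rectIntegral_mul_cth_eq_value {r k : ℝ} {f : ℂ → ℂ} {x : ℂ} (hr : 0 ≤ r) (hk : 0 ≤ k)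
    (hk' : k < Real.pi / 2) (hf : ∀ z ∈ closedBox r k, AnalyticAt ℂ f z) (hx : x ∈ openBox r k) :
    rectIntegral r k (fun z => f z * cth (z - x)) = 2 * Real.pi * I * f x := by
  have hne : ∀ z ∈ closedBox r k, z ≠ x → sinh (z - x) ≠ 0 := fun z hz hzx => by
    refine sinh_ne_zero_of_im ?_ (sub_ne_zero.2 hzx)
    rw [sub_im]
    exact (abs_sub _ _).trans_lt (by linarith [hx.2, hz.2])
  rw [rectIntegral_mul_cth_eq hr hk (fun z hz => hf z hz.1)
    (fun z hz => hne z hz.1 fun h => hz.2 (h ▸ hx)), rectIntegral_cth_of_mem hr hk hk' hx,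
    rectIntegral_eq_zero hr hk fun z hz => differentiableAt_cthQuotient (hf z hz) fun h => by
      by_contra h'
      exact hne z hz (fun e => h' (e ▸ rfl)) h]
  ring

/-- Cauchy's integral formula for a rectangular annulus, with the kernel `cth`. -/
theorem rectIntegral_annulus_mul_cth {R h r k : ℝ} {f : ℂ → ℂ} {x : ℂ} (hr : 0 ≤ r) (hk : 0 ≤ k)
    (hrR : r ≤ R) (hkh : k ≤ h) (hh : h < Real.pi / 2)
    (hf : ∀ z ∈ closedBox R h \ openBox r k, AnalyticAt ℂ f z) (hx : x ∈ openBox R h)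
    (hx' : x ∉ closedBox r k) :
    rectIntegral R h (fun z => f z * cth (z - x)) =
      rectIntegral r k (fun z => f z * cth (z - x)) + 2 * Real.pi * I * f x := by
  have hne : ∀ z ∈ closedBox R h, z ≠ x → sinh (z - x) ≠ 0 := fun z hz hzx => by
    refine sinh_ne_zero_of_im ?_ (sub_ne_zero.2 hzx)
    rw [sub_im]
    exact (abs_sub _ _).trans_lt (by linarith [hx.2, hz.2])
  have hin : closedBox r k ⊆ closedBox R h := fun z hz => ⟨hz.1.trans hrR, hz.2.trans hkh⟩
  have hout : openBox r k ⊆ openBox R h := fun z hz => ⟨hz.1.trans_le hrR, hz.2.trans_le hkh⟩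
  rw [rectIntegral_mul_cth_eq (hr.trans hrR) (hk.trans hkh)
    (fun z hz => hf z ⟨hz.1, fun h' => hz.2 (hout h')⟩)
    (fun z hz => hne z hz.1 fun h => hz.2 (h ▸ hx)),
    rectIntegral_mul_cth_eq hr hk (fun z hz => hf z ⟨hin hz.1, hz.2⟩)
    (fun z hz => hne z (hin hz.1) fun h => hx' (h ▸ hz.1)),
    rectIntegral_cth_of_mem (hr.trans hrR) (hk.trans hkh) hh hx,
    rectIntegral_cth_of_notMem hr hk (fun z hz => hne z (hin hz) fun h => hx' (h ▸ hz)),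
    rectIntegral_eq_of_annulus hr hk hrR hkh fun z hz =>
      differentiableAt_cthQuotient (hf z hz) fun h => by
        by_contra h'
        exact hne z hz.1 (fun e => h' (e ▸ rfl)) h]
  ring

theorem eq_of_periodic_of_sinh {f : ℂ → ℂ} (hper : ∀ z, f (z + Real.pi * I) = f z) {x z : ℂ}
    (h : sinh (z - x) = 0) : f z = f x := by
  obtain ⟨n, hn⟩ := sinh_eq_zero_iff.1 h
  have hp : Function.Periodic f (Real.pi * I) := hper
  have := hp.int_mul n x
  rw [← this, ← hn]
  congr 1
  ring

/-- The integral of a periodic function times `cth (z - x)`, where `x` is outside. -/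
theorem rectIntegral_mul_cth_of_notMem {r k : ℝ} {f : ℂ → ℂ} {A B x : ℂ} (hr : 0 ≤ r) (hk : 0 ≤ k)
    (hk' : k < Real.pi / 2) (hper : ∀ z, f (z + Real.pi * I) = f z)
    (hf : ∀ z : ℂ, |z.im| ≤ Real.pi / 2 → z ∉ openBox r k → AnalyticAt ℂ f z)
    (hA : Tendsto f (comap re atTop) (𝓝 A)) (hB : Tendsto f (comap re atBot) (𝓝 B))
    (hx : ∀ z ∈ closedBox r k, sinh (z - x) ≠ 0) :
    rectIntegral r k (fun z => f z * cth (z - x)) = Real.pi * I * (A + B - 2 * f x) := by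
  rw [rectIntegral_mul_cth_eq hr hk (fun z hz => hf z (hz.1.2.trans hk'.le) hz.2)
    -- Now x is a pole outside the rectangle. Subtracting f(x) removes it, together with its
    -- translates, and costs nothing because `cth` alone integrates to zero.
    (fun z hz => hx z hz.1), rectIntegral_cth_of_notMem hr hk hx,
    rectIntegral_periodic (A := (A - f x) * 1) (B := (B - f x) * (-1)) hr hk hk'.le]
  · ring
  · intro z
    have hp : (fun w => f (w + Real.pi * I)) = f := funext hper
    have hd : deriv f (z + Real.pi * I) = deriv f z := by rw [← deriv_comp_add_const, hp]
    have he : z + Real.pi * I - x = z - x + Real.pi * I := by ring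
    simp only [cthQuotient, hper, he, cth_add_pi, sinh_add_pi, neg_eq_zero, hd]
  · intro z hz hzx
    exact differentiableAt_cthQuotient (hf z hz hzx) (eq_of_periodic_of_sinh hper)
  · refine ((hA.sub_const (f x)).mul (tendsto_cth_sub x)).congr' ?_
    filter_upwards [tendsto_comap.eventually (eventually_gt_atTop x.re)] with z hz
    have : sinh (z - x) ≠ 0 := sinh_ne_zero_of_re (by rw [sub_re]; exact (sub_pos.2 hz).ne')
    simp [cthQuotient, this]
  · refine ((hB.sub_const (f x)).mul (tendsto_cth_sub_atBot x)).congr' ?_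
    filter_upwards [tendsto_comap.eventually (eventually_lt_atBot x.re)] with z hz
    have : sinh (z - x) ≠ 0 := sinh_ne_zero_of_re (by rw [sub_re]; exact (sub_neg.2 hz).ne)
    simp [cthQuotient, this]

end Residue

end SixVertex

/-! ### Zero-free regions and asymptotics of the eigenvalues -/

namespace SixVertex

open MeasureTheory Complex

/-- Extracting the leading exponentials leaves factors 1 - exp (-2(z - a)) and 1 - exp (-2(z - b)),
which tend to 1 uniformly in the imaginary part. -/
theorem tendsto_sinh_ratio (a b : ℂ) :
    Tendsto (fun z => sinh (z - a) / sinh (z - b)) (comap re atTop) (𝓝 (exp (b - a))) := by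
  have h : ∀ z, sinh (z - a) / sinh (z - b) =
      exp (b - a) * ((1 - exp (-2 * (z - a))) / (1 - exp (-2 * (z - b)))) := fun z => by
    have e : ∀ x : ℂ, sinh x = exp x * (1 - exp (-2 * x)) / 2 := fun x => by
      have : exp (-x) = exp x * exp (-2 * x) := by rw [← exp_add]; ring_nf
      rw [eq_div_iff two_ne_zero, mul_comm, two_sinh, this]
      ring
    have e2 : exp (z - a) = exp (b - a) * exp (z - b) := by rw [← exp_add]; ring_nf
    rw [e, e, e2, div_div_div_cancel_right₀ two_ne_zero, mul_assoc, mul_div_assoc,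
      mul_div_mul_left _ _ (exp_ne_zero _)]
  have hl : Tendsto (fun z => exp (b - a) * ((1 - exp (-2 * (z - a))) / (1 - exp (-2 * (z - b)))))
      (comap re atTop) (𝓝 (exp (b - a) * ((1 - 0) / (1 - 0)))) :=
    (((tendsto_exp_neg_two_mul.comp (tendsto_sub_const a)).const_sub 1).div
      ((tendsto_exp_neg_two_mul.comp (tendsto_sub_const b)).const_sub 1) (by simp)).const_mul _
  simp only [h]
  simpa using hl

theorem tendsto_sinh_ratio_atBot (a b : ℂ) :
    Tendsto (fun z => sinh (z - a) / sinh (z - b)) (comap re atBot) (𝓝 (exp (a - b))) := by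
  have h := (tendsto_sinh_ratio (-a) (-b)).comp tendsto_neg_comap_re
  rw [show -b - -a = a - b by ring] at h
  refine h.congr fun z => ?_
  simp only [Function.comp]
  rw [show -z - -a = -(z - a) by ring, show -z - -b = -(z - b) by ring, sinh_neg, sinh_neg,
    neg_div_neg_eq]

namespace Data

variable {S : Data}

/-- The standing assumptions on the data. -/
structure Admissible (S : Data) : Prop where
  γ_pos : 0 < S.γ
  γ_lt : S.γ < Real.pi / 2
  R_pos : 0 < S.R
  h_pos : 0 < S.h
  h_lt : S.h < S.γ / 2
  baxter₀ : S.IsBaxterPair S.κ S.Λ₀ S.roots₀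
  baxter₁ : S.IsBaxterPair (S.κ + S.α) S.Λ₁ S.roots₁
  shift_mem : S.shift ∈ S.inside
  roots₀_mem : ∀ j, S.roots₀ j ∈ S.inside
  roots₁_mem : ∀ j, S.roots₁ j ∈ S.inside
  ne₀ : ∀ z ∈ S.closedInside, S.Λ₀ z ≠ 0
  ne₁ : ∀ z ∈ S.closedInside, S.Λ₁ z ≠ 0
  ne_κ : 1 + S.qpow (2 * S.κ) ≠ 0

theorem contourIntegral_eq (S : Data) (f : ℂ → ℂ) :
    S.contourIntegral f = rectIntegral S.R S.h f := by
  unfold contourIntegral rectIntegral boxIntegral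
  simp only [ofReal_neg, neg_mul, ← sub_eq_add_neg]
  ring

@[simp] theorem η_re (S : Data) : S.η.re = 0 := by simp [η]

@[simp] theorem η_im (S : Data) : S.η.im = S.γ := by simp [η]

theorem qpow_add (S : Data) (x y : ℂ) : S.qpow (x + y) = S.qpow x * S.qpow y := by
  rw [qpow, qpow, qpow, mul_add, exp_add]

theorem qpow_mul_neg (S : Data) (x : ℂ) : S.qpow x * S.qpow (-x) = 1 := by
  rw [← qpow_add, add_neg_cancel, qpow, mul_zero, exp_zero]

theorem qpow_ne_zero (S : Data) (x : ℂ) : S.qpow x ≠ 0 := exp_ne_zero _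

theorem qpow_two_mul (S : Data) (x : ℂ) : S.qpow (2 * x) = S.qpow x ^ 2 := by
  rw [two_mul, qpow_add, sq]

theorem qpow_neg_two_mul (S : Data) (x : ℂ) : S.qpow (-2 * x) = S.qpow (-x) ^ 2 := by
  rw [← qpow_two_mul]
  ring_nf

theorem eventually_gt_re (r : ℝ) : ∀ᶠ z : ℂ in comap re atTop, r < z.re :=
  tendsto_comap.eventually (eventually_gt_atTop r)

theorem eventually_domain (S : Data) : ∀ᶠ z : ℂ in comap re atTop, z ∈ S.domain := by
  filter_upwards [eventually_gt_re S.R] with z hz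
  exact Or.inr hz

theorem inside_subset (S : Data) : S.inside ⊆ S.closedInside := fun _ hz => ⟨hz.1.le, hz.2.le⟩

namespace Admissible

variable (hS : S.Admissible)

include hS

theorem h_lt_pi : S.h < Real.pi / 2 := by linarith [hS.h_lt, hS.γ_lt, Real.pi_pos]

theorem closedInside_subset_domain : S.closedInside ⊆ S.domain :=
  fun _ hz => Or.inl (hz.2.trans_lt hS.h_lt)

/-- In the strip, h < γ/2 puts the imaginary part of z - p + η between 0 and 2γ < π; to the right of
the contour the real part is positive. This is why η-shifted kernels have no pole while z stays in
the domain. -/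
theorem sinh_add_η_ne_zero {z p : ℂ} (hz : z ∈ S.domain) (hp : p ∈ S.closedInside) :
    sinh (z - p + S.η) ≠ 0 := by
  have hp1 := abs_le.1 hp.1
  have hp2 := abs_le.1 hp.2
  have := hS.h_lt
  have := hS.γ_lt
  have := hS.γ_pos
  rcases hz with hz | hz
  · have hz := abs_lt.1 hz
    have him : (z - p + S.η).im = z.im - p.im + S.γ := by simp
    refine sinh_ne_zero_of_im ?_ fun h => ?_
    · rw [him, abs_lt]
      constructor <;> linarith
    · have := congrArg Complex.im h
      rw [him, Complex.zero_im] at this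
      linarith
  · refine sinh_ne_zero_of_re ?_
    have : (z - p + S.η).re = z.re - p.re := by simp
    rw [this]
    linarith

theorem sinh_sub_η_ne_zero {z p : ℂ} (hz : z ∈ S.domain) (hp : p ∈ S.closedInside) :
    sinh (z - p - S.η) ≠ 0 := by
  have hp1 := abs_le.1 hp.1
  have hp2 := abs_le.1 hp.2
  have := hS.h_lt
  have := hS.γ_lt
  have := hS.γ_pos
  rcases hz with hz | hz
  · have hz := abs_lt.1 hz
    have him : (z - p - S.η).im = z.im - p.im - S.γ := by simp
    refine sinh_ne_zero_of_im ?_ fun h => ?_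
    · rw [him, abs_lt]
      constructor <;> linarith
    · have := congrArg Complex.im h
      rw [him, Complex.zero_im] at this
      linarith
  · refine sinh_ne_zero_of_re ?_
    have : (z - p - S.η).re = z.re - p.re := by simp
    rw [this]
    linarith

theorem sinh_ne_zero {z p : ℂ} (hz : z ∈ S.domain) (hp : p ∈ S.closedInside) (hne : z ≠ p) :
    sinh (z - p) ≠ 0 := by
  have hp1 := abs_le.1 hp.1
  have := hS.h_lt
  have := hS.γ_lt
  rcases hz with hz | hz
  · refine sinh_ne_zero_of_im ?_ (sub_ne_zero.2 hne)
    rw [sub_im]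
    exact (abs_sub _ _).trans_lt (by linarith [hp.2, Real.pi_pos])
  · refine sinh_ne_zero_of_re ?_
    rw [sub_re]
    linarith

theorem neg_shift_mem : -S.shift ∈ S.closedInside := by
  have := hS.shift_mem
  exact ⟨by simpa using this.1.le, by simpa using this.2.le⟩

theorem vacA_pole {z : ℂ} (hz : z ∈ S.domain) : sinh (z + S.shift - S.η) ≠ 0 := by
  have := hS.sinh_sub_η_ne_zero hz hS.neg_shift_mem
  rwa [sub_neg_eq_add] at this

theorem vacD_pole {z : ℂ} (hz : z ∈ S.domain) : sinh (z - S.shift + S.η) ≠ 0 :=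
  hS.sinh_add_η_ne_zero hz (S.inside_subset hS.shift_mem)

theorem qFun_ne_zero {roots : Fin S.M → ℂ} (hr : ∀ j, roots j ∈ S.inside) {z : ℂ}
    (hz : z ∈ S.domain) (hne : ∀ j, z ≠ roots j) : S.qFun roots z ≠ 0 :=
  Finset.prod_ne_zero_iff.2 fun j _ => hS.sinh_ne_zero hz (S.inside_subset (hr j)) (hne j)

theorem qFun_add_ne_zero {roots : Fin S.M → ℂ} (hr : ∀ j, roots j ∈ S.inside) {z : ℂ}
    (hz : z ∈ S.domain) : S.qFun roots (z + S.η) ≠ 0 :=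
  Finset.prod_ne_zero_iff.2 fun j _ => by
    rw [add_sub_right_comm]
    exact hS.sinh_add_η_ne_zero hz (S.inside_subset (hr j))

theorem qFun_sub_ne_zero {roots : Fin S.M → ℂ} (hr : ∀ j, roots j ∈ S.inside) {z : ℂ}
    (hz : z ∈ S.domain) : S.qFun roots (z - S.η) ≠ 0 :=
  Finset.prod_ne_zero_iff.2 fun j _ => by
    rw [sub_right_comm]
    exact hS.sinh_sub_η_ne_zero hz (S.inside_subset (hr j))

theorem analyticAt_Λ₀ {z : ℂ} (hz : z ∈ S.domain) : AnalyticAt ℂ S.Λ₀ z :=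
  (hS.baxter₀ z (hS.vacA_pole hz) (hS.vacD_pole hz)).1

theorem analyticAt_Λ₁ {z : ℂ} (hz : z ∈ S.domain) : AnalyticAt ℂ S.Λ₁ z :=
  (hS.baxter₁ z (hS.vacA_pole hz) (hS.vacD_pole hz)).1

theorem analyticAt_rho {z : ℂ} (hz : z ∈ S.domain) (h : S.Λ₀ z ≠ 0) : AnalyticAt ℂ S.rho z :=
  (hS.analyticAt_Λ₁ hz).div (hS.analyticAt_Λ₀ hz) h

theorem meromorphicAt_rho {z : ℂ} (hz : z ∈ S.domain) : MeromorphicAt S.rho z :=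
  (hS.analyticAt_Λ₁ hz).meromorphicAt.div (hS.analyticAt_Λ₀ hz).meromorphicAt

theorem rho_ne_zero {z : ℂ} (hz : z ∈ S.closedInside) : S.rho z ≠ 0 :=
  div_ne_zero (hS.ne₁ z hz) (hS.ne₀ z hz)

end Admissible

theorem analyticAt_qFun (roots : Fin S.M → ℂ) (z : ℂ) : AnalyticAt ℂ (S.qFun roots) z := by
  unfold qFun
  fun_prop

theorem analyticAt_vacA {z : ℂ} (h : sinh (z + S.shift - S.η) ≠ 0) : AnalyticAt ℂ S.vacA z := by
  unfold vacA
  exact (AnalyticAt.fun_div (f := fun z => sinh (z + S.shift))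
    (g := fun z => sinh (z + S.shift - S.η)) (by fun_prop) (by fun_prop) h).fun_pow _

/-- The ratio of the two `Q`-functions. -/
noncomputable def qRatio (S : Data) (z : ℂ) : ℂ := S.qFun S.roots₁ z / S.qFun S.roots₀ z

/-- The mean of the limits of `qRatio` at `± ∞`. -/
noncomputable def qMean (S : Data) : ℂ :=
  ((∏ j, exp (S.roots₀ j - S.roots₁ j)) + ∏ j, exp (S.roots₁ j - S.roots₀ j)) / 2

/-- The density of `dm`. -/
noncomputable def weight (S : Data) (z : ℂ) : ℂ :=
  S.qpow S.κ * S.vacA z * S.qFun S.roots₀ (z - S.η) /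
    (2 * Real.pi * I * S.Λ₁ z * S.qFun S.roots₀ z)

/-- The function `1 / (1 + 𝔞)`. -/
noncomputable def tau (S : Data) (z : ℂ) : ℂ :=
  S.qpow S.κ * S.vacA z * S.qFun S.roots₀ (z - S.η) / (S.Λ₀ z * S.qFun S.roots₀ z)

/-- The solution, up to normalization, of the transposed equation with constant source. -/
noncomputable def dualSol (S : Data) (z : ℂ) : ℂ :=
  S.qpow (-S.α) * S.qRatio (z + S.η) - S.qpow S.α * S.qRatio (z - S.η)

theorem tendsto_qRatio (S : Data) :
    Tendsto S.qRatio (comap re atTop) (𝓝 (∏ j, exp (S.roots₀ j - S.roots₁ j))) := by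
  have : S.qRatio = fun z => ∏ j, sinh (z - S.roots₁ j) / sinh (z - S.roots₀ j) := by
    ext z
    simp [qRatio, qFun, Finset.prod_div_distrib]
  rw [this]
  exact tendsto_finsetProd _ fun j _ => tendsto_sinh_ratio _ _

theorem tendsto_qRatio_atBot (S : Data) :
    Tendsto S.qRatio (comap re atBot) (𝓝 (∏ j, exp (S.roots₁ j - S.roots₀ j))) := by
  have : S.qRatio = fun z => ∏ j, sinh (z - S.roots₁ j) / sinh (z - S.roots₀ j) := by
    ext z
    simp [qRatio, qFun, Finset.prod_div_distrib]
  rw [this]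
  exact tendsto_finsetProd _ fun j _ => tendsto_sinh_ratio_atBot _ _

theorem qRatio_add_pi (S : Data) (z : ℂ) : S.qRatio (z + Real.pi * I) = S.qRatio z := by
  have : S.qRatio = fun z => ∏ j, sinh (z - S.roots₁ j) / sinh (z - S.roots₀ j) := by
    ext z
    simp [qRatio, qFun, Finset.prod_div_distrib]
  rw [this]
  refine Finset.prod_congr rfl fun j _ => ?_
  rw [add_sub_right_comm, add_sub_right_comm, sinh_add_pi, sinh_add_pi, neg_div_neg_eq]

theorem tendsto_vacA (S : Data) : Tendsto S.vacA (comap re atTop) (𝓝 (exp S.η ^ S.M)) := by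
  have h := (tendsto_sinh_ratio (-S.shift) (S.η - S.shift)).pow S.M
  rw [show S.η - S.shift - -S.shift = S.η by ring] at h
  refine h.congr fun z => ?_
  rw [vacA, show z + S.shift - S.η = z - (S.η - S.shift) by ring, ← sub_neg_eq_add]

theorem tendsto_vacD (S : Data) : Tendsto S.vacD (comap re atTop) (𝓝 (exp (-S.η) ^ S.M)) := by
  have h := (tendsto_sinh_ratio (S.shift) (S.shift - S.η)).pow S.M
  rw [show S.shift - S.η - S.shift = -S.η by ring] at h
  refine h.congr fun z => ?_
  rw [vacD, sub_sub_eq_add_sub, add_sub_right_comm]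

theorem tendsto_qFun_shift (S : Data) (roots : Fin S.M → ℂ) (x : ℂ) :
    Tendsto (fun z => S.qFun roots (z - x) / S.qFun roots z) (comap re atTop)
      (𝓝 (exp (-x) ^ S.M)) := by
  have h : Tendsto (fun z => ∏ j, sinh (z - (roots j + x)) / sinh (z - roots j)) (comap re atTop)
      (𝓝 (∏ j : Fin S.M, exp (roots j - (roots j + x)))) :=
    tendsto_finsetProd _ fun j _ => tendsto_sinh_ratio _ _
  simp only [sub_add_cancel_left, Finset.prod_const, Finset.card_univ, Fintype.card_fin] at h
  refine h.congr fun z => ?_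
  rw [Finset.prod_div_distrib, qFun, qFun]
  congr 1
  refine Finset.prod_congr rfl fun j _ => ?_
  congr 1
  ring

/-- Each of the M factors of the vacuum eigenvalue contributes exp η, and each of the M Bethe roots
contributes exp (-η): the counts agree and the product tends to 1. -/
theorem tendsto_vacA_mul (S : Data) (roots : Fin S.M → ℂ) :
    Tendsto (fun z => S.vacA z * (S.qFun roots (z - S.η) / S.qFun roots z)) (comap re atTop)
      (𝓝 1) := by
  have := S.tendsto_vacA.mul (S.tendsto_qFun_shift roots S.η)
  rwa [← mul_pow, ← exp_add, add_neg_cancel, exp_zero, one_pow] at this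

theorem tendsto_vacD_mul (S : Data) (roots : Fin S.M → ℂ) :
    Tendsto (fun z => S.vacD z * (S.qFun roots (z + S.η) / S.qFun roots z)) (comap re atTop)
      (𝓝 1) := by
  have := S.tendsto_vacD.mul (S.tendsto_qFun_shift roots (-S.η))
  rw [← mul_pow, ← exp_add, neg_neg, neg_add_cancel, exp_zero, one_pow] at this
  simpa only [sub_neg_eq_add] using this

namespace Admissible

variable (hS : S.Admissible)

include hS

/-- Divide Baxter's equation by Q, which has no zeros to the right of the contour; both quotients on
the right tend to 1 apart from the twist factors. -/
theorem tendsto_eigenvalue {k : ℂ} {Λ : ℂ → ℂ} {roots : Fin S.M → ℂ}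
    (hr : ∀ j, roots j ∈ S.inside) (hb : S.IsBaxterPair k Λ roots) :
    Tendsto Λ (comap re atTop) (𝓝 (S.qpow k + S.qpow (-k))) := by
  have h := ((S.tendsto_vacA_mul roots).const_mul (S.qpow k)).add
    ((S.tendsto_vacD_mul roots).const_mul (S.qpow (-k)))
  rw [mul_one, mul_one] at h
  refine h.congr' ?_
  filter_upwards [eventually_gt_re S.R] with z hz
  have hzd : z ∈ S.domain := Or.inr hz
  have hq : S.qFun roots z ≠ 0 := hS.qFun_ne_zero hr hzd fun j hj => by
    have := (hr j).1
    rw [← hj] at this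
    exact absurd (le_abs_self z.re) (not_le.2 (this.trans hz))
  have := (hb z (hS.vacA_pole hzd) (hS.vacD_pole hzd)).2
  rw [← mul_left_inj' hq, this]
  field_simp

theorem eigenvalue_limit_ne_zero : S.qpow S.κ + S.qpow (-S.κ) ≠ 0 := by
  intro h
  apply hS.ne_κ
  rw [qpow_two_mul]
  linear_combination S.qpow S.κ * h - S.qpow_mul_neg S.κ

theorem tendsto_Λ₀ : Tendsto S.Λ₀ (comap re atTop) (𝓝 (S.qpow S.κ + S.qpow (-S.κ))) :=
  hS.tendsto_eigenvalue hS.roots₀_mem hS.baxter₀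

theorem eventually_Λ₀_ne_zero : ∀ᶠ z in comap re atTop, S.Λ₀ z ≠ 0 :=
  hS.tendsto_Λ₀.eventually_ne hS.eigenvalue_limit_ne_zero

theorem one_add_qpow_neg_ne_zero : 1 + S.qpow (-2 * S.κ) ≠ 0 := by
  intro h
  apply hS.ne_κ
  rw [qpow_two_mul]
  rw [qpow_neg_two_mul] at h
  linear_combination S.qpow S.κ ^ 2 * h - (S.qpow S.κ * S.qpow (-S.κ) + 1) * S.qpow_mul_neg S.κ

/-- In accordance with 𝔞 → q^(-2κ) and τ = 1/(1 + 𝔞). -/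
theorem tendsto_tau : Tendsto S.tau (comap re atTop) (𝓝 (1 / (1 + S.qpow (-2 * S.κ)))) := by
  have h := (((S.tendsto_vacA_mul S.roots₀).const_mul (S.qpow S.κ)).div hS.tendsto_Λ₀
    hS.eigenvalue_limit_ne_zero)
  have hv : S.qpow S.κ * 1 / (S.qpow S.κ + S.qpow (-S.κ)) = 1 / (1 + S.qpow (-2 * S.κ)) := by
    rw [div_eq_div_iff hS.eigenvalue_limit_ne_zero hS.one_add_qpow_neg_ne_zero, qpow_neg_two_mul]
    linear_combination S.qpow (-S.κ) * S.qpow_mul_neg S.κ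
  rw [hv] at h
  refine h.congr fun z => ?_
  simp only [Pi.div_apply, tau]
  rw [mul_comm (S.Λ₀ z), ← div_div]
  ring

/-- The limit of the ratio of eigenvalues. -/
theorem tendsto_rho : Tendsto S.rho (comap re atTop) (𝓝 (S.qpow (-S.α) -
    (S.qpow (-S.α) - S.qpow S.α) / (1 + S.qpow (-2 * S.κ)))) := by
  have h := (hS.tendsto_eigenvalue hS.roots₁_mem hS.baxter₁).div hS.tendsto_Λ₀
    hS.eigenvalue_limit_ne_zero
  -- The quotient of the two limits is rewritten as q^(-α) - (q^(-α) - q^α) τ(∞), the form in which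
  -- the total mass cancels in `tendsto_of_resolvent`.
  have hv : S.qpow (-S.α) - (S.qpow (-S.α) - S.qpow S.α) / (1 + S.qpow (-2 * S.κ)) =
      (S.qpow (S.κ + S.α) + S.qpow (-(S.κ + S.α))) / (S.qpow S.κ + S.qpow (-S.κ)) := by
    have h1 := hS.one_add_qpow_neg_ne_zero
    have e : S.qpow S.κ + S.qpow (-S.κ) = S.qpow S.κ * (1 + S.qpow (-2 * S.κ)) := by
      rw [qpow_neg_two_mul]
      linear_combination -S.qpow (-S.κ) * S.qpow_mul_neg S.κ
    have e2 : (S.qpow (-S.α) - S.qpow S.α) / (1 + S.qpow (-2 * S.κ)) *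
        (S.qpow S.κ + S.qpow (-S.κ)) = (S.qpow (-S.α) - S.qpow S.α) * S.qpow S.κ := by
      rw [e, div_mul_eq_mul_div, div_eq_iff h1]
      ring
    rw [eq_div_iff hS.eigenvalue_limit_ne_zero, sub_mul, e2, neg_add, qpow_add, qpow_add]
    ring
  rw [hv]
  exact h

end Admissible

end Data

end SixVertex

/-! ### The measure dm and the explicit solution of the transposed equation -/

namespace SixVertex

open MeasureTheory Complex

namespace Data

variable {S : Data} {r k : ℝ}

/-- A rectangle inside the contour or equal to it, that contains the Bethe roots for the twist `κ`. -/
structure GoodBox (S : Data) (r k : ℝ) : Prop where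
  r_pos : 0 < r
  r_le : r ≤ S.R
  k_pos : 0 < k
  k_le : k ≤ S.h
  roots_mem : ∀ j, S.roots₀ j ∈ openBox r k

/-- The inhomogeneities of the integral equations. -/
noncomputable def source (S : Data) (c ν z : ℂ) : ℂ :=
  S.qpow c * cth (z - ν - S.η) - S.rho ν * cth (z - ν)

theorem analyticAt_qRatio {z : ℂ} (h : S.qFun S.roots₀ z ≠ 0) : AnalyticAt ℂ S.qRatio z :=
  (analyticAt_qFun S.roots₁ z).fun_div (analyticAt_qFun S.roots₀ z) h

theorem GoodBox.closedBox_subset (hB : S.GoodBox r k) : closedBox r k ⊆ S.closedInside :=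
  fun _ hz => ⟨hz.1.trans hB.r_le, hz.2.trans hB.k_le⟩

theorem GoodBox.openBox_subset (hB : S.GoodBox r k) : openBox r k ⊆ S.inside :=
  fun _ hz => ⟨hz.1.trans_le hB.r_le, hz.2.trans_le hB.k_le⟩

theorem GoodBox.bdry_mem (hB : S.GoodBox r k) (y : Sides) : bdry r k y ∈ frame r k :=
  SixVertex.bdry_mem hB.r_pos.le hB.k_pos.le y

theorem GoodBox.bdry_mem_closedInside (hB : S.GoodBox r k) (y : Sides) :
    bdry r k y ∈ S.closedInside :=
  hB.closedBox_subset (hB.bdry_mem y).1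

namespace Admissible

variable (hS : S.Admissible)

include hS

theorem inside_subset_domain : S.inside ⊆ S.domain :=
  S.inside_subset.trans hS.closedInside_subset_domain

theorem qFun₀_ne_zero (hB : S.GoodBox r k) {z : ℂ} (hz : z ∈ S.domain) (hz' : z ∉ openBox r k) :
    S.qFun S.roots₀ z ≠ 0 :=
  hS.qFun_ne_zero hS.roots₀_mem hz fun j h => hz' (h ▸ hB.roots_mem j)

theorem analyticAt_weight_num {z : ℂ} (hz : z ∈ S.domain) :
    AnalyticAt ℂ (fun z => S.qpow S.κ * S.vacA z * S.qFun S.roots₀ (z - S.η)) z :=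
  (analyticAt_const.mul (analyticAt_vacA (hS.vacA_pole hz))).mul
    ((analyticAt_qFun S.roots₀ (z - S.η)).fun_comp (f := fun z => z - S.η) (by fun_prop))

theorem analyticAt_weight {z : ℂ} (hz : z ∈ S.closedInside) (hq : S.qFun S.roots₀ z ≠ 0) :
    AnalyticAt ℂ S.weight z := by
  have hzd := hS.closedInside_subset_domain hz
  refine (hS.analyticAt_weight_num hzd).fun_div
    ((analyticAt_const.mul (hS.analyticAt_Λ₁ hzd)).mul (analyticAt_qFun S.roots₀ z)) ?_
  exact mul_ne_zero (mul_ne_zero two_pi_I_ne_zero (hS.ne₁ z hz)) hq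

theorem analyticAt_tau {z : ℂ} (hz : z ∈ S.domain) (h : S.Λ₀ z ≠ 0)
    (hq : S.qFun S.roots₀ z ≠ 0) : AnalyticAt ℂ S.tau z :=
  (hS.analyticAt_weight_num hz).fun_div
    ((hS.analyticAt_Λ₀ hz).mul (analyticAt_qFun S.roots₀ z)) (mul_ne_zero h hq)

theorem meromorphicAt_tau {z : ℂ} (hz : z ∈ S.domain) : MeromorphicAt S.tau z :=
  (hS.analyticAt_weight_num hz).meromorphicAt.fun_div
    ((hS.analyticAt_Λ₀ hz).mul (analyticAt_qFun S.roots₀ z)).meromorphicAt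

theorem contour_qFun_ne_zero {z : ℂ} (hz : z ∈ S.contour) : S.qFun S.roots₀ z ≠ 0 :=
  hS.qFun_ne_zero hS.roots₀_mem (hS.closedInside_subset_domain hz.1)
    fun j h => hz.2 (h ▸ hS.roots₀_mem j)

/-- Baxter's equation gives 1 + 𝔞 = Λ(·|κ) Q / (q^κ a Q(· - η)); with 1/ρ the factor Λ(·|κ) drops
out. The resulting density is holomorphic inside C except at the Bethe roots for κ, which makes
shrinking the contour possible. -/
theorem integralDm_eq (f : ℂ → ℂ) :
    S.integralDm f = rectIntegral S.R S.h fun z => S.weight z * f z := by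
  rw [integralDm, contourIntegral_eq]
  refine rectIntegral_congr hS.R_pos.le hS.h_pos.le fun z hz => ?_
  have hzd := hS.closedInside_subset_domain hz.1
  have h1 : S.qFun S.roots₀ z ≠ 0 := hS.contour_qFun_ne_zero hz
  have h2 : S.qFun S.roots₀ (z - S.η) ≠ 0 := hS.qFun_sub_ne_zero hS.roots₀_mem hzd
  have h3 : S.vacA z ≠ 0 := by
    refine pow_ne_zero _ (div_ne_zero ?_ (hS.vacA_pole hzd))
    rw [← sub_neg_eq_add]
    refine hS.sinh_ne_zero hzd hS.neg_shift_mem fun h => hz.2 ?_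
    rw [h]
    have := hS.shift_mem
    exact ⟨by simpa using this.1, by simpa using this.2⟩
  have h4 := hS.ne₀ z hz.1
  have h5 := hS.ne₁ z hz.1
  have h6 := (hS.baxter₀ z (hS.vacA_pole hzd) (hS.vacD_pole hzd)).2
  have h7 := S.qpow_ne_zero S.κ
  have haux : 1 + S.aux z =
      S.Λ₀ z * S.qFun S.roots₀ z / (S.qpow S.κ * S.vacA z * S.qFun S.roots₀ (z - S.η)) := by
    have h8 := S.qpow_mul_neg S.κ
    rw [aux, qpow_neg_two_mul, h6]
    field_simp
    linear_combination (S.qpow (-S.κ) * S.vacD z * S.qFun S.roots₀ (z + S.η)) * h8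
  have h9 := two_pi_I_ne_zero
  rw [haux, rho, weight]
  have hpi : (Real.pi : ℂ) ≠ 0 := by exact_mod_cast Real.pi_ne_zero
  field_simp

theorem two_pi_I_mul_weight {z : ℂ} (hz : z ∈ S.closedInside) (hq : S.qFun S.roots₀ z ≠ 0) :
    2 * Real.pi * I * S.weight z * S.rho z = S.tau z := by
  have h4 := hS.ne₀ z hz
  have h5 := hS.ne₁ z hz
  have hpi : (Real.pi : ℂ) ≠ 0 := by exact_mod_cast Real.pi_ne_zero
  have hI := I_ne_zero
  rw [weight, rho, tau]
  field_simp

/-- The central identity. By Baxter's equation for κ, 1 - τ is the second term q^(-κ) d Q(· + η)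
divided by Λ(·|κ) Q. So q^(-α) φ(z+η) (1 - τ) + q^α φ(z-η) τ is the right-hand side of Baxter's
equation for κ + α over Λ(·|κ) Q, which is ρ φ. -/
theorem tau_mul_dualSol {z : ℂ} (hz : z ∈ S.domain) (h : S.Λ₀ z ≠ 0)
    (hq : S.qFun S.roots₀ z ≠ 0) :
    S.tau z * S.dualSol z = S.qpow (-S.α) * S.qRatio (z + S.η) - S.rho z * S.qRatio z := by
  have h0 := (hS.baxter₀ z (hS.vacA_pole hz) (hS.vacD_pole hz)).2
  have h1 := (hS.baxter₁ z (hS.vacA_pole hz) (hS.vacD_pole hz)).2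
  have h2 := hS.qFun_sub_ne_zero hS.roots₀_mem hz
  have h3 := hS.qFun_add_ne_zero hS.roots₀_mem hz
  rw [neg_add, qpow_add, qpow_add] at h1
  rw [tau, dualSol, qRatio, qRatio, qRatio, rho]
  field_simp
  linear_combination S.qFun S.roots₀ (z + S.η) * h1 -
    S.qpow (-S.α) * S.qFun S.roots₁ (z + S.η) * h0

theorem analyticAt_qRatio_add {z : ℂ} (hz : z ∈ S.domain) :
    AnalyticAt ℂ (fun z => S.qRatio (z + S.η)) z :=
  (analyticAt_qRatio (hS.qFun_add_ne_zero hS.roots₀_mem hz)).fun_comp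
    (f := fun z => z + S.η) (by fun_prop)

theorem analyticAt_qRatio_sub {z : ℂ} (hz : z ∈ S.domain) :
    AnalyticAt ℂ (fun z => S.qRatio (z - S.η)) z :=
  (analyticAt_qRatio (hS.qFun_sub_ne_zero hS.roots₀_mem hz)).fun_comp
    (f := fun z => z - S.η) (by fun_prop)

theorem analyticAt_dualSol {z : ℂ} (hz : z ∈ S.domain) : AnalyticAt ℂ S.dualSol z :=
  (analyticAt_const.mul (hS.analyticAt_qRatio_add hz)).sub
    (analyticAt_const.mul (hS.analyticAt_qRatio_sub hz))

theorem analyticAt_kernel_sub {z m : ℂ} (hz : z ∈ S.closedInside) (hm : m ∈ S.domain) :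
    AnalyticAt ℂ (fun z => S.kernel (m - z)) z := by
  unfold kernel
  refine (analyticAt_const.mul ?_).sub (analyticAt_const.mul ?_)
  · exact (analyticAt_cth (hS.sinh_sub_η_ne_zero hm hz)).fun_comp
      (f := fun z => m - z - S.η) (by fun_prop)
  · exact (analyticAt_cth (hS.sinh_add_η_ne_zero hm hz)).fun_comp
      (f := fun z => m - z + S.η) (by fun_prop)

theorem qRatio_strip (hB : S.GoodBox r k) {z : ℂ} (hz : |z.im| ≤ Real.pi / 2)
    (hz' : z ∉ openBox r k) : AnalyticAt ℂ S.qRatio z := by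
  refine analyticAt_qRatio (Finset.prod_ne_zero_iff.2 fun j _ => ?_)
  exact sinh_sub_ne_zero_of_strip (hB.k_le.trans_lt hS.h_lt_pi) (hB.roots_mem j) hz hz'

theorem analyticAt_qRatio_div_rho {z : ℂ} (hz : z ∈ S.closedInside) :
    AnalyticAt ℂ (fun z => S.qpow (-S.α) * S.qRatio (z + S.η) / S.rho z) z := by
  have hzd := hS.closedInside_subset_domain hz
  exact (analyticAt_const.mul (hS.analyticAt_qRatio_add hzd)).fun_div
    (hS.analyticAt_rho hzd (hS.ne₀ z hz)) (hS.rho_ne_zero hz)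

/-- The integral of the dual solution against `cth`, split into the two parts. -/
theorem rectIntegral_dualSol (hB : S.GoodBox r k) {x : ℂ}
    (hx : ∀ z ∈ frame r k, sinh (z - x) ≠ 0) :
    2 * Real.pi * I * rectIntegral r k (fun z => S.weight z * S.dualSol z * cth (z - x)) =
      rectIntegral r k (fun z => S.qpow (-S.α) * S.qRatio (z + S.η) / S.rho z * cth (z - x)) -
        rectIntegral r k (fun z => S.qRatio z * cth (z - x)) := by
  have hin : ∀ z ∈ frame r k, z ∈ S.closedInside := fun z hz =>
    hB.closedBox_subset hz.1
  rw [sub_eq_add_neg, ← neg_one_mul (rectIntegral r k (fun z => S.qRatio z * cth (z - x))),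
    ← rectIntegral_const_mul, ← rectIntegral_const_mul,
    ← rectIntegral_add hB.r_pos.le hB.k_pos.le]
  · refine rectIntegral_congr hB.r_pos.le hB.k_pos.le fun z hz => ?_
    have hzi := hin z hz
    have hzd := hS.closedInside_subset_domain hzi
    have hq := hS.qFun₀_ne_zero hB hzd hz.2
    have h1 := hS.tau_mul_dualSol hzd (hS.ne₀ z hzi) hq
    rw [← hS.two_pi_I_mul_weight hzi hq] at h1
    have h2 := hS.rho_ne_zero hzi
    have h3 : 2 * Real.pi * I * (S.weight z * S.dualSol z) =
        S.qpow (-S.α) * S.qRatio (z + S.η) / S.rho z - S.qRatio z := by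
      rw [eq_sub_iff_add_eq, eq_div_iff h2]
      linear_combination h1
    linear_combination cth (z - x) * h3
  · intro z hz
    exact ((hS.analyticAt_qRatio_div_rho (hin z hz)).mul
      (analyticAt_cth_sub (hx z hz))).continuousAt.continuousWithinAt
  · intro z hz
    have hzd := hS.closedInside_subset_domain (hin z hz)
    exact (analyticAt_const.mul ((analyticAt_qRatio (hS.qFun₀_ne_zero hB hzd hz.2)).mul
      (analyticAt_cth_sub (hx z hz)))).continuousAt.continuousWithinAt

/-- With x outside, the part with φ(z+η)/ρ is holomorphic and integrates to zero; the periodic part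
φ is evaluated over the period strip, giving its value at x and the mean of its limits. -/
theorem rectIntegral_dualSol_of_notMem (hB : S.GoodBox r k) {x : ℂ}
    (hx : ∀ z ∈ closedBox r k, sinh (z - x) ≠ 0) :
    rectIntegral r k (fun z => S.weight z * S.dualSol z * cth (z - x)) =
      S.qRatio x - S.qMean := by
  have h := hS.rectIntegral_dualSol hB fun z hz => hx z hz.1
  have h0 : rectIntegral r k
      (fun z => S.qpow (-S.α) * S.qRatio (z + S.η) / S.rho z * cth (z - x)) = 0 :=
    rectIntegral_eq_zero hB.r_pos.le hB.k_pos.le fun z hz =>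
      ((hS.analyticAt_qRatio_div_rho (hB.closedBox_subset hz)).mul
        (analyticAt_cth_sub (hx z hz))).differentiableAt
  rw [rectIntegral_mul_cth_of_notMem hB.r_pos.le hB.k_pos.le (hB.k_le.trans_lt hS.h_lt_pi)
    S.qRatio_add_pi (fun z h1 h2 => hS.qRatio_strip hB h1 h2) S.tendsto_qRatio
    S.tendsto_qRatio_atBot hx, h0] at h
  rw [← mul_right_inj' two_pi_I_ne_zero, h, qMean]
  ring

/-- With x inside, the holomorphic part contributes its value at x by Cauchy's formula, and the
periodic part only the mean of its limits. -/
theorem rectIntegral_dualSol_of_mem (hB : S.GoodBox r k) {x : ℂ} (hx : x ∈ openBox r k) :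
    rectIntegral r k (fun z => S.weight z * S.dualSol z * cth (z - x)) =
      S.qpow (-S.α) * S.qRatio (x + S.η) / S.rho x - S.qMean := by
  have hk := hB.k_le.trans_lt hS.h_lt_pi
  have h := hS.rectIntegral_dualSol hB fun z hz =>
    sinh_sub_ne_zero_of_strip hk hx (hz.1.2.trans hk.le) hz.2
  rw [rectIntegral_mul_cth_of_mem hB.r_pos.le hB.k_pos.le hk S.qRatio_add_pi
    (fun z h1 h2 => (hS.qRatio_strip hB h1 h2).differentiableAt) S.tendsto_qRatio
    S.tendsto_qRatio_atBot hx, rectIntegral_mul_cth_eq_value hB.r_pos.le hB.k_pos.le hk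
      (fun z hz => hS.analyticAt_qRatio_div_rho (hB.closedBox_subset hz)) hx] at h
  rw [← mul_right_inj' two_pi_I_ne_zero, h, qMean]
  ring

end Admissible

end Data

end SixVertex

/-! ### The integral equation and its transpose on shrunken rectangles -/

namespace SixVertex

open MeasureTheory Complex

namespace Data

variable {S : Data} {r k : ℝ}

/-- The density of `dm` on the boundary of a rectangle, in terms of the parametrization. -/
noncomputable def boxWeight (S : Data) (r k : ℝ) (y : Sides) : ℂ :=
  S.weight (bdry r k y) * sideVec r k y.1

/-- The transform of a function on the boundary with the kernel `cth`. -/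
noncomputable def boxTransform (S : Data) (r k : ℝ) (g : Sides → ℂ) : ℂ → ℂ :=
  cthTransform sidesMeasure (bdry r k) fun y => S.boxWeight r k y * g y

/-- The integral with the kernel `K_α (l - μ)`. -/
noncomputable def fwd (S : Data) (r k : ℝ) (g : Sides → ℂ) (l : ℂ) : ℂ :=
  S.qpow (-S.α) * S.boxTransform r k g (l - S.η) - S.qpow S.α * S.boxTransform r k g (l + S.η)

/-- The integral with the transposed kernel `K_α (μ - m)`. -/
noncomputable def bwd (S : Data) (r k : ℝ) (g : Sides → ℂ) (m : ℂ) : ℂ :=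
  S.qpow S.α * S.boxTransform r k g (m - S.η) - S.qpow (-S.α) * S.boxTransform r k g (m + S.η)

/-- The integral against the inhomogeneity `S.source c ν`. -/
noncomputable def sourceInt (S : Data) (r k : ℝ) (g : Sides → ℂ) (c ν : ℂ) : ℂ :=
  S.rho ν * S.boxTransform r k g ν - S.qpow c * S.boxTransform r k g (ν + S.η)

theorem continuous_cth_bdry {z : ℂ} (hz : ∀ y, sinh (z - bdry r k y) ≠ 0) :
    Continuous fun y => cth (z - bdry r k y) := by
  have := continuous_bdry r k
  refine continuous_iff_continuousAt.2 fun y => ?_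
  exact ContinuousAt.comp (f := fun y => z - bdry r k y) (analyticAt_cth (hz y)).continuousAt
    (by fun_prop)

namespace Admissible

variable (hS : S.Admissible)

include hS

theorem continuousOn_weight (hB : S.GoodBox r k) : ContinuousOn S.weight (frame r k) :=
  fun z hz => by
    have hi := hB.closedBox_subset hz.1
    exact (hS.analyticAt_weight hi (hS.qFun₀_ne_zero hB (hS.closedInside_subset_domain hi)
      hz.2)).continuousAt.continuousWithinAt

theorem continuous_boxWeight (hB : S.GoodBox r k) : Continuous (S.boxWeight r k) :=
  (continuous_comp_bdry hB.r_pos.le hB.k_pos.le (hS.continuousOn_weight hB)).mul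
    (continuous_sideVec r k)

theorem sinh_bdry_sub (hB : S.GoodBox r k) {z : ℂ} (hz : z ∈ S.domain) (y : Sides) :
    sinh (z - S.η - bdry r k y) ≠ 0 := by
  rw [sub_right_comm]
  exact hS.sinh_sub_η_ne_zero hz (hB.bdry_mem_closedInside y)

theorem sinh_bdry_add (hB : S.GoodBox r k) {z : ℂ} (hz : z ∈ S.domain) (y : Sides) :
    sinh (z + S.η - bdry r k y) ≠ 0 := by
  rw [add_sub_right_comm]
  exact hS.sinh_add_η_ne_zero hz (hB.bdry_mem_closedInside y)

theorem sinh_bdry (hB : S.GoodBox r k) {z : ℂ} (hz : z ∈ S.domain) (hf : z ∉ frame r k)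
    (y : Sides) : sinh (z - bdry r k y) ≠ 0 :=
  hS.sinh_ne_zero hz (hB.bdry_mem_closedInside y) fun h => hf (h ▸ hB.bdry_mem y)

theorem analyticAt_boxTransform (hB : S.GoodBox r k) {g : Sides → ℂ} (hg : Continuous g) {z : ℂ}
    (hz : ∀ y, sinh (z - bdry r k y) ≠ 0) : AnalyticAt ℂ (S.boxTransform r k g) z :=
  analyticAt_cthTransform _ (continuous_bdry r k) ((hS.continuous_boxWeight hB).mul hg) hz

theorem tendsto_boxTransform (hB : S.GoodBox r k) {g : Sides → ℂ} (hg : Continuous g) :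
    Tendsto (S.boxTransform r k g) (comap re atTop)
      (𝓝 (∫ y, S.boxWeight r k y * g y ∂sidesMeasure)) :=
  tendsto_cthTransform _ (continuous_bdry r k) ((hS.continuous_boxWeight hB).mul hg)

/-- The sign comes from oddness of `cth`: the transform has argument z - w, the residue formulas w -
z. -/
theorem boxTransform_eq (hB : S.GoodBox r k) {F : ℂ → ℂ} (hF : ContinuousOn F (frame r k)) {z : ℂ}
    (hz : ∀ y, sinh (z - bdry r k y) ≠ 0) :
    S.boxTransform r k (fun y => F (bdry r k y)) z =
      -rectIntegral r k fun w => S.weight w * F w * cth (w - z) := by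
  have h1 := continuous_comp_bdry hB.r_pos.le hB.k_pos.le hF
  have h2 := continuous_comp_bdry hB.r_pos.le hB.k_pos.le (hS.continuousOn_weight hB)
  have h3 := continuous_cth_bdry hz
  have h4 : (fun y => cth (bdry r k y - z)) = fun y => -cth (z - bdry r k y) := by
    ext y
    rw [← cth_neg, neg_sub]
  have h5 : Continuous fun y => cth (bdry r k y - z) := by
    rw [h4]
    exact h3.neg
  rw [rectIntegral_eq_integral ((h2.mul h1).mul h5), ← integral_neg]
  refine integral_congr_ae (Eventually.of_forall fun y => ?_)
  have h6 := congrFun h4 y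
  dsimp only at h6 ⊢
  rw [h6, boxWeight]
  ring

theorem fwd_eq (hB : S.GoodBox r k) {g : Sides → ℂ} (hg : Continuous g) {l : ℂ}
    (hl : l ∈ S.domain) :
    S.fwd r k g l = ∫ y, S.boxWeight r k y * g y * S.kernel (l - bdry r k y) ∂sidesMeasure := by
  have h1 := continuous_cth_bdry (hS.sinh_bdry_sub hB hl)
  have h2 := continuous_cth_bdry (hS.sinh_bdry_add hB hl)
  have hw := hS.continuous_boxWeight hB
  rw [fwd, boxTransform, cthTransform, cthTransform, ← integral_const_mul, ← integral_const_mul,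
    ← integral_sub (integrable_of_continuous _ (by fun_prop))
      (integrable_of_continuous _ (by fun_prop))]
  refine integral_congr_ae (Eventually.of_forall fun y => ?_)
  dsimp only
  rw [kernel, sub_right_comm l, add_sub_right_comm l]
  ring

theorem bwd_eq (hB : S.GoodBox r k) {g : Sides → ℂ} (hg : Continuous g) {m : ℂ}
    (hm : m ∈ S.domain) :
    S.bwd r k g m = ∫ y, S.boxWeight r k y * g y * S.kernel (bdry r k y - m) ∂sidesMeasure := by
  have h1 := continuous_cth_bdry (hS.sinh_bdry_sub hB hm)
  have h2 := continuous_cth_bdry (hS.sinh_bdry_add hB hm)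
  have hw := hS.continuous_boxWeight hB
  rw [bwd, boxTransform, cthTransform, cthTransform, ← integral_const_mul, ← integral_const_mul,
    ← integral_sub (integrable_of_continuous _ (by fun_prop))
      (integrable_of_continuous _ (by fun_prop))]
  refine integral_congr_ae (Eventually.of_forall fun y => ?_)
  dsimp only
  rw [kernel, show bdry r k y - m - S.η = -(m + S.η - bdry r k y) by ring,
    show bdry r k y - m + S.η = -(m - S.η - bdry r k y) by ring, cth_neg, cth_neg]
  ring

theorem sourceInt_eq (hB : S.GoodBox r k) {g : Sides → ℂ} (hg : Continuous g) {c ν : ℂ}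
    (hν : ν ∈ S.domain) (hν' : ν ∉ frame r k) :
    S.sourceInt r k g c ν =
      ∫ y, S.boxWeight r k y * g y * S.source c ν (bdry r k y) ∂sidesMeasure := by
  have h1 := continuous_cth_bdry (hS.sinh_bdry hB hν hν')
  have h2 := continuous_cth_bdry (hS.sinh_bdry_add hB hν)
  have hw := hS.continuous_boxWeight hB
  rw [sourceInt, boxTransform, cthTransform, cthTransform, ← integral_const_mul,
    ← integral_const_mul, ← integral_sub (integrable_of_continuous _ (by fun_prop))
      (integrable_of_continuous _ (by fun_prop))]
  refine integral_congr_ae (Eventually.of_forall fun y => ?_)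
  dsimp only
  rw [source, show bdry r k y - ν - S.η = -(ν + S.η - bdry r k y) by ring,
    show bdry r k y - ν = -(ν - bdry r k y) by ring, cth_neg, cth_neg]
  ring

theorem analyticAt_boxTransform_add (hB : S.GoodBox r k) {g : Sides → ℂ} (hg : Continuous g)
    {l : ℂ} (hl : l ∈ S.domain) : AnalyticAt ℂ (fun l => S.boxTransform r k g (l + S.η)) l :=
  (hS.analyticAt_boxTransform hB hg (hS.sinh_bdry_add hB hl)).fun_comp
    (f := fun l => l + S.η) (by fun_prop)

theorem analyticAt_boxTransform_sub (hB : S.GoodBox r k) {g : Sides → ℂ} (hg : Continuous g)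
    {l : ℂ} (hl : l ∈ S.domain) : AnalyticAt ℂ (fun l => S.boxTransform r k g (l - S.η)) l :=
  (hS.analyticAt_boxTransform hB hg (hS.sinh_bdry_sub hB hl)).fun_comp
    (f := fun l => l - S.η) (by fun_prop)

theorem analyticAt_fwd (hB : S.GoodBox r k) {g : Sides → ℂ} (hg : Continuous g) {l : ℂ}
    (hl : l ∈ S.domain) : AnalyticAt ℂ (S.fwd r k g) l :=
  (analyticAt_const.mul (hS.analyticAt_boxTransform_sub hB hg hl)).sub
    (analyticAt_const.mul (hS.analyticAt_boxTransform_add hB hg hl))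

theorem analyticAt_bwd (hB : S.GoodBox r k) {g : Sides → ℂ} (hg : Continuous g) {l : ℂ}
    (hl : l ∈ S.domain) : AnalyticAt ℂ (S.bwd r k g) l :=
  (analyticAt_const.mul (hS.analyticAt_boxTransform_sub hB hg hl)).sub
    (analyticAt_const.mul (hS.analyticAt_boxTransform_add hB hg hl))

theorem tendsto_boxTransform_add (hB : S.GoodBox r k) {g : Sides → ℂ} (hg : Continuous g) (x : ℂ) :
    Tendsto (fun z => S.boxTransform r k g (z + x)) (comap re atTop)
      (𝓝 (∫ y, S.boxWeight r k y * g y ∂sidesMeasure)) := by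
  have := (hS.tendsto_boxTransform hB hg).comp (tendsto_sub_const (-x))
  simpa only [Function.comp_def, sub_neg_eq_add] using this

theorem tendsto_bwd (hB : S.GoodBox r k) {g : Sides → ℂ} (hg : Continuous g) :
    Tendsto (S.bwd r k g) (comap re atTop)
      (𝓝 ((S.qpow S.α - S.qpow (-S.α)) * ∫ y, S.boxWeight r k y * g y ∂sidesMeasure)) := by
  rw [sub_mul]
  exact (((hS.tendsto_boxTransform hB hg).comp (tendsto_sub_const S.η)).const_mul _).sub
    ((hS.tendsto_boxTransform_add hB hg S.η).const_mul _)

theorem continuous_kernel_bdry (hB : S.GoodBox r k) :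
    Continuous fun q : Sides × Sides => S.kernel (bdry r k q.1 - bdry r k q.2) := by
  have hb := continuous_bdry r k
  have hd := fun y => hS.closedInside_subset_domain (hB.bdry_mem_closedInside y)
  unfold kernel
  refine continuous_iff_continuousAt.2 fun q => ?_
  refine (continuousAt_const.mul ?_).sub (continuousAt_const.mul ?_)
  · refine ContinuousAt.comp (f := fun q : Sides × Sides => bdry r k q.1 - bdry r k q.2 - S.η)
      (analyticAt_cth ?_).continuousAt (by fun_prop)
    exact hS.sinh_sub_η_ne_zero (hd q.1) (hB.bdry_mem_closedInside q.2)
  · refine ContinuousAt.comp (f := fun q : Sides × Sides => bdry r k q.1 - bdry r k q.2 + S.η)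
      (analyticAt_cth ?_).continuousAt (by fun_prop)
    exact hS.sinh_add_η_ne_zero (hd q.1) (hB.bdry_mem_closedInside q.2)

/-- Two integrals over the boundary of nested rectangles agree. -/
theorem integralDm_eq_of_box (hB : S.GoodBox r k) {F : ℂ → ℂ}
    (hF : ∀ z ∈ S.closedInside \ openBox r k, DifferentiableAt ℂ F z) :
    S.integralDm F = ∫ y, S.boxWeight r k y * F (bdry r k y) ∂sidesMeasure := by
  have hw : ∀ z ∈ S.closedInside \ openBox r k, DifferentiableAt ℂ S.weight z := fun z hz =>
    (hS.analyticAt_weight hz.1 (hS.qFun₀_ne_zero hB (hS.closedInside_subset_domain hz.1)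
      hz.2)).differentiableAt
  have hann := rectIntegral_eq_of_annulus (f := fun z => S.weight z * F z) hB.r_pos.le hB.k_pos.le
    hB.r_le hB.k_le fun z hz => (hw z hz).mul (hF z hz)
  rw [hS.integralDm_eq, hann, rectIntegral_eq_integral]
  · refine integral_congr_ae (Eventually.of_forall fun y => ?_)
    dsimp only
    rw [boxWeight]
    ring
  · refine (continuous_comp_bdry hB.r_pos.le hB.k_pos.le (f := fun z => S.weight z * F z) ?_)
    intro z hz
    have hi := hB.closedBox_subset hz.1
    exact ((hw z ⟨hi, hz.2⟩).mul (hF z ⟨hi, hz.2⟩)).continuousAt.continuousWithinAt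

/-- The homogeneous integral equation on the contour has only the trivial solution. -/
theorem homogeneous_eq_zero {g₀ : ℂ → ℂ} {ν : ℂ} (h₀ : S.IsTheSolutionG ν g₀) {g : ℂ → ℂ}
    (hg : ContinuousOn g S.contour)
    (h : ∀ l ∈ S.contour, g l = S.integralDm fun μ => S.kernel (l - μ) * g μ) :
    ∀ l ∈ S.contour, g l = 0 := by
  have hw : ContinuousOn S.weight S.contour := fun z hz =>
    (hS.analyticAt_weight hz.1 (hS.contour_qFun_ne_zero hz)).continuousAt.continuousWithinAt
  have hsol : S.SolvesG ν fun l => g₀ l + g l := by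
    refine ⟨h₀.1.1.add hg, fun l hl => ?_⟩
    dsimp only
    rw [h₀.1.2 l hl, h l hl, add_assoc, hS.integralDm_eq, hS.integralDm_eq, hS.integralDm_eq]
    have hk : ContinuousOn (fun μ => S.kernel (l - μ)) S.contour := fun z hz =>
      (hS.analyticAt_kernel_sub hz.1
        (hS.closedInside_subset_domain hl.1)).continuousAt.continuousWithinAt
    have := rectIntegral_add hS.R_pos.le hS.h_pos.le (hw.mul (hk.mul h₀.1.1))
      (hw.mul (hk.mul hg))
    simp only [Pi.mul_apply] at this
    simp only [mul_add]
    rw [this]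
    rfl
  intro l hl
  have := h₀.2 _ hsol hl
  simpa using this

/-- The homogeneous equation on a smaller rectangle has only the trivial solution. -/
theorem box_homogeneous_eq_zero (hB : S.GoodBox r k) {g₀ : ℂ → ℂ} {ν : ℂ}
    (h₀ : S.IsTheSolutionG ν g₀) {g : Sides → ℂ} (hg : Continuous g)
    (h : ∀ y, g y = S.fwd r k g (bdry r k y)) : ∀ y, g y = 0 := by
  -- The right side of the equation extends g analytically to the whole domain. By Cauchy's theorem
  -- the extension satisfies the homogeneous equation on C itself, where uniqueness is assumed.
  have key : ∀ l ∈ S.domain,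
      S.integralDm (fun μ => S.kernel (l - μ) * S.fwd r k g μ) = S.fwd r k g l := by
    intro l hl
    rw [hS.integralDm_eq_of_box hB, hS.fwd_eq hB hg hl]
    · refine integral_congr_ae (Eventually.of_forall fun y => ?_)
      dsimp only
      rw [← h y]
      ring
    · intro z hz
      exact (hS.analyticAt_kernel_sub hz.1 hl).differentiableAt.mul
        (hS.analyticAt_fwd hB hg (hS.closedInside_subset_domain hz.1)).differentiableAt
  have hzero := hS.homogeneous_eq_zero h₀ (g := S.fwd r k g)
    (fun z hz => (hS.analyticAt_fwd hB hg
      (hS.closedInside_subset_domain hz.1)).continuousAt.continuousWithinAt)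
    (fun l hl => (key l (hS.closedInside_subset_domain hl.1)).symm)
  intro y
  have hy := hS.closedInside_subset_domain (hB.bdry_mem_closedInside y)
  rw [h y, ← key _ hy, hS.integralDm_eq]
  rw [rectIntegral_congr (g := fun _ => 0) hS.R_pos.le hS.h_pos.le]
  · exact rectIntegral_eq_zero hS.R_pos.le hS.h_pos.le fun z _ => differentiableAt_const _
  · intro z hz
    simp [hzero z hz]

/-- The solution operator of the transposed integral equation on a smaller rectangle. -/
theorem exists_box_resolvent (hB : S.GoodBox r k) {g₀ : ℂ → ℂ} {ν : ℂ}
    (h₀ : S.IsTheSolutionG ν g₀) :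
    ∃ T : C(Sides, ℂ) →L[ℂ] C(Sides, ℂ),
      (∀ s u : C(Sides, ℂ), (∀ y, u y = s y + S.bwd r k u (bdry r k y)) ↔ u = T s) ∧
      ∀ s f g : C(Sides, ℂ), (∀ y, g y = f y + S.fwd r k g (bdry r k y)) →
        ∫ y, S.boxWeight r k y * T s y * f y ∂sidesMeasure =
          ∫ y, S.boxWeight r k y * s y * g y ∂sidesMeasure := by
  have hd := fun y => hS.closedInside_subset_domain (hB.bdry_mem_closedInside y)
  let v : C(Sides, ℂ) := ⟨S.boxWeight r k, hS.continuous_boxWeight hB⟩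
  let κ : C(Sides × Sides, ℂ) := ⟨_, hS.continuous_kernel_bdry hB⟩
  have hf : ∀ (g : C(Sides, ℂ)) y,
      intOp sidesMeasure (weightKernel v κ) g y = S.fwd r k g (bdry r k y) := fun g y => by
    rw [hS.fwd_eq hB g.continuous (hd y), intOp_weightKernel_apply]
    refine integral_congr_ae (Eventually.of_forall fun x => ?_)
    change S.kernel (bdry r k y - bdry r k x) * S.boxWeight r k x * g x = _
    dsimp only
    ring
  have hb : ∀ (g : C(Sides, ℂ)) y,
      intOp sidesMeasure (weightKernelT v κ) g y = S.bwd r k g (bdry r k y) := fun g y => by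
    rw [hS.bwd_eq hB g.continuous (hd y), intOp_weightKernelT_apply]
    refine integral_congr_ae (Eventually.of_forall fun x => ?_)
    change S.kernel (bdry r k x - bdry r k y) * S.boxWeight r k x * g x = _
    dsimp only
    ring
  obtain ⟨T, hT⟩ := exists_resolvent_transpose sidesMeasure v κ fun g hg => by
    ext y
    refine hS.box_homogeneous_eq_zero hB h₀ g.continuous (fun y => ?_) y
    rw [← hf]
    exact DFunLike.congr_fun hg y
  refine ⟨T, fun s u => ?_, fun s f g hg => ?_⟩
  · rw [← hT, DFunLike.ext_iff]
    simp only [ContinuousMap.add_apply, hb]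
  · refine integral_dual sidesMeasure v κ ((hT s _).2 rfl) ?_
    ext y
    rw [ContinuousMap.add_apply, hf]
    exact hg y

end Admissible

end Data

end SixVertex

/-! ### Normalization and pairings of the explicit solution -/

namespace SixVertex

open MeasureTheory Complex

namespace Data

variable {S : Data} {r k : ℝ}

theorem sinh_ne_zero_comm {x z : ℂ} (h : sinh (x - z) ≠ 0) : sinh (z - x) ≠ 0 := by
  rw [← neg_sub, sinh_neg]
  exact neg_ne_zero.2 h

theorem boxTransform_const_mul (S : Data) (r k : ℝ) (c : ℂ) (g : Sides → ℂ) (z : ℂ) :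
    S.boxTransform r k (fun y => c * g y) z = c * S.boxTransform r k g z := by
  rw [boxTransform, boxTransform, cthTransform, cthTransform, ← integral_const_mul]
  refine integral_congr_ae (Eventually.of_forall fun y => ?_)
  dsimp only
  ring

theorem bwd_const_mul (S : Data) (r k : ℝ) (c : ℂ) (g : Sides → ℂ) (z : ℂ) :
    S.bwd r k (fun y => c * g y) z = c * S.bwd r k g z := by
  simp only [bwd, boxTransform_const_mul]
  ring

theorem sourceInt_const_mul (S : Data) (r k : ℝ) (c a : ℂ) (g : Sides → ℂ) (z : ℂ) :
    S.sourceInt r k (fun y => c * g y) a z = c * S.sourceInt r k g a z := by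
  simp only [sourceInt, boxTransform_const_mul]
  ring

namespace Admissible

variable (hS : S.Admissible)

include hS

theorem continuousOn_dualSol (hB : S.GoodBox r k) : ContinuousOn S.dualSol (frame r k) :=
  fun _ hz => (hS.analyticAt_dualSol
    (hS.closedInside_subset_domain (hB.closedBox_subset hz.1))).continuousAt.continuousWithinAt

theorem boxTransform_dualSol_of_notMem (hB : S.GoodBox r k) {x : ℂ}
    (hx : ∀ z ∈ closedBox r k, sinh (x - z) ≠ 0) :
    S.boxTransform r k (fun y => S.dualSol (bdry r k y)) x = S.qMean - S.qRatio x := by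
  rw [hS.boxTransform_eq hB (hS.continuousOn_dualSol hB) fun y => hx _ (hB.bdry_mem y).1,
    hS.rectIntegral_dualSol_of_notMem hB fun z hz => sinh_ne_zero_comm (hx z hz), neg_sub]

theorem boxTransform_dualSol_of_mem (hB : S.GoodBox r k) {x : ℂ} (hx : x ∈ openBox r k) :
    S.boxTransform r k (fun y => S.dualSol (bdry r k y)) x =
      S.qMean - S.qpow (-S.α) * S.qRatio (x + S.η) / S.rho x := by
  have hxd := hS.inside_subset_domain (hB.openBox_subset hx)
  rw [hS.boxTransform_eq hB (hS.continuousOn_dualSol hB)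
    (hS.sinh_bdry hB hxd fun h => h.2 hx), hS.rectIntegral_dualSol_of_mem hB hx, neg_sub]

theorem boxTransform_dualSol_add (hB : S.GoodBox r k) {x : ℂ} (hx : x ∈ S.domain) :
    S.boxTransform r k (fun y => S.dualSol (bdry r k y)) (x + S.η) =
      S.qMean - S.qRatio (x + S.η) :=
  hS.boxTransform_dualSol_of_notMem hB fun z hz => by
    rw [add_sub_right_comm]
    exact hS.sinh_add_η_ne_zero hx (hB.closedBox_subset hz)

theorem boxTransform_dualSol_sub (hB : S.GoodBox r k) {x : ℂ} (hx : x ∈ S.domain) :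
    S.boxTransform r k (fun y => S.dualSol (bdry r k y)) (x - S.η) =
      S.qMean - S.qRatio (x - S.η) :=
  hS.boxTransform_dualSol_of_notMem hB fun z hz => by
    rw [sub_right_comm]
    exact hS.sinh_sub_η_ne_zero hx (hB.closedBox_subset hz)

/-- So `dualSol` solves the transposed equation with the constant source `qMean` (q^(-α) - q^α):
both shifted points lie outside the rectangle, where the transform is `qMean` - φ. -/
theorem bwd_dualSol (hB : S.GoodBox r k) {m : ℂ} (hm : m ∈ S.domain) :
    S.bwd r k (fun y => S.dualSol (bdry r k y)) m =
      S.dualSol m - S.qMean * (S.qpow (-S.α) - S.qpow S.α) := by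
  rw [bwd, hS.boxTransform_dualSol_add hB hm, hS.boxTransform_dualSol_sub hB hm, dualSol]
  ring

/-- For ν inside, the transform at ν carries φ(ν+η)/ρ(ν), so multiplication by ρ(ν) makes φ cancel
against the transform at ν + η. -/
theorem sourceInt_dualSol_of_mem (hB : S.GoodBox r k) {ν : ℂ} (hν : ν ∈ openBox r k) :
    S.sourceInt r k (fun y => S.dualSol (bdry r k y)) (-S.α) ν =
      S.qMean * (S.rho ν - S.qpow (-S.α)) := by
  have hi := hB.openBox_subset hν
  have hρ := hS.rho_ne_zero (S.inside_subset hi)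
  rw [sourceInt, hS.boxTransform_dualSol_of_mem hB hν,
    hS.boxTransform_dualSol_add hB (hS.inside_subset_domain hi)]
  field_simp
  ring

/-- For ν outside, the subtracted product is the residue term of the continuation, and
`tau_mul_dualSol` restores the same closed form as inside. -/
theorem sourceInt_dualSol_of_notMem (hB : S.GoodBox r k) {ν : ℂ} (hν : ν ∈ S.domain)
    (hν' : ν ∉ closedBox r k) (h : S.Λ₀ ν ≠ 0) :
    S.sourceInt r k (fun y => S.dualSol (bdry r k y)) (-S.α) ν - S.dualSol ν * S.tau ν =
      S.qMean * (S.rho ν - S.qpow (-S.α)) := by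
  have hq := hS.qFun₀_ne_zero hB hν fun h' => hν' (openBox_subset_closedBox r k h')
  rw [sourceInt, hS.boxTransform_dualSol_add hB hν, hS.boxTransform_dualSol_of_notMem hB
    fun z hz => hS.sinh_ne_zero hν (hB.closedBox_subset hz) fun e => hν' (e ▸ hz)]
  linear_combination -(hS.tau_mul_dualSol hν h hq)

/-- The mean of the limits of the ratio of `Q`-functions does not vanish: otherwise the transposed
homogeneous equation would have a nontrivial solution. -/
theorem qMean_ne_zero (hB : S.GoodBox r k) {T : C(Sides, ℂ) →L[ℂ] C(Sides, ℂ)}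
    (hT : ∀ s u : C(Sides, ℂ), (∀ y, u y = s y + S.bwd r k u (bdry r k y)) ↔ u = T s) :
    S.qMean ≠ 0 := by
  intro h0
  let u : C(Sides, ℂ) := ⟨fun y => S.dualSol (bdry r k y),
    continuous_comp_bdry hB.r_pos.le hB.k_pos.le (hS.continuousOn_dualSol hB)⟩
  have hu : u = T 0 := (hT 0 u).1 fun y => by
    have := hS.bwd_dualSol hB (hS.closedInside_subset_domain (hB.bdry_mem_closedInside y))
    rw [h0, zero_mul, sub_zero] at this
    rw [ContinuousMap.zero_apply, zero_add]
    exact this.symm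
  rw [map_zero] at hu
  have hu' : (fun y => S.dualSol (bdry r k y)) = fun _ => 0 := funext fun y =>
    DFunLike.congr_fun hu y
  -- Any inside point would do. The transform of the zero function vanishes there, yet the explicit
  -- formula is a nonzero multiple of φ(η), because neither Q-function has a zero at the shifted
  -- point.
  have hm : (0 : ℂ) ∈ openBox r k := ⟨by simpa using hB.r_pos, by simpa using hB.k_pos⟩
  have hd := hS.inside_subset_domain (hB.openBox_subset hm)
  have h1 := hS.boxTransform_dualSol_of_mem hB hm
  have h2 : S.boxTransform r k (fun _ => 0) 0 = 0 := by
    simp [boxTransform, cthTransform]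
  rw [hu', h2, h0, zero_sub, eq_comm, neg_eq_zero] at h1
  refine div_ne_zero (mul_ne_zero (S.qpow_ne_zero _) ?_)
    (hS.rho_ne_zero (S.inside_subset (hB.openBox_subset hm))) h1
  exact div_ne_zero (hS.qFun_add_ne_zero hS.roots₁_mem hd) (hS.qFun_add_ne_zero hS.roots₀_mem hd)

/-- The solution of the transposed equation with the constant source `q ^ (-α) - q ^ α`. -/
theorem constSource (hB : S.GoodBox r k) {T : C(Sides, ℂ) →L[ℂ] C(Sides, ℂ)}
    (hT : ∀ s u : C(Sides, ℂ), (∀ y, u y = s y + S.bwd r k u (bdry r k y)) ↔ u = T s) :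
    let u := T (ContinuousMap.const Sides (S.qpow (-S.α) - S.qpow S.α))
    (∀ ν ∈ openBox r k, S.sourceInt r k u (-S.α) ν = S.rho ν - S.qpow (-S.α)) ∧
    ∀ ν ∈ S.domain, ν ∉ closedBox r k → S.Λ₀ ν ≠ 0 →
      S.sourceInt r k u (-S.α) ν - (S.qpow (-S.α) - S.qpow S.α + S.bwd r k u ν) * S.tau ν =
        S.rho ν - S.qpow (-S.α) := by
  have hc := hS.qMean_ne_zero hB hT
  let u₀ : C(Sides, ℂ) := ⟨fun y => S.qMean⁻¹ * S.dualSol (bdry r k y),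
    continuous_const.mul
      (continuous_comp_bdry hB.r_pos.le hB.k_pos.le (hS.continuousOn_dualSol hB))⟩
  have hb : ∀ m ∈ S.domain, S.bwd r k u₀ m =
      S.qMean⁻¹ * S.dualSol m - (S.qpow (-S.α) - S.qpow S.α) := fun m hm => by
    have : S.bwd r k u₀ m = S.qMean⁻¹ * _ := S.bwd_const_mul r k _ _ m
    rw [this, hS.bwd_dualSol hB hm]
    field_simp
  -- The normalized explicit function satisfies the equation, so by uniqueness it is the resolvent
  -- applied to the constant.
  have hu : u₀ = T (ContinuousMap.const Sides (S.qpow (-S.α) - S.qpow S.α)) :=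
    (hT _ _).1 fun y => by
      rw [hb _ (hS.closedInside_subset_domain (hB.bdry_mem_closedInside y))]
      simp [u₀]
  intro u
  have hs : ∀ ν, S.sourceInt r k u (-S.α) ν = S.qMean⁻¹ * _ := fun ν => by
    have : S.sourceInt r k u₀ (-S.α) ν = S.qMean⁻¹ * _ := S.sourceInt_const_mul r k _ _ _ ν
    rwa [hu] at this
  rw [hu] at hb
  refine ⟨fun ν hν => ?_, fun ν hν hν' h => ?_⟩
  · rw [hs, hS.sourceInt_dualSol_of_mem hB hν, inv_mul_cancel_left₀ hc]
  · have h1 := hS.sourceInt_dualSol_of_notMem hB hν hν' h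
    rw [hs, hb ν hν]
    have h2 : S.qMean⁻¹ * S.qMean = 1 := inv_mul_cancel₀ hc
    linear_combination S.qMean⁻¹ * h1 + (S.rho ν - S.qpow (-S.α)) * h2

end Admissible

end Data

end SixVertex

/-! ### Meromorphic continuation across the contour -/

namespace SixVertex

open MeasureTheory Complex

/-- The identity theorem for meromorphic functions, one of them in normal form. -/
theorem eq_of_meromorphicNFAt {U : Set ℂ} (hU : IsPreconnected U) {H Φ : ℂ → ℂ}
    (hH : ∀ z ∈ U, MeromorphicNFAt H z) (hΦ : ∀ z ∈ U, MeromorphicAt Φ z) {z₀ : ℂ} (hz₀ : z₀ ∈ U)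
    (h : ∃ᶠ z in 𝓝[≠] z₀, H z = Φ z) {z : ℂ} (hz : z ∈ U) (hΦz : AnalyticAt ℂ Φ z) :
    H =ᶠ[𝓝 z] Φ := by
  have hd : MeromorphicOn (H - Φ) U := fun w hw => (hH w hw).meromorphicAt.sub (hΦ w hw)
  have h0 : meromorphicOrderAt (H - Φ) z₀ = ⊤ := by
    rw [meromorphicOrderAt_eq_top_iff]
    have := ((hH z₀ hz₀).meromorphicAt.frequently_eq_iff_eventuallyEq (hΦ z₀ hz₀)).1 h
    filter_upwards [this] with w hw
    simp [hw]
  have h1 : meromorphicOrderAt (H - Φ) z = ⊤ := by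
    by_contra hne
    exact hd.meromorphicOrderAt_ne_top_of_isPreconnected hU hz hz₀ hne h0
  rw [meromorphicOrderAt_eq_top_iff] at h1
  refine ((hH z hz).eventuallyEq_nhdsNE_iff_eventuallyEq_nhds hΦz.meromorphicNFAt).1 ?_
  filter_upwards [h1] with w hw
  exact sub_eq_zero.1 hw

namespace Data

variable {S : Data} {r k r' k' : ℝ}

theorem meromorphicAt_source (S : Data) (c ν z : ℂ) : MeromorphicAt (S.source c ν) z := by
  unfold source
  refine (MeromorphicAt.const _ _).fun_mul ?_ |>.fun_sub ((MeromorphicAt.const _ _).fun_mul ?_)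
  · simpa only [sub_sub] using meromorphicAt_cth_sub (ν + S.η) z
  · exact meromorphicAt_cth_sub ν z

theorem meromorphicAt_kernel (S : Data) (m z : ℂ) : MeromorphicAt (fun z => S.kernel (m - z)) z := by
  unfold kernel
  refine (MeromorphicAt.const _ _).fun_mul ?_ |>.fun_sub ((MeromorphicAt.const _ _).fun_mul ?_)
  · simpa only [sub_right_comm] using meromorphicAt_sub_cth (m - S.η) z
  · simpa only [add_sub_right_comm] using meromorphicAt_sub_cth (m + S.η) z

theorem analyticAt_source {c ν z : ℂ} (h1 : sinh (z - ν - S.η) ≠ 0) (h2 : sinh (z - ν) ≠ 0) :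
    AnalyticAt ℂ (S.source c ν) z := by
  unfold source
  refine (analyticAt_const.mul ?_).sub (analyticAt_const.mul ?_)
  · exact (analyticAt_cth h1).fun_comp (f := fun z => z - ν - S.η) (by fun_prop)
  · exact analyticAt_cth_sub h2

namespace Admissible

variable (hS : S.Admissible)

include hS

theorem isPreconnected_domain : IsPreconnected S.domain := by
  have hγ := hS.γ_pos
  have h1 : IsPreconnected {z : ℂ | |z.im| < S.γ / 2} := by
    have := ((convex_Ioi (-(S.γ / 2))).linear_preimage imLm).inter
      ((convex_Iio (S.γ / 2)).linear_preimage imLm)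
    convert this.isPreconnected using 1
    ext z
    exact abs_lt (a := z.im)
  have h2 : IsPreconnected {z : ℂ | S.R < z.re} :=
    ((convex_Ioi S.R).linear_preimage reLm).isPreconnected
  refine h1.union ((S.R + 1 : ℝ) : ℂ) ?_ ?_ h2
  · change |((S.R + 1 : ℝ) : ℂ).im| < S.γ / 2
    rw [ofReal_im, abs_zero]
    linarith
  · change S.R < ((S.R + 1 : ℝ) : ℂ).re
    rw [ofReal_re]
    linarith

/-- The continuation starts in the annulus between two rectangles, so the identity theorem is needed
on the domain with a rectangle removed. That set is a chain of five overlapping convex pieces: the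
half-plane, then the strips to the right, above, to the left and below. -/
theorem isPreconnected_domain_diff (hB : S.GoodBox r k) :
    IsPreconnected (S.domain \ closedBox r k) := by
  have hγ := hS.γ_pos
  have hr := hB.r_pos
  have hk := hB.k_pos
  have hrR := hB.r_le
  have hkh := hB.k_le
  have hh := hS.h_lt
  have ht : ∃ t, k < t ∧ t < S.γ / 2 := exists_between (by linarith)
  obtain ⟨t, ht1, ht2⟩ := ht
  have hre : ∀ x y : ℝ, ((x : ℂ) + y * I).re = x := fun x y => by simp
  have him : ∀ x y : ℝ, ((x : ℂ) + y * I).im = y := fun x y => by simp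
  have p1 : IsPreconnected {z : ℂ | S.R < z.re} :=
    ((convex_Ioi S.R).linear_preimage reLm).isPreconnected
  have p2 : IsPreconnected {z : ℂ | r < z.re ∧ -(S.γ / 2) < z.im ∧ z.im < S.γ / 2} :=
    (((convex_Ioi r).linear_preimage reLm).inter (((convex_Ioi (-(S.γ / 2))).linear_preimage
      imLm).inter ((convex_Iio (S.γ / 2)).linear_preimage imLm))).isPreconnected
  have p3 : IsPreconnected {z : ℂ | z.re < -r ∧ -(S.γ / 2) < z.im ∧ z.im < S.γ / 2} :=
    (((convex_Iio (-r)).linear_preimage reLm).inter (((convex_Ioi (-(S.γ / 2))).linear_preimage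
      imLm).inter ((convex_Iio (S.γ / 2)).linear_preimage imLm))).isPreconnected
  have p4 : IsPreconnected {z : ℂ | k < z.im ∧ z.im < S.γ / 2} :=
    (((convex_Ioi k).linear_preimage imLm).inter
      ((convex_Iio (S.γ / 2)).linear_preimage imLm)).isPreconnected
  have p5 : IsPreconnected {z : ℂ | -(S.γ / 2) < z.im ∧ z.im < -k} :=
    (((convex_Ioi (-(S.γ / 2))).linear_preimage imLm).inter
      ((convex_Iio (-k)).linear_preimage imLm)).isPreconnected
  have q1 := p1.union (((S.R + 1 : ℝ) : ℂ) + (t : ℝ) * I) (by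
      change S.R < _; rw [hre]; linarith)
    (by refine ⟨?_, ?_, ?_⟩ <;> simp only [hre, him] <;> linarith) p2
  have q2 := q1.union (((S.R + 1 : ℝ) : ℂ) + (t : ℝ) * I) (Or.inl (by
      change S.R < _; rw [hre]; linarith))
    (by refine ⟨?_, ?_⟩ <;> simp only [him] <;> linarith) p4
  have q3 := q2.union (((-r - 1 : ℝ) : ℂ) + (t : ℝ) * I) (Or.inr (by
      refine ⟨?_, ?_⟩ <;> simp only [him] <;> linarith))
    (by refine ⟨?_, ?_, ?_⟩ <;> simp only [hre, him] <;> linarith) p3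
  have q4 := q3.union (((-r - 1 : ℝ) : ℂ) + (-t : ℝ) * I) (Or.inr (by
      refine ⟨?_, ?_, ?_⟩ <;> simp only [hre, him] <;> linarith))
    (by refine ⟨?_, ?_⟩ <;> simp only [him] <;> linarith) p5
  convert q4 using 1
  ext z
  simp only [domain, closedBox, Set.mem_sdiff, Set.mem_ofPred_eq, Set.mem_union, not_and_or, not_le,
    abs_lt, lt_abs]
  constructor
  · rintro ⟨h | h, (h' | h') | h' | h'⟩
    · exact Or.inl (Or.inl (Or.inl (Or.inr ⟨h', h⟩)))
    · exact Or.inl (Or.inr ⟨by linarith, h⟩)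
    · exact Or.inl (Or.inl (Or.inr ⟨h', h.2⟩))
    · exact Or.inr ⟨h.1, by linarith⟩
    all_goals exact Or.inl (Or.inl (Or.inl (Or.inl h)))
  · rintro ((((h | h) | h) | h) | h)
    · exact ⟨Or.inr h, Or.inl (Or.inl (by linarith))⟩
    · exact ⟨Or.inl h.2, Or.inl (Or.inl h.1)⟩
    · exact ⟨Or.inl ⟨by linarith, h.2⟩, Or.inr (Or.inl h.1)⟩
    · exact ⟨Or.inl h.2, Or.inl (Or.inr (by linarith))⟩
    · exact ⟨Or.inl ⟨h.1, by linarith⟩, Or.inr (Or.inr (by linarith))⟩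

theorem analyticAt_sourceInt (hB : S.GoodBox r k) {g : Sides → ℂ} (hg : Continuous g) {c ν : ℂ}
    (hν : ν ∈ S.domain) (hf : ν ∉ frame r k) (h : S.Λ₀ ν ≠ 0) :
    AnalyticAt ℂ (S.sourceInt r k g c) ν :=
  ((hS.analyticAt_rho hν h).mul (hS.analyticAt_boxTransform hB hg (hS.sinh_bdry hB hν hf))).sub
    (analyticAt_const.mul (hS.analyticAt_boxTransform_add hB hg hν))

theorem meromorphicAt_sourceInt (hB : S.GoodBox r k) {g : Sides → ℂ} (hg : Continuous g) {c ν : ℂ}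
    (hν : ν ∈ S.domain) (hf : ν ∉ frame r k) :
    MeromorphicAt (S.sourceInt r k g c) ν :=
  ((hS.meromorphicAt_rho hν).mul
    (hS.analyticAt_boxTransform hB hg (hS.sinh_bdry hB hν hf)).meromorphicAt).sub
    (analyticAt_const.mul (hS.analyticAt_boxTransform_add hB hg hν)).meromorphicAt

theorem meromorphicAt_source_right {c x ν : ℂ} (hν : ν ∈ S.domain) :
    MeromorphicAt (fun ν => S.source c ν x) ν := by
  unfold source
  refine (MeromorphicAt.const _ _).fun_mul ?_ |>.fun_sub ((hS.meromorphicAt_rho hν).fun_mul ?_)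
  · simpa only [sub_right_comm] using meromorphicAt_sub_cth (x - S.η) ν
  · exact meromorphicAt_sub_cth x ν

theorem analyticAt_source_right {c x ν : ℂ} (hν : ν ∈ S.domain) (h : S.Λ₀ ν ≠ 0)
    (h1 : sinh (x - ν - S.η) ≠ 0) (h2 : sinh (x - ν) ≠ 0) :
    AnalyticAt ℂ (fun ν => S.source c ν x) ν := by
  unfold source
  refine (analyticAt_const.mul ?_).sub ((hS.analyticAt_rho hν h).mul ?_)
  · exact (analyticAt_cth h1).fun_comp (f := fun ν => x - ν - S.η) (by fun_prop)
  · exact analyticAt_sub_cth h2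

/-- Deforming the contour in `boxTransform` when no pole is crossed. -/
theorem boxTransform_nested (hB : S.GoodBox r k) (hB' : S.GoodBox r' k') (hr : r' ≤ r)
    (hk : k' ≤ k) {Y : ℂ → ℂ} (hY : ∀ z ∈ closedBox r k \ openBox r' k', AnalyticAt ℂ Y z) {x : ℂ}
    (hx : ∀ z ∈ closedBox r k \ openBox r' k', sinh (x - z) ≠ 0) :
    S.boxTransform r k (fun y => Y (bdry r k y)) x =
      S.boxTransform r' k' (fun y => Y (bdry r' k' y)) x := by
  have hin : ∀ z ∈ frame r k, z ∈ closedBox r k \ openBox r' k' := fun z hz =>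
    ⟨hz.1, fun h => hz.2 ⟨h.1.trans_le hr, h.2.trans_le hk⟩⟩
  have hin' : ∀ z ∈ frame r' k', z ∈ closedBox r k \ openBox r' k' := fun z hz =>
    ⟨⟨hz.1.1.trans hr, hz.1.2.trans hk⟩, hz.2⟩
  rw [hS.boxTransform_eq hB (fun z hz => (hY z (hin z hz)).continuousAt.continuousWithinAt)
    (fun y => hx _ (hin _ (hB.bdry_mem y))),
    hS.boxTransform_eq hB' (fun z hz => (hY z (hin' z hz)).continuousAt.continuousWithinAt)
    (fun y => hx _ (hin' _ (hB'.bdry_mem y))),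
    rectIntegral_eq_of_annulus hB'.r_pos.le hB'.k_pos.le hr hk]
  intro z hz
  have hi := hB.closedBox_subset hz.1
  exact (((hS.analyticAt_weight hi (hS.qFun₀_ne_zero hB' (hS.closedInside_subset_domain hi)
    hz.2)).mul (hY z hz)).mul (analyticAt_cth_sub (sinh_ne_zero_comm (hx z hz)))).differentiableAt

/-- Deforming the contour in `boxTransform` across the pole. -/
theorem boxTransform_residue (hB : S.GoodBox r k) (hB' : S.GoodBox r' k') (hr : r' ≤ r)
    (hk : k' ≤ k) {Y : ℂ → ℂ} (hY : ∀ z ∈ closedBox r k \ openBox r' k', AnalyticAt ℂ Y z) {x : ℂ}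
    (hx : x ∈ openBox r k) (hx' : x ∉ closedBox r' k') :
    S.boxTransform r k (fun y => Y (bdry r k y)) x =
      S.boxTransform r' k' (fun y => Y (bdry r' k' y)) x -
        2 * Real.pi * I * (S.weight x * Y x) := by
  have hin : ∀ z ∈ frame r k, z ∈ closedBox r k \ openBox r' k' := fun z hz =>
    ⟨hz.1, fun h => hz.2 ⟨h.1.trans_le hr, h.2.trans_le hk⟩⟩
  have hin' : ∀ z ∈ frame r' k', z ∈ closedBox r k \ openBox r' k' := fun z hz =>
    ⟨⟨hz.1.1.trans hr, hz.1.2.trans hk⟩, hz.2⟩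
  have hxd := hS.inside_subset_domain (hB.openBox_subset hx)
  rw [hS.boxTransform_eq hB (fun z hz => (hY z (hin z hz)).continuousAt.continuousWithinAt)
    (hS.sinh_bdry hB hxd fun h => h.2 hx),
    hS.boxTransform_eq hB' (fun z hz => (hY z (hin' z hz)).continuousAt.continuousWithinAt)
    (hS.sinh_bdry hB' hxd fun h => hx' h.1),
    rectIntegral_annulus_mul_cth (f := fun z => S.weight z * Y z) hB'.r_pos.le hB'.k_pos.le hr hk
      (hB.k_le.trans_lt hS.h_lt_pi) ?_ hx hx']
  · ring
  intro z hz
  have hi := hB.closedBox_subset hz.1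
  exact (hS.analyticAt_weight hi (hS.qFun₀_ne_zero hB' (hS.closedInside_subset_domain hi)
    hz.2)).mul (hY z hz)

theorem boxTransform_add_nested (hB : S.GoodBox r k) (hB' : S.GoodBox r' k') (hr : r' ≤ r)
    (hk : k' ≤ k) {Y : ℂ → ℂ} (hY : ∀ z ∈ closedBox r k \ openBox r' k', AnalyticAt ℂ Y z) {x : ℂ}
    (hx : x ∈ S.domain) :
    S.boxTransform r k (fun y => Y (bdry r k y)) (x + S.η) =
      S.boxTransform r' k' (fun y => Y (bdry r' k' y)) (x + S.η) :=
  hS.boxTransform_nested hB hB' hr hk hY fun z hz => by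
    rw [add_sub_right_comm]
    exact hS.sinh_add_η_ne_zero hx (hB.closedBox_subset hz.1)

/-- Continuation of the integral against `S.source c ν` with respect to `ν` to the outside of the
rectangle. -/
theorem continuation (hB : S.GoodBox r k) (hB' : S.GoodBox r' k') (hr : r' < r)
    (hk : k' < k) {Y : ℂ → ℂ} (hY : ∀ z ∈ closedBox r k \ openBox r' k', AnalyticAt ℂ Y z)
    (hYm : ∀ z ∈ S.domain, MeromorphicAt Y z) {H : ℂ → ℂ} (hH : MeromorphicNFOn H S.domain)
    {c c' t x : ℂ} (hHY : ∀ ν ∈ openBox r k, ν ≠ x →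
      H ν = S.sourceInt r k (fun y => Y (bdry r k y)) c ν + t * S.source c' ν x)
    {ν : ℂ} (hν : ν ∈ S.domain) (hν' : ν ∉ closedBox r k) (hΛ : S.Λ₀ ν ≠ 0)
    (hYν : AnalyticAt ℂ Y ν) (ht : t = 0 ∨ (sinh (x - ν - S.η) ≠ 0 ∧ sinh (x - ν) ≠ 0)) :
    H ν = S.sourceInt r k (fun y => Y (bdry r k y)) c ν - Y ν * S.tau ν + t * S.source c' ν x := by
  have hsub : closedBox r' k' ⊆ openBox r k := closedBox_subset_openBox hr hk
  have hYc : Continuous fun y => Y (bdry r' k' y) :=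
    continuous_comp_bdry hB'.r_pos.le hB'.k_pos.le fun z hz =>
      (hY z ⟨openBox_subset_closedBox r k (hsub hz.1), hz.2⟩).continuousAt.continuousWithinAt
  -- The candidate uses the smaller rectangle. In the annulus between the rectangles, shrinking the
  -- contour crosses the pole at ν and gives -2πi w(ν) Y(ν), w being the density `weight` of dm; the
  -- factor ρ(ν) turns this into -Y(ν) τ(ν).
  set Φ : ℂ → ℂ := fun ν => S.sourceInt r' k' (fun y => Y (bdry r' k' y)) c ν - Y ν * S.tau ν +
    t * S.source c' ν x with hΦ
  have hΦm : ∀ z ∈ S.domain \ closedBox r' k', MeromorphicAt Φ z := fun z hz =>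
    ((hS.meromorphicAt_sourceInt hB' hYc hz.1 fun h => hz.2 h.1).fun_sub
      ((hYm z hz.1).fun_mul (hS.meromorphicAt_tau hz.1))).fun_add
      ((MeromorphicAt.const _ _).fun_mul (hS.meromorphicAt_source_right hz.1))
  have heq : ∀ z ∈ openBox r k, z ∉ closedBox r' k' → z ≠ x → H z = Φ z := by
    intro z hz hz' hzx
    have hi := S.inside_subset (hB.openBox_subset hz)
    have hd := hS.closedInside_subset_domain hi
    rw [hHY z hz hzx, hΦ]
    dsimp only
    rw [sourceInt, sourceInt, hS.boxTransform_residue hB hB' hr.le hk.le hY hz hz',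
      hS.boxTransform_add_nested hB hB' hr.le hk.le hY hd,
      ← hS.two_pi_I_mul_weight hi (hS.qFun₀_ne_zero hB' hd
        fun h => hz' (openBox_subset_closedBox _ _ h))]
    ring
  -- A real point of the annulus; near it both expressions agree, except possibly at x.
  obtain ⟨m, hm1, hm2⟩ := exists_between hr
  have hmpos : 0 < m := hB'.r_pos.trans hm1
  have hmo : ((m : ℝ) : ℂ) ∈ openBox r k :=
    ⟨by simpa [abs_of_pos hmpos] using hm2, by simpa using hB.k_pos⟩
  have hmc : ((m : ℝ) : ℂ) ∉ closedBox r' k' := fun h => by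
    have := h.1
    rw [ofReal_re, abs_of_pos hmpos] at this
    linarith
  have hev : ∀ᶠ z in 𝓝[≠] ((m : ℝ) : ℂ), H z = Φ z := by
    have h1 : ∀ᶠ z in 𝓝 ((m : ℝ) : ℂ), z ∈ openBox r k := (isOpen_openBox r k).mem_nhds hmo
    have h2 : ∀ᶠ z in 𝓝 ((m : ℝ) : ℂ), z ∉ closedBox r' k' :=
      (isClosed_closedBox r' k').isOpen_compl.mem_nhds hmc
    have h3 : ∀ᶠ z in 𝓝[≠] ((m : ℝ) : ℂ), z ≠ x := by
      by_cases hx : ((m : ℝ) : ℂ) = x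
      · rw [← hx]
        exact self_mem_nhdsWithin
      · exact nhdsWithin_le_nhds (isOpen_ne.mem_nhds hx)
    filter_upwards [nhdsWithin_le_nhds h1, nhdsWithin_le_nhds h2, h3] with z a b c
    exact heq z a b c
  have hν'' : ν ∉ closedBox r' k' := fun h => hν' (openBox_subset_closedBox r k (hsub h))
  have hΦa : AnalyticAt ℂ Φ ν := by
    refine ((hS.analyticAt_sourceInt hB' hYc hν (fun h => hν'' h.1) hΛ).fun_sub (hYν.fun_mul
      (hS.analyticAt_tau hν hΛ (hS.qFun₀_ne_zero hB hν
        fun h => hν' (openBox_subset_closedBox r k h))))).fun_add ?_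
    rcases ht with ht | ht
    · simp only [ht, zero_mul]
      exact analyticAt_const
    · exact analyticAt_const.fun_mul (hS.analyticAt_source_right hν hΛ ht.1 ht.2)
  have hfin := (eq_of_meromorphicNFAt (hS.isPreconnected_domain_diff hB')
    (fun z hz => hH hz.1) hΦm
    ⟨hS.inside_subset_domain (hB.openBox_subset hmo), hmc⟩ hev.frequently ⟨hν, hν''⟩
    hΦa).self_of_nhds
  rw [hfin, hΦ]
  dsimp only
  -- With ν outside both rectangles, the contour goes back to the larger one without crossing a
  -- pole.
  rw [sourceInt, sourceInt, hS.boxTransform_add_nested hB hB' hr.le hk.le hY hν,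
    hS.boxTransform_nested hB hB' hr.le hk.le hY fun z hz =>
      hS.sinh_ne_zero hν (hB.closedBox_subset hz.1) fun e => hν' (e ▸ hz.1)]

end Admissible

end Data

end SixVertex

/-! ### G and Ψ expressed by the transposed resolvent -/

namespace SixVertex

open MeasureTheory Complex

namespace Data

variable {S : Data} {r k r' k' : ℝ}

/-- There are finitely many Bethe roots and they lie strictly inside, so there is room to shrink. It
makes room for an annulus in the continuation argument and puts points on C outside the new
rectangle. -/
theorem GoodBox.exists_lt (hB : S.GoodBox r k) {p : ℂ} (hp : p ∈ openBox r k) :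
    ∃ r' k', r' < r ∧ k' < k ∧ S.GoodBox r' k' ∧ p ∈ openBox r' k' := by
  have h1 : ∀ᶠ x in 𝓝[<] r, 0 < x ∧ |p.re| < x ∧ ∀ j, |(S.roots₀ j).re| < x := by
    refine nhdsWithin_le_nhds ((lt_mem_nhds hB.r_pos).and ((lt_mem_nhds hp.1).and ?_))
    exact eventually_all.2 fun j => lt_mem_nhds (hB.roots_mem j).1
  have h2 : ∀ᶠ x in 𝓝[<] k, 0 < x ∧ |p.im| < x ∧ ∀ j, |(S.roots₀ j).im| < x := by
    refine nhdsWithin_le_nhds ((lt_mem_nhds hB.k_pos).and ((lt_mem_nhds hp.2).and ?_))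
    exact eventually_all.2 fun j => lt_mem_nhds (hB.roots_mem j).2
  obtain ⟨r', ⟨a1, a2, a3⟩, a4⟩ := (h1.and self_mem_nhdsWithin).exists
  obtain ⟨k', ⟨b1, b2, b3⟩, b4⟩ := (h2.and self_mem_nhdsWithin).exists
  exact ⟨r', k', a4, b4, ⟨a1, (le_of_lt a4).trans hB.r_le, b1, (le_of_lt b4).trans hB.k_le,
    fun j => ⟨a3 j, b3 j⟩⟩, a2, b2⟩

namespace Admissible

variable (hS : S.Admissible)

include hS

theorem goodBox : S.GoodBox S.R S.h :=
  ⟨hS.R_pos, le_rfl, hS.h_pos, le_rfl, hS.roots₀_mem⟩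

theorem integralDm_eq_bdry {F : ℂ → ℂ} (hF : ContinuousOn F S.contour) :
    S.integralDm F = ∫ y, S.boxWeight S.R S.h y * F (bdry S.R S.h y) ∂sidesMeasure := by
  rw [hS.integralDm_eq, rectIntegral_eq_integral]
  · refine integral_congr_ae (Eventually.of_forall fun y => ?_)
    dsimp only
    rw [boxWeight]
    ring
  · exact (continuous_comp_bdry hS.R_pos.le hS.h_pos.le (f := fun z => S.weight z * F z)
      ((hS.continuousOn_weight hS.goodBox).mul hF))

/-- Points on the right side of the rectangle accumulate at R; there the integral equation feeds the
identity theorem. -/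
theorem frequently_contour : ∃ᶠ z in 𝓝[≠] (S.R : ℂ), z ∈ S.contour := by
  have h1 : Tendsto (fun t : ℝ => (S.R : ℂ) + t * I) (𝓝[≠] 0) (𝓝[≠] (S.R : ℂ)) := by
    refine tendsto_nhdsWithin_iff.2 ⟨?_, ?_⟩
    · have : Continuous fun t : ℝ => (S.R : ℂ) + t * I := by fun_prop
      have h := (this.tendsto 0).mono_left (nhdsWithin_le_nhds (s := {0}ᶜ))
      simpa using h
    · filter_upwards [self_mem_nhdsWithin] with t ht h
      refine ht ?_
      have := congrArg im (Set.mem_singleton_iff.1 h)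
      simpa using this
  refine h1.frequently (Eventually.frequently ?_)
  have h2 : ∀ᶠ t : ℝ in 𝓝 0, |t| < S.h :=
    (continuous_abs.tendsto 0).eventually (gt_mem_nhds (by simpa using hS.h_pos))
  filter_upwards [nhdsWithin_le_nhds h2] with t ht
  have hR := hS.R_pos
  refine ⟨⟨?_, ?_⟩, fun h => ?_⟩
  · simp [abs_of_pos hR]
  · simpa using ht.le
  · have := h.1
    simp [abs_of_pos hR] at this

section G

variable {G : ℂ → ℂ → ℂ} (hG : S.IsG G)

include hG

theorem continuous_G_contour {ν : ℂ} (hν : ν ∈ S.inside) :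
    Continuous fun y => G (bdry S.R S.h y) ν :=
  continuous_comp_bdry (f := fun l => G l ν) hS.R_pos.le hS.h_pos.le (hG.solution ν hν).1.1

theorem integralDm_kernel_G {l ν : ℂ} (hν : ν ∈ S.inside) (hl : l ∈ S.domain) :
    (S.integralDm fun μ => S.kernel (l - μ) * G μ ν) =
      S.fwd S.R S.h (fun y => G (bdry S.R S.h y) ν) l := by
  rw [hS.integralDm_eq_bdry, hS.fwd_eq hS.goodBox (hS.continuous_G_contour hG hν) hl]
  · refine integral_congr_ae (Eventually.of_forall fun y => ?_)
    dsimp only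
    ring
  · refine ContinuousOn.mul (fun z hz => ?_) (hG.solution ν hν).1.1
    exact (hS.analyticAt_kernel_sub hz.1 hl).continuousAt.continuousWithinAt

/-- The equation holds on C, and both sides are meromorphic on the connected domain. Since the right
side is analytic away from ν, the normal form of G has its value there. -/
theorem eventuallyEq_G {l ν : ℂ} (hν : ν ∈ S.inside) (hl : l ∈ S.domain) (h : l ≠ ν) :
    (fun l => G l ν) =ᶠ[𝓝 l] fun l => S.source (-S.α) ν l +
      S.fwd S.R S.h (fun y => G (bdry S.R S.h y) ν) l := by
  have hc := hS.continuous_G_contour hG hν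
  have hR : (S.R : ℂ) ∈ S.domain := by
    left
    have := hS.γ_pos
    simpa using this
  refine eq_of_meromorphicNFAt hS.isPreconnected_domain
    (fun z hz => hG.continuation_left ν hν hz) (fun z hz => ?_) hR ?_ hl ?_
  · exact (meromorphicAt_source S _ _ _).fun_add
      (hS.analyticAt_fwd hS.goodBox hc hz).meromorphicAt
  · refine hS.frequently_contour.mono fun z hz => ?_
    have := (hG.solution ν hν).1.2 z hz
    dsimp only at this
    rw [this, hS.integralDm_kernel_G hG hν (hS.closedInside_subset_domain hz.1)]
    rfl
  · have hi := S.inside_subset hν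
    exact (analyticAt_source (hS.sinh_sub_η_ne_zero hl hi) (hS.sinh_ne_zero hl hi h)).fun_add
      (hS.analyticAt_fwd hS.goodBox hc hl)

theorem analyticAt_G {l ν : ℂ} (hν : ν ∈ S.inside) (hl : l ∈ S.domain) (h : l ≠ ν) :
    AnalyticAt ℂ (fun l => G l ν) l := by
  have hi := S.inside_subset hν
  refine AnalyticAt.congr ?_ (hS.eventuallyEq_G hG hν hl h).symm
  exact (analyticAt_source (hS.sinh_sub_η_ne_zero hl hi) (hS.sinh_ne_zero hl hi h)).fun_add
    (hS.analyticAt_fwd hS.goodBox (hS.continuous_G_contour hG hν) hl)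

theorem continuous_G_bdry (hB : S.GoodBox r k) {ν : ℂ} (hν : ν ∈ openBox r k) :
    Continuous fun y => G (bdry r k y) ν := by
  refine continuous_comp_bdry (f := fun l => G l ν) hB.r_pos.le hB.k_pos.le fun z hz => ?_
  exact (hS.analyticAt_G hG (hB.openBox_subset hν)
    (hS.closedInside_subset_domain (hB.closedBox_subset hz.1))
    fun e => hz.2 (e ▸ hν)).continuousAt.continuousWithinAt

/-- The integral equation for `G` on a smaller rectangle. -/
theorem G_eq (hB : S.GoodBox r k) {l ν : ℂ} (hν : ν ∈ openBox r k) (hl : l ∈ S.domain)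
    (h : l ≠ ν) :
    G l ν = S.source (-S.α) ν l + S.fwd r k (fun y => G (bdry r k y) ν) l := by
  have hi := hB.openBox_subset hν
  have h1 := (hS.eventuallyEq_G hG hi hl h).self_of_nhds
  dsimp only at h1
  rw [h1, ← hS.integralDm_kernel_G hG hi hl, hS.integralDm_eq_of_box hB,
    hS.fwd_eq hB (hS.continuous_G_bdry hG hB hν) hl]
  · congr 1
    refine integral_congr_ae (Eventually.of_forall fun y => ?_)
    dsimp only
    ring
  · intro z hz
    exact (hS.analyticAt_kernel_sub hz.1 hl).differentiableAt.mul
      (hS.analyticAt_G hG hi (hS.closedInside_subset_domain hz.1)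
        fun e => hz.2 (e ▸ hν)).differentiableAt

/-- Integrals against `G` in terms of the resolvent of the transposed equation. -/
theorem integral_mul_G (hB : S.GoodBox r k) {T : C(Sides, ℂ) →L[ℂ] C(Sides, ℂ)}
    (hT : ∀ s f g : C(Sides, ℂ), (∀ y, g y = f y + S.fwd r k g (bdry r k y)) →
        ∫ y, S.boxWeight r k y * T s y * f y ∂sidesMeasure =
          ∫ y, S.boxWeight r k y * s y * g y ∂sidesMeasure)
    (s : C(Sides, ℂ)) {ν : ℂ} (hν : ν ∈ openBox r k) :
    ∫ y, S.boxWeight r k y * s y * G (bdry r k y) ν ∂sidesMeasure =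
      S.sourceInt r k (T s) (-S.α) ν := by
  have hd := fun y => hS.closedInside_subset_domain (hB.bdry_mem_closedInside y)
  have hi := hB.openBox_subset hν
  have hne : ∀ z ∈ frame r k, z ≠ ν := fun z hz e => hz.2 (e ▸ hν)
  have hc : Continuous fun y => S.source (-S.α) ν (bdry r k y) := by
    refine continuous_comp_bdry hB.r_pos.le hB.k_pos.le fun z hz => ?_
    have hz' := hS.closedInside_subset_domain (hB.closedBox_subset hz.1)
    exact (analyticAt_source (hS.sinh_sub_η_ne_zero hz' (S.inside_subset hi))
      (hS.sinh_ne_zero hz' (S.inside_subset hi) (hne z hz))).continuousAt.continuousWithinAt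
  rw [hS.sourceInt_eq hB (T s).continuous (hS.inside_subset_domain hi) fun h => h.2 hν]
  exact (hT s ⟨_, hc⟩ ⟨_, hS.continuous_G_bdry hG hB hν⟩ fun y =>
    hS.G_eq hG hB hν (hd y) (hne _ (hB.bdry_mem y))).symm

/-- Representation of `G` by the resolvent of the transposed equation. -/
theorem G_eq_sourceInt (hB : S.GoodBox r k) {T : C(Sides, ℂ) →L[ℂ] C(Sides, ℂ)}
    (hT : ∀ s f g : C(Sides, ℂ), (∀ y, g y = f y + S.fwd r k g (bdry r k y)) →
        ∫ y, S.boxWeight r k y * T s y * f y ∂sidesMeasure =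
          ∫ y, S.boxWeight r k y * s y * g y ∂sidesMeasure)
    {l : ℂ} (hl : l ∈ S.domain) {s : C(Sides, ℂ)} (hs : ∀ y, s y = S.kernel (l - bdry r k y))
    {ν : ℂ} (hν : ν ∈ openBox r k) (h : ν ≠ l) :
    G l ν = S.sourceInt r k (T s) (-S.α) ν + 1 * S.source (-S.α) ν l := by
  rw [hS.G_eq hG hB hν hl h.symm, ← hS.integral_mul_G hG hB hT s hν,
    hS.fwd_eq hB (hS.continuous_G_bdry hG hB hν) hl, one_mul, add_comm]
  congr 1
  refine integral_congr_ae (Eventually.of_forall fun y => ?_)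
  dsimp only
  rw [hs]
  ring

variable {Ψ : ℂ → ℂ → ℂ} (hΨ : S.IsPsi G Ψ)

include hΨ

theorem Psi_eq_integral (hB : S.GoodBox r k) {ν₁ ν₂ : ℂ} (h₁ : ν₁ ∈ openBox r k)
    (h₂ : ν₂ ∈ openBox r k) :
    Ψ ν₁ ν₂ = ∫ y, S.boxWeight r k y * (G (bdry r k y) ν₂ * S.source S.α ν₁ (bdry r k y))
      ∂sidesMeasure := by
  have hi₁ := hB.openBox_subset h₁
  have hi₂ := hB.openBox_subset h₂
  rw [hΨ.formula ν₁ hi₁ ν₂ hi₂]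
  refine hS.integralDm_eq_of_box hB (F := fun z => G z ν₂ * S.source S.α ν₁ z) fun z hz => ?_
  have hd := hS.closedInside_subset_domain hz.1
  have hi := S.inside_subset hi₁
  exact (hS.analyticAt_G hG hi₂ hd fun e => hz.2 (e ▸ h₂)).differentiableAt.mul
    (analyticAt_source (hS.sinh_sub_η_ne_zero hd hi)
      (hS.sinh_ne_zero hd hi fun e => hz.2 (e ▸ h₁))).differentiableAt

/-- Representation of `Ψ` by the resolvent of the transposed equation, with the first argument
inside the rectangle. -/
theorem Psi_eq_of_mem (hB : S.GoodBox r k) {T : C(Sides, ℂ) →L[ℂ] C(Sides, ℂ)}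
    (hT : ∀ s f g : C(Sides, ℂ), (∀ y, g y = f y + S.fwd r k g (bdry r k y)) →
        ∫ y, S.boxWeight r k y * T s y * f y ∂sidesMeasure =
          ∫ y, S.boxWeight r k y * s y * g y ∂sidesMeasure)
    {ν₁ : ℂ} (h₁ : ν₁ ∈ openBox r k) {s : C(Sides, ℂ)}
    (hs : ∀ y, s y = S.source S.α ν₁ (bdry r k y)) {ν₂ : ℂ} (h₂ : ν₂ ∈ openBox r k) :
    Ψ ν₁ ν₂ = S.sourceInt r k (T s) (-S.α) ν₂ := by
  rw [hS.Psi_eq_integral hG hΨ hB h₁ h₂, ← hS.integral_mul_G hG hB hT s h₂]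
  refine integral_congr_ae (Eventually.of_forall fun y => ?_)
  dsimp only
  rw [hs]
  ring

/-- Continuing ν₁ out of the contour leaves a residue: the integrand G(·, ν₂) has the pole of `cth`
at ν₁, which contributes -G(ν₁, ν₂) τ(ν₁). Two rectangles are used so that ν₂ stays inside the
smaller one. -/
theorem Psi_eq_sub (hB : S.GoodBox r k) (hB' : S.GoodBox r' k') (hr : r' < r)
    (hk : k' < k) {ν₁ ν₂ : ℂ} (h₁ : ν₁ ∈ S.domain) (h₁' : ν₁ ∉ closedBox r k)
    (h : S.Λ₀ ν₁ ≠ 0) (h₂ : ν₂ ∈ openBox r' k') :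
    Ψ ν₁ ν₂ = S.sourceInt r' k' (fun y => G (bdry r' k' y) ν₂) S.α ν₁ - G ν₁ ν₂ * S.tau ν₁ := by
  have hsub := closedBox_subset_openBox hr hk
  have h₂' : ν₂ ∈ openBox r k := hsub (openBox_subset_closedBox _ _ h₂)
  have hi₂ := hB.openBox_subset h₂'
  have hY : ∀ z ∈ closedBox r k \ openBox r' k', AnalyticAt ℂ (fun l => G l ν₂) z := fun z hz =>
    hS.analyticAt_G hG hi₂ (hS.closedInside_subset_domain (hB.closedBox_subset hz.1))
      fun e => hz.2 (e ▸ h₂)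
  have hc := hS.continuous_G_bdry hG hB h₂'
  have key := hS.continuation hB hB' hr hk hY
    (fun z hz => (hG.continuation_left ν₂ hi₂ hz).meromorphicAt)
    -- There is no additional explicit term here: t = 0, so c' and x are arbitrary.
    (hΨ.continuation_left ν₂ hi₂) (c := S.α) (c' := 0) (t := 0) (x := 0)
    (fun ν hν _ => by
      rw [zero_mul, add_zero, hS.Psi_eq_integral hG hΨ hB hν h₂', hS.sourceInt_eq hB hc
        (hS.inside_subset_domain (hB.openBox_subset hν)) fun h => h.2 hν]
      refine integral_congr_ae (Eventually.of_forall fun y => ?_)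
      dsimp only
      ring) h₁ h₁' h
    (hS.analyticAt_G hG hi₂ h₁ fun e => h₁' (openBox_subset_closedBox _ _ (e ▸ h₂')))
    (Or.inl rfl)
  rw [key, zero_mul, add_zero, sourceInt, sourceInt,
    hS.boxTransform_add_nested hB hB' hr.le hk.le hY h₁,
    hS.boxTransform_nested hB hB' hr.le hk.le hY fun z hz =>
      hS.sinh_ne_zero h₁ (hB.closedBox_subset hz.1) fun e => h₁' (e ▸ hz.1)]

/-- Representation of `Ψ` by the resolvent of the transposed equation, with the first argument
outside the rectangle. -/
theorem Psi_eq_of_notMem (hB : S.GoodBox r k) (hB' : S.GoodBox r' k') (hr : r' < r)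
    (hk : k' < k) {T : C(Sides, ℂ) →L[ℂ] C(Sides, ℂ)}
    (hT : ∀ s f g : C(Sides, ℂ), (∀ y, g y = f y + S.fwd r' k' g (bdry r' k' y)) →
        ∫ y, S.boxWeight r' k' y * T s y * f y ∂sidesMeasure =
          ∫ y, S.boxWeight r' k' y * s y * g y ∂sidesMeasure)
    {ν₁ ν₂ : ℂ} (h₁ : ν₁ ∈ S.domain) (h₁' : ν₁ ∉ closedBox r k)
    (h : S.Λ₀ ν₁ ≠ 0) {s : C(Sides, ℂ)}
    (hs : ∀ y, s y = S.source S.α ν₁ (bdry r' k' y) +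
      -S.tau ν₁ * S.kernel (ν₁ - bdry r' k' y))
    (h₂ : ν₂ ∈ openBox r' k') :
    Ψ ν₁ ν₂ = S.sourceInt r' k' (T s) (-S.α) ν₂ + -S.tau ν₁ * S.source (-S.α) ν₂ ν₁ := by
  have hc := hS.continuous_G_bdry hG hB' h₂
  have hcl : ν₁ ∉ closedBox r' k' := fun e =>
    h₁' (openBox_subset_closedBox _ _ (closedBox_subset_openBox hr hk e))
  rw [hS.Psi_eq_sub hG hΨ hB hB' hr hk h₁ h₁' h h₂, hS.G_eq hG hB' h₂ h₁
    -- The residue term contains G(ν₁, ν₂), to which the integral equation is applied once more. Its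
    -- kernel is absorbed into the source s, and its inhomogeneity becomes the separate last term.
    fun e => hcl (openBox_subset_closedBox _ _ (e ▸ h₂)), hS.fwd_eq hB' hc h₁,
    hS.sourceInt_eq hB' hc h₁ fun e => hcl e.1, ← hS.integral_mul_G hG hB' hT s h₂]
  have hw := hS.continuous_boxWeight hB'
  have hk : Continuous fun y => S.kernel (ν₁ - bdry r' k' y) :=
    continuous_comp_bdry (f := fun z => S.kernel (ν₁ - z)) hB'.r_pos.le hB'.k_pos.le fun z hz =>
      (hS.analyticAt_kernel_sub (hB'.closedBox_subset hz.1) h₁).continuousAt.continuousWithinAt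
  have hf : Continuous fun y => S.source S.α ν₁ (bdry r' k' y) := by
    have : (fun y => S.source S.α ν₁ (bdry r' k' y)) = fun y =>
        s y - -S.tau ν₁ * S.kernel (ν₁ - bdry r' k' y) := by
      ext y
      rw [hs]
      ring
    rw [this]
    exact s.continuous.sub (continuous_const.mul hk)
  have hsplit : (fun y => S.boxWeight r' k' y * s y * G (bdry r' k' y) ν₂) = fun y =>
      S.boxWeight r' k' y * G (bdry r' k' y) ν₂ * S.source S.α ν₁ (bdry r' k' y) +
        -S.tau ν₁ * (S.boxWeight r' k' y * G (bdry r' k' y) ν₂ *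
          S.kernel (ν₁ - bdry r' k' y)) := by
    ext y
    rw [hs]
    ring
  have h1 : Continuous fun y => S.boxWeight r' k' y * G (bdry r' k' y) ν₂ *
    S.source S.α ν₁ (bdry r' k' y) := (hw.mul hc).mul hf
  have h2 : Continuous fun y => -S.tau ν₁ * (S.boxWeight r' k' y * G (bdry r' k' y) ν₂ *
    S.kernel (ν₁ - bdry r' k' y)) := continuous_const.mul ((hw.mul hc).mul hk)
  rw [hsplit, integral_add (integrable_of_continuous _ h1) (integrable_of_continuous _ h2),
    integral_const_mul]
  ring

end G

end Admissible

end Data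

end SixVertex

/-! ### Limits of the resolvent representations -/

namespace SixVertex

open MeasureTheory Complex

/-- A function on the boundary as a continuous function, `0` if it is not continuous. -/
noncomputable def toCont (f : Sides → ℂ) : C(Sides, ℂ) :=
  open scoped Classical in if h : Continuous f then ⟨f, h⟩ else 0

theorem toCont_apply {f : Sides → ℂ} (hf : Continuous f) (y : Sides) : toCont f y = f y := by
  rw [toCont, dif_pos hf]
  rfl

theorem continuous_cth_of_re {r k : ℝ} (hr : 0 ≤ r) (hk : 0 ≤ k) {z : ℂ} (hz : r < z.re) :
    Continuous fun y => cth (z - bdry r k y) :=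
  Data.continuous_cth_bdry fun y => sinh_ne_zero_of_re (by
    have := (abs_le.1 (bdry_mem hr hk y).1.1).2
    rw [sub_re]
    exact ne_of_gt (by linarith))

theorem tendsto_toCont_cth {r k : ℝ} (hr : 0 ≤ r) (hk : 0 ≤ k) (x : ℂ) :
    Tendsto (fun l => toCont fun y => cth (l + x - bdry r k y)) (comap re atTop)
      (𝓝 (ContinuousMap.const Sides 1)) := by
  obtain ⟨B, hB⟩ := isCompact_univ.exists_bound_of_continuousOn
    (f := fun y => bdry r k y - x) (by have := continuous_bdry r k; fun_prop)
  have h := tendstoUniformly_cth (b := fun y => bdry r k y - x) (fun y => hB y trivial)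
  rw [ContinuousMap.tendsto_iff_tendstoUniformly]
  intro u hu
  filter_upwards [h u hu, Data.eventually_gt_re (r - x.re)] with l hlu hl y
  rw [toCont_apply]
  · have := hlu y
    rw [sub_sub_eq_add_sub] at this
    exact this
  · refine continuous_cth_of_re hr hk ?_
    rw [add_re]
    linarith

namespace Data

variable {S : Data} {r k r' k' : ℝ}

theorem tendsto_source_left (S : Data) (c ν : ℂ) :
    Tendsto (S.source c ν) (comap re atTop) (𝓝 (S.qpow c - S.rho ν)) := by
  have h1 := (tendsto_cth_sub (ν + S.η)).const_mul (S.qpow c)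
  have h2 := (tendsto_cth_sub ν).const_mul (S.rho ν)
  have := h1.sub h2
  simp only [mul_one, ← sub_sub] at this
  exact this

theorem tendsto_kernel_sub (S : Data) (m : ℂ) :
    Tendsto (fun z => S.kernel (m - z)) (comap re atTop)
      (𝓝 (S.qpow S.α - S.qpow (-S.α))) := by
  have h1 := (tendsto_sub_cth (m - S.η)).const_mul (S.qpow (-S.α))
  have h2 := (tendsto_sub_cth (m + S.η)).const_mul (S.qpow S.α)
  have h := h1.sub h2
  simp only [sub_right_comm m S.η, add_sub_right_comm m S.η] at h
  rw [show S.qpow S.α - S.qpow (-S.α) = S.qpow (-S.α) * -1 - S.qpow S.α * -1 by ring]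
  exact h

theorem tendsto_kernel_sub_left (S : Data) (ν : ℂ) :
    Tendsto (fun l => S.kernel (l - ν)) (comap re atTop)
      (𝓝 (S.qpow (-S.α) - S.qpow S.α)) := by
  have h1 := (tendsto_cth_sub (ν + S.η)).const_mul (S.qpow (-S.α))
  have h2 := (tendsto_cth_sub (ν - S.η)).const_mul (S.qpow S.α)
  have h := h1.sub h2
  simp only [mul_one, ← sub_sub, sub_sub_eq_add_sub] at h
  simpa only [kernel, sub_add_eq_add_sub] using h

namespace Admissible

variable (hS : S.Admissible)

include hS

theorem tendsto_source_right (c x : ℂ) :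
    Tendsto (fun ν => S.source c ν x) (comap re atTop)
      (𝓝 (-S.qpow c + (S.qpow (-S.α) - (S.qpow (-S.α) - S.qpow S.α) /
        (1 + S.qpow (-2 * S.κ))))) := by
  have h1 := (tendsto_sub_cth (x - S.η)).const_mul (S.qpow c)
  have h2 := hS.tendsto_rho.mul (tendsto_sub_cth x)
  have h := h1.sub h2
  simp only [sub_right_comm x S.η] at h
  rw [show ∀ u v : ℂ, -u + v = u * -1 - v * -1 by intros; ring]
  exact h

/-- Continuation of the representation by the resolvent to the outside of the rectangle. -/
theorem eq_of_resolvent (hB : S.GoodBox r k) (hB' : S.GoodBox r' k') (hr : r' < r) (hk : k' < k)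
    {T : C(Sides, ℂ) →L[ℂ] C(Sides, ℂ)}
    (hT : ∀ s u : C(Sides, ℂ), (∀ y, u y = s y + S.bwd r k u (bdry r k y)) ↔ u = T s)
    {s : ℂ → ℂ} (hs : ∀ z ∈ closedBox r k \ openBox r' k', AnalyticAt ℂ s z)
    (hsm : ∀ z ∈ S.domain, MeromorphicAt s z) {σ : C(Sides, ℂ)}
    (hσ : ∀ y, σ y = s (bdry r k y)) {H : ℂ → ℂ} (hH : MeromorphicNFOn H S.domain) {t x : ℂ}
    (h : ∀ ν ∈ openBox r k, ν ≠ x →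
      H ν = S.sourceInt r k (T σ) (-S.α) ν + t * S.source (-S.α) ν x)
    {ν : ℂ} (hν : ν ∈ S.domain) (hν' : ν ∉ closedBox r k) (hΛ : S.Λ₀ ν ≠ 0)
    (hsν : AnalyticAt ℂ s ν) (ht : t = 0 ∨ (sinh (x - ν - S.η) ≠ 0 ∧ sinh (x - ν) ≠ 0)) :
    H ν = S.sourceInt r k (T σ) (-S.α) ν - (s ν + S.bwd r k (T σ) ν) * S.tau ν +
      t * S.source (-S.α) ν x := by
  -- The right side of the transposed equation extends T σ off the boundary; this extension is what
  -- the residue evaluates at ν.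
  have hY : (fun y => s (bdry r k y) + S.bwd r k (T σ) (bdry r k y)) = T σ := by
    ext y
    rw [(hT σ _).2 rfl y, hσ]
  have hb : ∀ z ∈ S.domain, AnalyticAt ℂ (S.bwd r k (T σ)) z := fun z hz =>
    hS.analyticAt_bwd hB (T σ).continuous hz
  have key := hS.continuation hB hB' hr hk (Y := fun z => s z + S.bwd r k (T σ) z)
    (fun z hz => (hs z hz).fun_add (hb z (hS.closedInside_subset_domain
      (hB.closedBox_subset hz.1))))
    (fun z hz => (hsm z hz).fun_add (hb z hz).meromorphicAt) hH (c := -S.α) (c' := -S.α) (t := t)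
    (x := x) (fun ν hν hνx => by rw [hY]; exact h ν hν hνx) hν hν' hΛ (hsν.fun_add (hb ν hν)) ht
  rwa [hY] at key

/-- The limit with respect to the argument in which the resolvent representation is continued. -/
theorem tendsto_of_resolvent (hB : S.GoodBox r k) (hB' : S.GoodBox r' k') (hr : r' < r)
    (hk : k' < k) {T : C(Sides, ℂ) →L[ℂ] C(Sides, ℂ)}
    (hT : ∀ s u : C(Sides, ℂ), (∀ y, u y = s y + S.bwd r k u (bdry r k y)) ↔ u = T s)
    {s : ℂ → ℂ} (hs : ∀ z ∈ closedBox r k \ openBox r' k', AnalyticAt ℂ s z)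
    (hsm : ∀ z ∈ S.domain, MeromorphicAt s z) {H : ℂ → ℂ} (hH : MeromorphicNFOn H S.domain)
    {t x : ℂ} (h : ∀ σ : C(Sides, ℂ), (∀ y, σ y = s (bdry r k y)) → ∀ ν ∈ openBox r k, ν ≠ x →
      H ν = S.sourceInt r k (T σ) (-S.α) ν + t * S.source (-S.α) ν x)
    (hsa : ∀ᶠ z in comap re atTop, AnalyticAt ℂ s z) {L : ℂ}
    (hsL : Tendsto s (comap re atTop) (𝓝 L)) :
    Tendsto H (comap re atTop) (𝓝 ((t * (S.qpow S.α - S.qpow (-S.α)) - L) /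
      (1 + S.qpow (-2 * S.κ)))) := by
  have hc : Continuous fun y => s (bdry r k y) :=
    continuous_comp_bdry hB.r_pos.le hB.k_pos.le fun z hz =>
      (hs z ⟨hz.1, fun e => hz.2 (closedBox_subset_openBox hr hk
        (openBox_subset_closedBox _ _ e))⟩).continuousAt.continuousWithinAt
  let σ : C(Sides, ℂ) := ⟨_, hc⟩
  have hg := (T σ).continuous
  have hlim := ((((hS.tendsto_rho.mul (hS.tendsto_boxTransform hB hg)).sub
    ((hS.tendsto_boxTransform_add hB hg S.η).const_mul (S.qpow (-S.α)))).sub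
    ((hsL.add (hS.tendsto_bwd hB hg)).mul hS.tendsto_tau)).add
    ((hS.tendsto_source_right (-S.α) x).const_mul t))
  have hev : ∀ᶠ ν in comap re atTop, S.sourceInt r k (T σ) (-S.α) ν -
      (s ν + S.bwd r k (T σ) ν) * S.tau ν + t * S.source (-S.α) ν x = H ν := by
    filter_upwards [S.eventually_domain, hS.eventually_Λ₀_ne_zero, hsa, eventually_gt_re r,
      eventually_gt_re x.re] with ν h1 h2 h3 h4 h5
    refine (hS.eq_of_resolvent hB hB' hr hk hT hs hsm (fun y => rfl) hH (h σ fun y => rfl) h1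
      (fun e => ?_) h2 h3 (Or.inr ⟨?_, ?_⟩)).symm
    · exact absurd ((le_abs_self _).trans e.1) (not_le.2 h4)
    · refine sinh_ne_zero_of_re ?_
      rw [sub_re, sub_re, η_re, sub_zero]
      exact ne_of_lt (by linarith)
    · refine sinh_ne_zero_of_re ?_
      rw [sub_re]
      exact ne_of_lt (by linarith)
  -- In the limit the unknown ∫ dm T σ is multiplied by ρ(∞) - q^(-α) - (q^α - q^(-α)) τ(∞), which
  -- is zero. Only L, t and τ(∞) remain.
  convert hlim.congr' hev using 2
  have := hS.one_add_qpow_neg_ne_zero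
  field_simp
  ring

theorem tendsto_boxTransform_of_tendsto (hB : S.GoodBox r k) {ι : Type*} {F : Filter ι}
    {g : ι → C(Sides, ℂ)} {g₀ : C(Sides, ℂ)} (hg : Tendsto g F (𝓝 g₀)) {z : ℂ}
    (hz : ∀ y, sinh (z - bdry r k y) ≠ 0) :
    Tendsto (fun i => S.boxTransform r k (g i) z) F (𝓝 (S.boxTransform r k g₀ z)) := by
  let w : C(Sides, ℂ) := ⟨fun y => S.boxWeight r k y * cth (z - bdry r k y),
    (hS.continuous_boxWeight hB).mul (continuous_cth_bdry hz)⟩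
  have hw : ∀ g : C(Sides, ℂ), pairing sidesMeasure w g = S.boxTransform r k g z := fun g => by
    rw [pairing_apply, boxTransform, cthTransform]
    refine integral_congr_ae (Eventually.of_forall fun y => ?_)
    change S.boxWeight r k y * cth (z - bdry r k y) * g y = _
    dsimp only
    ring
  simpa only [Function.comp_def, hw] using ((pairing sidesMeasure w).continuous.tendsto g₀).comp hg

theorem tendsto_sourceInt_of_tendsto (hB : S.GoodBox r k) {ι : Type*} {F : Filter ι}
    {g : ι → C(Sides, ℂ)} {g₀ : C(Sides, ℂ)} (hg : Tendsto g F (𝓝 g₀)) {c ν : ℂ}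
    (hν : ν ∈ S.domain) (hν' : ν ∉ frame r k) :
    Tendsto (fun i => S.sourceInt r k (g i) c ν) F (𝓝 (S.sourceInt r k g₀ c ν)) :=
  ((hS.tendsto_boxTransform_of_tendsto hB hg (hS.sinh_bdry hB hν hν')).const_mul _).sub
    ((hS.tendsto_boxTransform_of_tendsto hB hg (hS.sinh_bdry_add hB hν)).const_mul _)

theorem tendsto_bwd_of_tendsto (hB : S.GoodBox r k) {ι : Type*} {F : Filter ι}
    {g : ι → C(Sides, ℂ)} {g₀ : C(Sides, ℂ)} (hg : Tendsto g F (𝓝 g₀)) {ν : ℂ}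
    (hν : ν ∈ S.domain) :
    Tendsto (fun i => S.bwd r k (g i) ν) F (𝓝 (S.bwd r k g₀ ν)) :=
  ((hS.tendsto_boxTransform_of_tendsto hB hg (hS.sinh_bdry_sub hB hν)).const_mul _).sub
    ((hS.tendsto_boxTransform_of_tendsto hB hg (hS.sinh_bdry_add hB hν)).const_mul _)

/-- The limit of the resolvent representation with the second argument inside the rectangle, if
the source tends to a constant. -/
theorem tendsto_sourceInt_resolvent (hB : S.GoodBox r k) {T : C(Sides, ℂ) →L[ℂ] C(Sides, ℂ)}
    (hT : ∀ s u : C(Sides, ℂ), (∀ y, u y = s y + S.bwd r k u (bdry r k y)) ↔ u = T s)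
    {σ : ℂ → C(Sides, ℂ)} {m : ℂ} (hσ : Tendsto σ (comap re atTop)
      (𝓝 (m • ContinuousMap.const Sides (S.qpow (-S.α) - S.qpow S.α)))) {ν : ℂ}
    (hν : ν ∈ openBox r k) :
    Tendsto (fun l => S.sourceInt r k (T (σ l)) (-S.α) ν) (comap re atTop)
      (𝓝 (m * (S.rho ν - S.qpow (-S.α)))) := by
  have hTσ : Tendsto (fun l => T (σ l)) (comap re atTop) _ := (T.continuous.tendsto _).comp hσ
  rw [map_smul] at hTσ
  have h1 := hS.tendsto_sourceInt_of_tendsto hB hTσ (c := -S.α)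
    (hS.inside_subset_domain (hB.openBox_subset hν)) (fun h => h.2 hν)
  rw [← (hS.constSource hB hT).1 ν hν]
  convert h1 using 2
  exact (S.sourceInt_const_mul r k m _ _ ν).symm

/-- Here ν is fixed outside the rectangle, so the residue term has to be carried along. The
resolvent is continuous, and for the limiting constant source the outside half of `constSource`
gives the value. -/
theorem tendsto_sourceInt_resolvent_sub (hB : S.GoodBox r k)
    {T : C(Sides, ℂ) →L[ℂ] C(Sides, ℂ)}
    (hT : ∀ s u : C(Sides, ℂ), (∀ y, u y = s y + S.bwd r k u (bdry r k y)) ↔ u = T s)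
    {σ : ℂ → C(Sides, ℂ)} {m : ℂ} (hσ : Tendsto σ (comap re atTop)
      (𝓝 (m • ContinuousMap.const Sides (S.qpow (-S.α) - S.qpow S.α)))) {ν : ℂ}
    (hν : ν ∈ S.domain) (hν' : ν ∉ closedBox r k) (hΛ : S.Λ₀ ν ≠ 0) {s : ℂ → ℂ}
    (hs : Tendsto s (comap re atTop) (𝓝 (m * (S.qpow (-S.α) - S.qpow S.α)))) :
    Tendsto (fun l => S.sourceInt r k (T (σ l)) (-S.α) ν -
      (s l + S.bwd r k (T (σ l)) ν) * S.tau ν) (comap re atTop)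
      (𝓝 (m * (S.rho ν - S.qpow (-S.α)))) := by
  have hTσ : Tendsto (fun l => T (σ l)) (comap re atTop) _ := (T.continuous.tendsto _).comp hσ
  rw [map_smul] at hTσ
  have h1 := hS.tendsto_sourceInt_of_tendsto hB hTσ (c := -S.α) hν (fun h => hν' h.1)
  have h2 := hS.tendsto_bwd_of_tendsto hB hTσ hν
  rw [← (hS.constSource hB hT).2 ν hν hν' hΛ]
  convert h1.sub ((hs.add h2).mul_const (S.tau ν)) using 2
  have e1 : S.sourceInt r k
      (m • T (ContinuousMap.const Sides (S.qpow (-S.α) - S.qpow S.α))) (-S.α) ν = m * _ :=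
    S.sourceInt_const_mul r k m _ _ ν
  have e2 : S.bwd r k
      (m • T (ContinuousMap.const Sides (S.qpow (-S.α) - S.qpow S.α))) ν = m * _ :=
    S.bwd_const_mul r k m _ ν
  rw [ContinuousMap.coe_smul, e1, e2]
  ring

end Admissible

end Data

end SixVertex

/-! ### The four limits -/

namespace SixVertex

open MeasureTheory Complex

namespace Data

variable {S : Data} {r k r' k' : ℝ}

theorem analyticAt_kernel_of_re {l z : ℂ} (h : l.re ≠ z.re) :
    AnalyticAt ℂ (fun z => S.kernel (l - z)) z := by
  have hre : ∀ w : ℂ, w.re = 0 → sinh (l - z + w) ≠ 0 := fun w hw => sinh_ne_zero_of_re (by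
    rw [add_re, sub_re, hw, add_zero]
    exact sub_ne_zero.2 h)
  unfold kernel
  refine (analyticAt_const.mul ?_).sub (analyticAt_const.mul ?_)
  · refine (analyticAt_cth ?_).fun_comp (f := fun z => l - z - S.η) (by fun_prop)
    rw [sub_eq_add_neg]
    exact hre _ (by simp)
  · exact (analyticAt_cth (hre _ S.η_re)).fun_comp (f := fun z => l - z + S.η) (by fun_prop)

theorem sinh_source_ne_zero_of_re {l z : ℂ} (h : l.re ≠ z.re) :
    sinh (l - z - S.η) ≠ 0 ∧ sinh (l - z) ≠ 0 := by
  refine ⟨sinh_ne_zero_of_re ?_, sinh_ne_zero_of_re ?_⟩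
  · rw [sub_re, sub_re, η_re, sub_zero]
    exact sub_ne_zero.2 h
  · rw [sub_re]
    exact sub_ne_zero.2 h

theorem analyticAt_source_of_re {c ν z : ℂ} (h : z.re ≠ ν.re) :
    AnalyticAt ℂ (S.source c ν) z :=
  analyticAt_source (sinh_source_ne_zero_of_re (S := S) h).1 (sinh_source_ne_zero_of_re (S := S) h).2

/-- The kernel `K_α (l - ·)` as a continuous function on the boundary. -/
noncomputable def kernelCont (S : Data) (r k : ℝ) (l : ℂ) : C(Sides, ℂ) :=
  S.qpow (-S.α) • (toCont fun y => cth (l + -S.η - bdry r k y)) -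
    S.qpow S.α • toCont fun y => cth (l + S.η - bdry r k y)

/-- The source of the resolvent representation of `Ψ` as a continuous function. -/
noncomputable def sourceCont (S : Data) (r k : ℝ) (l : ℂ) : C(Sides, ℂ) :=
  S.rho l • (toCont fun y => cth (l + 0 - bdry r k y)) -
    S.qpow S.α • (toCont fun y => cth (l + S.η - bdry r k y)) + -S.tau l • S.kernelCont r k l

theorem kernelCont_apply (hr : 0 ≤ r) (hk : 0 ≤ k) {l : ℂ} (hl : r < l.re) (y : Sides) :
    S.kernelCont r k l y = S.kernel (l - bdry r k y) := by
  rw [kernelCont, ContinuousMap.sub_apply, ContinuousMap.smul_apply, ContinuousMap.smul_apply,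
    toCont_apply (continuous_cth_of_re hr hk (by simpa using hl)),
    toCont_apply (continuous_cth_of_re hr hk (by simpa using hl)), kernel, smul_eq_mul,
    smul_eq_mul, add_sub_right_comm, add_sub_right_comm, ← sub_eq_add_neg]

theorem sourceCont_apply (hr : 0 ≤ r) (hk : 0 ≤ k) {l : ℂ} (hl : r < l.re) (y : Sides) :
    S.sourceCont r k l y = S.source S.α l (bdry r k y) +
      -S.tau l * S.kernel (l - bdry r k y) := by
  rw [sourceCont, ContinuousMap.add_apply, ContinuousMap.sub_apply, ContinuousMap.smul_apply,
    ContinuousMap.smul_apply, ContinuousMap.smul_apply, kernelCont_apply hr hk hl,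
    toCont_apply (continuous_cth_of_re hr hk (by simpa using hl)),
    toCont_apply (continuous_cth_of_re hr hk (by simpa using hl)), source, smul_eq_mul,
    smul_eq_mul, smul_eq_mul, show bdry r k y - l - S.η = -(l + S.η - bdry r k y) by ring,
    show bdry r k y - l = -(l + 0 - bdry r k y) by ring, cth_neg, cth_neg]
  ring

theorem tendsto_kernelCont (hr : 0 ≤ r) (hk : 0 ≤ k) :
    Tendsto (S.kernelCont r k) (comap re atTop)
      (𝓝 (ContinuousMap.const Sides (S.qpow (-S.α) - S.qpow S.α))) := by
  have h := ((tendsto_toCont_cth hr hk (-S.η)).const_smul (S.qpow (-S.α))).sub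
    ((tendsto_toCont_cth hr hk S.η).const_smul (S.qpow S.α))
  have e : ContinuousMap.const Sides (S.qpow (-S.α) - S.qpow S.α) =
      S.qpow (-S.α) • ContinuousMap.const Sides 1 - S.qpow S.α • ContinuousMap.const Sides 1 := by
    ext y
    simp
  rw [e]
  exact h

theorem meromorphicAt_sum_source (S : Data) (c d ν₁ z : ℂ) :
    MeromorphicAt (fun z => S.source c ν₁ z + d * S.kernel (ν₁ - z)) z :=
  (meromorphicAt_source S _ _ _).fun_add
    ((MeromorphicAt.const _ _).fun_mul (meromorphicAt_kernel S _ _))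

namespace Admissible

variable (hS : S.Admissible)

include hS

/-- The part of the source from Ψ and the part from the residue each contribute -τ(∞) times q^(-α) -
q^α, the former through the limit of ρ; this is the origin of the 2. -/
theorem tendsto_sourceCont (hr : 0 ≤ r) (hk : 0 ≤ k) :
    Tendsto (S.sourceCont r k) (comap re atTop)
      (𝓝 ((1 - 2 / (1 + S.qpow (-2 * S.κ))) •
        ContinuousMap.const Sides (S.qpow (-S.α) - S.qpow S.α))) := by
  have h := ((hS.tendsto_rho.smul (tendsto_toCont_cth hr hk 0)).sub
    ((tendsto_toCont_cth hr hk S.η).const_smul (S.qpow S.α))).add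
    (hS.tendsto_tau.neg.smul (tendsto_kernelCont (S := S) hr hk))
  refine Eq.subst (motive := fun g => Tendsto (S.sourceCont r k) _ (𝓝 g)) ?_ h
  ext y
  simp
  ring

theorem zero_mem_inside : (0 : ℂ) ∈ S.inside :=
  ⟨by simpa using hS.R_pos, by simpa using hS.h_pos⟩

variable {G : ℂ → ℂ → ℂ} (hG : S.IsG G)

include hG

/-- The source K_α(l - ·) tends to q^α - q^(-α), and the explicit inhomogeneity contributes exactly
the opposite amount. -/
theorem tendsto_G_right {l : ℂ} (hl : l ∈ S.domain) :
    Tendsto (fun ν => G l ν) (comap re atTop) (𝓝 0) := by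
  have hB := hS.goodBox
  obtain ⟨r', k', hr, hk, hB', -⟩ := hB.exists_lt hS.zero_mem_inside
  -- The homogeneous equation does not involve ν, so uniqueness at the single point 0 yields the
  -- resolvent for all second arguments.
  obtain ⟨T, hT, hT'⟩ := hS.exists_box_resolvent hB (hG.solution 0 hS.zero_mem_inside)
  have h := hS.tendsto_of_resolvent hB hB' hr hk hT (s := fun z => S.kernel (l - z))
    (fun z hz => hS.analyticAt_kernel_sub hz.1 hl) (fun z _ => meromorphicAt_kernel S l z)
    (hG.continuation_right l hl) (t := 1) (x := l)
    (fun σ hσ ν hν h => hS.G_eq_sourceInt hG hB hT' hl hσ hν h)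
    ((eventually_gt_re l.re).mono fun z hz => analyticAt_kernel_of_re hz.ne)
    (S.tendsto_kernel_sub l)
  simpa using h

/-- The source K_α(l - ·) tends to the constant of `constSource`, so the integral tends to ρ(ν) -
q^(-α), which cancels the limit of the inhomogeneity. -/
theorem tendsto_G_left {ν : ℂ} (hν : ν ∈ S.domain) (hΛ : S.Λ₀ ν ≠ 0) :
    Tendsto (fun l => G l ν) (comap re atTop) (𝓝 0) := by
  have h2 := (S.tendsto_source_left (-S.α) ν).const_mul 1
  have hlim : (1 : ℂ) * (S.rho ν - S.qpow (-S.α)) + 1 * (S.qpow (-S.α) - S.rho ν) = 0 := by ring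
  by_cases hi : ν ∈ S.inside
  · have hB := hS.goodBox
    obtain ⟨T, hT, hT'⟩ := hS.exists_box_resolvent hB (hG.solution 0 hS.zero_mem_inside)
    have hσ := tendsto_kernelCont (S := S) hB.r_pos.le hB.k_pos.le
    rw [← one_smul ℂ (ContinuousMap.const Sides (S.qpow (-S.α) - S.qpow S.α))] at hσ
    have h1 := (hS.tendsto_sourceInt_resolvent hB hT hσ hi).add h2
    rw [hlim] at h1
    refine h1.congr' ?_
    filter_upwards [S.eventually_domain, eventually_gt_re S.R, eventually_gt_re ν.re]
      with l hl hlR hlν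
    exact (hS.G_eq_sourceInt hG hB hT' hl (kernelCont_apply hB.r_pos.le hB.k_pos.le hlR) hi
      fun e => hlν.ne (congrArg re e)).symm
  -- A point ν that is not inside may lie on C; shrinking the rectangle puts it strictly outside,
  -- and a further rectangle supplies the annulus for the continuation.
  · obtain ⟨r, k, hr, hk, hB, h0⟩ := hS.goodBox.exists_lt hS.zero_mem_inside
    obtain ⟨r', k', hr', hk', hB', -⟩ := hB.exists_lt h0
    have hν' : ν ∉ closedBox r k := fun h => hi (closedBox_subset_openBox hr hk h)
    obtain ⟨T, hT, hT'⟩ := hS.exists_box_resolvent hB (hG.solution 0 hS.zero_mem_inside)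
    have hσ := tendsto_kernelCont (S := S) hB.r_pos.le hB.k_pos.le
    have hs := S.tendsto_kernel_sub_left ν
    rw [← one_smul ℂ (ContinuousMap.const Sides (S.qpow (-S.α) - S.qpow S.α))] at hσ
    rw [← one_mul (S.qpow (-S.α) - S.qpow S.α)] at hs
    have h1 := (hS.tendsto_sourceInt_resolvent_sub hB hT hσ hν hν' hΛ hs).add h2
    rw [hlim] at h1
    refine h1.congr' ?_
    filter_upwards [S.eventually_domain, eventually_gt_re r, eventually_gt_re ν.re]
      with l hl hlr hlν
    have hσl := kernelCont_apply (S := S) hB.r_pos.le hB.k_pos.le hlr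
    exact (hS.eq_of_resolvent hB hB' hr' hk' hT (s := fun z => S.kernel (l - z))
      (fun z hz => hS.analyticAt_kernel_sub (hB.closedBox_subset hz.1) hl)
      (fun z _ => meromorphicAt_kernel S l z) hσl (hG.continuation_right l hl) (t := 1) (x := l)
      (fun ν hν h => hS.G_eq_sourceInt hG hB hT' hl hσl hν h) hν hν' hΛ
      (analyticAt_kernel_of_re hlν.ne') (Or.inr (sinh_source_ne_zero_of_re hlν.ne'))).symm

variable {Ψ : ℂ → ℂ → ℂ} (hΨ : S.IsPsi G Ψ)

include hΨ

theorem tendsto_Psi_right {ν₁ : ℂ} (hν : ν₁ ∈ S.domain) (hΛ : S.Λ₀ ν₁ ≠ 0) :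
    Tendsto (fun ν₂ => Ψ ν₁ ν₂) (comap re atTop)
      (𝓝 (-((S.qpow S.α - S.rho ν₁) / (1 + S.qpow (-2 * S.κ))))) := by
  have hev := eventually_gt_re ν₁.re
  by_cases hi : ν₁ ∈ S.inside
  · have hB := hS.goodBox
    obtain ⟨r', k', hr, hk, hB', hm⟩ := hB.exists_lt hi
    obtain ⟨T, hT, hT'⟩ := hS.exists_box_resolvent hB (hG.solution 0 hS.zero_mem_inside)
    have h := hS.tendsto_of_resolvent hB hB' hr hk hT (s := S.source S.α ν₁)
      (fun z hz => by
        have hz' := hS.closedInside_subset_domain hz.1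
        have hi' := S.inside_subset hi
        exact analyticAt_source (hS.sinh_sub_η_ne_zero hz' hi')
          (hS.sinh_ne_zero hz' hi' fun e => hz.2 (e ▸ hm)))
      (fun z _ => meromorphicAt_source S _ _ z)
      (hΨ.continuation_right ν₁ hν hΛ) (t := 0) (x := 0)
      (fun σ hσ ν hν _ => by
        rw [hS.Psi_eq_of_mem hG hΨ hB hT' hi hσ hν, zero_mul, add_zero])
      (hev.mono fun z hz => analyticAt_source_of_re hz.ne') (S.tendsto_source_left S.α ν₁)
    rwa [zero_mul, zero_sub, neg_div] at h
  -- Three rectangles: the largest excludes ν₁, the middle one carries the resolvent, and the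
  -- smallest serves the continuation in ν₂.
  · obtain ⟨r₁, k₁, hr₁, hk₁, hB₁, h₁⟩ := hS.goodBox.exists_lt hS.zero_mem_inside
    obtain ⟨r, k, hr, hk, hB, h₂⟩ := hB₁.exists_lt h₁
    obtain ⟨r', k', hr', hk', hB', -⟩ := hB.exists_lt h₂
    have hν₁ : ν₁ ∉ closedBox r₁ k₁ := fun h => hi (closedBox_subset_openBox hr₁ hk₁ h)
    obtain ⟨T, hT, hT'⟩ := hS.exists_box_resolvent hB (hG.solution 0 hS.zero_mem_inside)
    have h := hS.tendsto_of_resolvent hB hB' hr' hk' hT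
      (s := fun z => S.source S.α ν₁ z + -S.tau ν₁ * S.kernel (ν₁ - z))
      (fun z hz => by
        have hz' := hB.closedBox_subset hz.1
        have hzν : z ≠ ν₁ := fun e => hν₁ (openBox_subset_closedBox _ _
          (closedBox_subset_openBox hr hk (e ▸ hz.1)))
        refine (analyticAt_source ?_ ?_).fun_add
          (analyticAt_const.fun_mul (hS.analyticAt_kernel_sub hz' hν))
        · rw [← neg_ne_zero, ← sinh_neg, show -(z - ν₁ - S.η) = ν₁ - z + S.η by ring]
          exact hS.sinh_add_η_ne_zero hν hz'
        · exact sinh_ne_zero_comm (hS.sinh_ne_zero hν hz' hzν.symm))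
      (fun z _ => meromorphicAt_sum_source S _ _ _ z)
      (hΨ.continuation_right ν₁ hν hΛ) (t := -S.tau ν₁) (x := ν₁)
      (fun σ hσ ν hν' _ => hS.Psi_eq_of_notMem hG hΨ hB₁ hB hr hk hT' hν hν₁ hΛ hσ hν')
      (hev.mono fun z hz => (analyticAt_source_of_re hz.ne').fun_add
        (analyticAt_const.fun_mul (analyticAt_kernel_of_re hz.ne)))
      ((S.tendsto_source_left S.α ν₁).add ((S.tendsto_kernel_sub ν₁).const_mul _))
    -- The term -τ(ν₁) (q^α - q^(-α)) occurs both in the limit of the source and in the explicit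
    -- part and cancels, leaving the value found for ν₁ inside.
    rwa [sub_add_cancel_right, neg_div] at h

theorem tendsto_Psi_left {ν₂ : ℂ} (hν : ν₂ ∈ S.domain) (hΛ : S.Λ₀ ν₂ ≠ 0) :
    Tendsto (fun ν₁ => Ψ ν₁ ν₂) (comap re atTop)
      (𝓝 (-((S.qpow (-S.α) - S.rho ν₂) / (1 + S.qpow (2 * S.κ))))) := by
  have h2 := hS.tendsto_tau.neg.mul (S.tendsto_source_left (-S.α) ν₂)
  -- With τ(∞) = 1/(1 + q^(-2κ)) the two contributions add up to (1 - τ(∞)) (ρ(ν₂) - q^(-α)), and 1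
  -- - τ(∞) = 1/(1 + q^(2κ)).
  have hlim : (1 - 2 / (1 + S.qpow (-2 * S.κ))) * (S.rho ν₂ - S.qpow (-S.α)) +
      -(1 / (1 + S.qpow (-2 * S.κ))) * (S.qpow (-S.α) - S.rho ν₂) =
      -((S.qpow (-S.α) - S.rho ν₂) / (1 + S.qpow (2 * S.κ))) := by
    have h3 := hS.ne_κ
    have h4 := hS.one_add_qpow_neg_ne_zero
    have h5 := S.qpow_mul_neg (2 * S.κ)
    rw [← neg_mul] at h5
    generalize S.qpow (2 * S.κ) = u at *
    generalize S.qpow (-2 * S.κ) = v at *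
    field_simp
    linear_combination (S.rho ν₂ - S.qpow (-S.α)) * h5
  have hB₁ := hS.goodBox
  by_cases hi : ν₂ ∈ S.inside
  · obtain ⟨r, k, hr, hk, hB, hm⟩ := hB₁.exists_lt hi
    obtain ⟨T, hT, hT'⟩ := hS.exists_box_resolvent hB (hG.solution 0 hS.zero_mem_inside)
    have h1 := (hS.tendsto_sourceInt_resolvent hB hT
      (hS.tendsto_sourceCont hB.r_pos.le hB.k_pos.le) hm).add h2
    rw [hlim] at h1
    refine h1.congr' ?_
    filter_upwards [S.eventually_domain, eventually_gt_re S.R, hS.eventually_Λ₀_ne_zero]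
      with l hl hlR hlΛ
    exact (hS.Psi_eq_of_notMem hG hΨ hB₁ hB hr hk hT' hl
      (fun h => absurd ((le_abs_self _).trans h.1) (not_le.2 hlR)) hlΛ
      (sourceCont_apply hB.r_pos.le hB.k_pos.le (hr.trans hlR)) hm).symm
  · obtain ⟨r, k, hr, hk, hB, h0⟩ := hB₁.exists_lt hS.zero_mem_inside
    obtain ⟨r', k', hr', hk', hB', -⟩ := hB.exists_lt h0
    have hν' : ν₂ ∉ closedBox r k := fun h => hi (closedBox_subset_openBox hr hk h)
    obtain ⟨T, hT, hT'⟩ := hS.exists_box_resolvent hB (hG.solution 0 hS.zero_mem_inside)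
    have hs : Tendsto (fun l => S.source S.α l ν₂ + -S.tau l * S.kernel (l - ν₂))
        (comap re atTop)
        (𝓝 ((1 - 2 / (1 + S.qpow (-2 * S.κ))) * (S.qpow (-S.α) - S.qpow S.α))) := by
      convert (hS.tendsto_source_right S.α ν₂).add
        (hS.tendsto_tau.neg.mul (S.tendsto_kernel_sub_left ν₂)) using 2
      ring
    have h1 := (hS.tendsto_sourceInt_resolvent_sub hB hT
      (hS.tendsto_sourceCont hB.r_pos.le hB.k_pos.le) hν hν' hΛ hs).add h2
    rw [hlim] at h1
    refine h1.congr' ?_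
    filter_upwards [S.eventually_domain, eventually_gt_re S.R, hS.eventually_Λ₀_ne_zero,
      eventually_gt_re ν₂.re] with l hl hlR hlΛ hlν
    have hl' : l ∉ closedBox S.R S.h := fun h =>
      absurd ((le_abs_self _).trans h.1) (not_le.2 hlR)
    have hσ := sourceCont_apply (S := S) hB.r_pos.le hB.k_pos.le (hr.trans hlR)
    exact (hS.eq_of_resolvent hB hB' hr' hk' hT
      (s := fun z => S.source S.α l z + -S.tau l * S.kernel (l - z))
      (fun z hz => by
        have : z.re ≠ l.re :=
          ((le_abs_self _).trans (hz.1.1.trans hB.r_le)).trans_lt hlR |>.ne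
        exact (analyticAt_source_of_re this).fun_add
          (analyticAt_const.fun_mul (analyticAt_kernel_of_re this.symm)))
      (fun z _ => meromorphicAt_sum_source S _ _ _ z) hσ
      (hΨ.continuation_right l hl hlΛ) (t := -S.tau l) (x := l)
      (fun ν hν _ => hS.Psi_eq_of_notMem hG hΨ hB₁ hB hr hk hT' hl hl' hlΛ hσ hν) hν hν' hΛ
      ((analyticAt_source_of_re hlν.ne).fun_add
        (analyticAt_const.fun_mul (analyticAt_kernel_of_re hlν.ne')))
      (Or.inr (sinh_source_ne_zero_of_re hlν.ne'))).symm

end Admissible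

end Data

end SixVertex

theorem lemma2p1 (S : SixVertex.Data)
    (hγ : 0 < S.γ) (hγ' : S.γ < Real.pi / 2) (hM : 0 < S.M)
    -- the contour: a rectangle around the origin of height less than `γ`
    (hR : 0 < S.R) (hh : 0 < S.h) (hh' : S.h < S.γ / 2)
    -- the eigenvalues and `Q`-functions for the twists `κ` and `κ + α`
    (hΛ₀ : S.IsBaxterPair S.κ S.Λ₀ S.roots₀)
    (hΛ₁ : S.IsBaxterPair (S.κ + S.α) S.Λ₁ S.roots₁)
    -- the contour encloses the points `± β / N` and all Bethe roots
    (hβ : S.shift ∈ S.inside)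
    (hroots₀ : ∀ j, S.roots₀ j ∈ S.inside) (hroots₁ : ∀ j, S.roots₁ j ∈ S.inside)
    -- the eigenvalues have no zeros on or inside the contour
    (hne₀ : ∀ z ∈ S.closedInside, S.Λ₀ z ≠ 0) (hne₁ : ∀ z ∈ S.closedInside, S.Λ₁ z ≠ 0)
    -- the denominators in the limits do not vanish
    (hκ : 1 + S.qpow (2 * S.κ) ≠ 0)
    (G Ψ : ℂ → ℂ → ℂ) (hG : S.IsG G) (hΨ : S.IsPsi G Ψ) :
    (∀ ν ∈ S.domain, S.Λ₀ ν ≠ 0 →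
      Tendsto (fun l => G l ν) (comap Complex.re atTop) (𝓝 0)) ∧
    (∀ l ∈ S.domain,
      Tendsto (fun ν => G l ν) (comap Complex.re atTop) (𝓝 0)) ∧
    (∀ ν₂ ∈ S.domain, S.Λ₀ ν₂ ≠ 0 →
      Tendsto (fun ν₁ => Ψ ν₁ ν₂) (comap Complex.re atTop)
        (𝓝 (-((S.qpow (-S.α) - S.rho ν₂) / (1 + S.qpow (2 * S.κ)))))) ∧
    (∀ ν₁ ∈ S.domain, S.Λ₀ ν₁ ≠ 0 →
      Tendsto (fun ν₂ => Ψ ν₁ ν₂) (comap Complex.re atTop)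
        (𝓝 (-((S.qpow S.α - S.rho ν₁) / (1 + S.qpow (-2 * S.κ)))))) := by
  have hS : S.Admissible :=
    ⟨hγ, hγ', hR, hh, hh', hΛ₀, hΛ₁, hβ, hroots₀, hroots₁, hne₀, hne₁, hκ⟩
  exact ⟨fun ν hν hΛ => hS.tendsto_G_left hG hν hΛ, fun l hl => hS.tendsto_G_right hG hl,
    fun ν₂ hν hΛ => hS.tendsto_Psi_left hG hΨ hν hΛ,
    fun ν₁ hν hΛ => hS.tendsto_Psi_right hG hΨ hν hΛ⟩
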